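/- Let $k$ be an algebraically closed field of characteristic $0$, complete with respect to a nontrivial non-archimedean absolute value. Let $D_1,D_2$ be strict open discs over $k$ (in the sense of Berkovich), let $\varphi\colon D_2\to D_1$ be a finite étale morphism of degree $d$, and let $x\in D_1(k)$ be a rational point. Normalize the radius of $D_1$ to be $1$; for $s\in(0,1]$ let $D(x,s^-)\subseteq D_1$ be the open disc of radius $s$ centred at $x$, and let $N_x(s)$ be the number of connected components of $\varphi^{-1}(D(x,s^-))$. The break-points of $N_x$ are its points of discontinuity in $(0,1)$ together with $0$ and $1$. Let $(\mathcal F,\nabla)=\varphi_*(\mathcal O,d)$ be the pushforward of the constant connection $(\mathcal O,d)$ on $D_2$, which is a differential equation of rank $d$ on $D_1$; for $1\le j\le d$, let $$\mathcal R_j\big(x,\varphi_*(\mathcal O,d)\big)=\sup\big\{s\in(0,1) : \dim_k H^0\big(D(x,s^-),(\mathcal F,\nabla)\big)\ge d-j+1\big\}$$ be its $j$-th radius of convergence at $x$, where $H^0$ denotes the space of horizontal sections. Then $N_x$ has finitely many break-points. Let $0=s_0<s_1<\dots<s_{n-1}<s_n=1$ be the break-points, and set $n_{x,i}:=N_x(s_i)$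 for $i=1,\dots,n$. Then $n_{x,1}=d$, $n_{x,n}=1$, and $$\mathcal R_j\big(x,\varphi_*(\mathcal O,d)\big)=s_i\qquad\text{for } 1\le i\le n-1 \text{ and } d-n_{x,i}<j\le d-n_{x,i+1},$$ $$\mathcal R_d\big(x,\varphi_*(\mathcal O,d)\big)=1.$$ In other words, the radii of $\varphi_*(\mathcal O,d)$ at $x$ are $s_1,\dots,s_{n-1}$, where $s_i$ appears exactly $n_{x,i}-n_{x,i+1}$ times, together with exactly one radius equal to $1$. -/

import Mathlib

open Polynomial Topology TopologicalSpace

universe u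

namespace PushConst

/-! ### Auxiliary estimates for rational functions on discs -/

theorem exists_norm_mem_Ioo {k : Type u} [NontriviallyNormedField k] [IsAlgClosed k]
    {α β : ℝ} (hα : 0 < α) (h : α < β) : ∃ s : k, α < ‖s‖ ∧ ‖s‖ < β := by
  obtain ⟨c, hc⟩ := NormedField.exists_one_lt_norm k
  have hβα : 1 < β / α := by rwa [one_lt_div hα]
  obtain ⟨n, hn⟩ := pow_unbounded_of_one_lt ‖c‖ hβα
  have hn0 : n ≠ 0 := by rintro rfl; simp at hn; linarith
  obtain ⟨t, ht⟩ := IsAlgClosed.exists_pow_nat_eq c (Nat.pos_of_ne_zero hn0)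
  have ht1 : 1 < ‖t‖ := by
    by_contra hcon
    have : ‖t‖ ^ n ≤ 1 := pow_le_one₀ (norm_nonneg _) (not_lt.1 hcon)
    rw [← norm_pow, ht] at this; linarith
  have ht2 : ‖t‖ < β / α := by
    rw [← ht, norm_pow] at hn
    exact lt_of_pow_lt_pow_left₀ n (by positivity) hn
  obtain ⟨m, hm1, hm2⟩ := exists_mem_Ico_zpow hα ht1
  refine ⟨t ^ (m + 1), by rw [norm_zpow]; exact hm2, ?_⟩
  rw [norm_zpow, zpow_add_one₀ (by positivity)]
  rw [lt_div_iff₀ hα] at ht2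
  calc ‖t‖ ^ m * ‖t‖ ≤ α * ‖t‖ := by gcongr
    _ < β := by linarith

theorem exists_norm_avoid {k : Type u} [NontriviallyNormedField k] [IsAlgClosed k]
    {α β : ℝ} (hα : 0 < α) (h : α < β) {F : Set ℝ} (hF : F.Finite) :
    ∃ s : k, α < ‖s‖ ∧ ‖s‖ < β ∧ ‖s‖ ∉ F := by
  obtain ⟨x, hx, hxF⟩ := ((Set.Ioo_infinite h).sdiff hF).nonempty
  have hopen : IsOpen (Set.Ioo α β \ F) := isOpen_Ioo.sdiff hF.isClosed
  obtain ⟨ε, hε, hsub⟩ := Metric.isOpen_iff.1 hopen x ⟨hx, hxF⟩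
  have hx0 : 0 < x := hα.trans hx.1
  obtain ⟨s, hs1, hs2⟩ := exists_norm_mem_Ioo (k := k) (α := x) (β := x + ε) hx0 (by linarith)
  have := hsub (show ‖s‖ ∈ Metric.ball x ε by
    rw [Metric.mem_ball, Real.dist_eq, abs_lt]; constructor <;> linarith)
  exact ⟨s, this.1.1, this.1.2, this.2⟩

theorem norm_prod_roots {k : Type u} [NontriviallyNormedField k] (m : Multiset k) (z : k) :
    ‖(m.map fun x => z - x).prod‖ = (m.map fun x => ‖z - x‖).prod := by
  have := map_multiset_prod (normHom : k →*₀ ℝ) (m.map fun x => z - x)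
  simpa [Multiset.map_map] using this

theorem exists_sphere_bound {k : Type u} [NontriviallyNormedField k] [IsUltrametricDist k]
    [IsAlgClosed k] (p : k[X]) (a : k) {ρ : ℝ} (hρ : 0 < ρ) :
    ∃ s : k, ρ / 2 < ‖s - a‖ ∧ ‖s - a‖ < ρ ∧
      ∀ b : k, ‖b - a‖ ≤ ρ / 2 → ‖p.eval b‖ ≤ ‖p.eval s‖ := by
  classical
  obtain ⟨t, ht1, ht2, ht3⟩ := exists_norm_avoid (k := k) (α := ρ / 2) (β := ρ) (by positivity)
    (by linarith) (F := (fun β : k => ‖β - a‖) '' (p.roots.toFinset : Set k))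
    (Set.Finite.image _ (Finset.finite_toSet _))
  refine ⟨a + t, by simpa using ht1, by simpa using ht2, fun b hb => ?_⟩
  rw [(IsAlgClosed.splits p).eval_eq_prod_roots, (IsAlgClosed.splits p).eval_eq_prod_roots,
    norm_mul, norm_mul]
  gcongr
  rw [norm_prod_roots, norm_prod_roots]
  refine Multiset.prod_map_le_prod_map₀ _ _ (fun _ _ => norm_nonneg _) (fun r hr => ?_)
  have hne : ‖t‖ ≠ ‖r - a‖ := fun h =>
    ht3 ⟨r, by rw [Finset.mem_coe, Multiset.mem_toFinset]; exact hr, h.symm⟩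
  have e1 : a + t - r = t + (a - r) := by ring
  rw [e1, IsUltrametricDist.norm_add_eq_max_of_norm_ne_norm (by rwa [norm_sub_rev a r])]
  calc ‖b - r‖ = ‖(b - a) + (a - r)‖ := by ring_nf
    _ ≤ max ‖b - a‖ ‖a - r‖ := IsUltrametricDist.norm_add_le_max _ _
    _ ≤ _ := max_le_max (by linarith) le_rfl

theorem norm_eval_const {k : Type u} [NontriviallyNormedField k] [IsUltrametricDist k]
    [IsAlgClosed k] (q : k[X]) (a : k) {ρ : ℝ} (hq : ∀ b, ‖b - a‖ ≤ ρ → q.eval b ≠ 0)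
    (b : k) (hb : ‖b - a‖ ≤ ρ) : ‖q.eval b‖ = ‖q.eval a‖ := by
  rw [(IsAlgClosed.splits q).eval_eq_prod_roots, (IsAlgClosed.splits q).eval_eq_prod_roots,
    norm_mul, norm_mul]
  congr 1
  rw [norm_prod_roots, norm_prod_roots]
  congr 1
  refine Multiset.map_congr rfl (fun r hr => ?_)
  have hr0 : q.eval r = 0 := (Polynomial.mem_roots'.1 hr).2
  have hlt : ρ < ‖a - r‖ := by
    by_contra h
    exact hq r (by rw [norm_sub_rev]; exact not_lt.1 h) hr0
  have e1 : b - r = (b - a) + (a - r) := by ring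
  rw [e1, IsUltrametricDist.norm_add_eq_max_of_norm_ne_norm (by linarith : ‖b - a‖ < ‖a - r‖).ne]
  exact max_eq_right (by linarith)

/-- A rational function without poles on a closed disc that is bounded there by `M` is Lipschitz
around the centre, with a constant proportional to `M`. -/
theorem rational_lipschitz {k : Type u} [NontriviallyNormedField k] [IsUltrametricDist k]
    [IsAlgClosed k] (p q : k[X]) (a : k) {ρ M : ℝ} (hρ : 0 < ρ)
    (hq : ∀ b, ‖b - a‖ ≤ ρ → q.eval b ≠ 0)
    (hM : ∀ b, ‖b - a‖ ≤ ρ → ‖p.eval b / q.eval b‖ ≤ M) (b : k) (hb : ‖b - a‖ ≤ ρ) :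
    ‖p.eval b / q.eval b - p.eval a / q.eval a‖ ≤ 4 * M / ρ * ‖b - a‖ := by
  have ha : ‖a - a‖ ≤ ρ := by simp [hρ.le]
  have hM0 : 0 ≤ M := (norm_nonneg _).trans (hM a ha)
  have hdiff : ∀ b, ‖b - a‖ ≤ ρ → ‖p.eval b / q.eval b - p.eval a / q.eval a‖ ≤ 2 * M := by
    intro b hb
    calc _ ≤ _ := norm_sub_le _ _
      _ ≤ 2 * M := by linarith [hM a ha, hM b hb]
  rcases le_or_gt ‖b - a‖ (ρ / 2) with hb2 | hb2
  · set N : k[X] := p * C (q.eval a) - C (p.eval a) * q with hN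
    have hroot : N.IsRoot a := by simp [hN, mul_comm]
    obtain ⟨N1, hN1⟩ := Polynomial.dvd_iff_isRoot.2 hroot
    have hval : ∀ c, ‖c - a‖ ≤ ρ → ‖p.eval c / q.eval c - p.eval a / q.eval a‖ * ‖q.eval a‖ ^ 2 =
        ‖c - a‖ * ‖N1.eval c‖ := by
      intro c hc
      have h1 : N.eval c = (c - a) * N1.eval c := by rw [hN1]; simp
      rw [← norm_mul, ← h1]
      conv_lhs => rw [sq]; arg 2; arg 1; rw [← norm_eval_const q a hq c hc]
      rw [← norm_mul, ← norm_mul]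
      congr 1
      have := hq c hc
      have := hq a ha
      simp only [hN, eval_sub, eval_mul, eval_C]
      field_simp
    obtain ⟨s, hs1, hs2, hs3⟩ := exists_sphere_bound N1 a hρ
    have hqa : 0 < ‖q.eval a‖ := norm_pos_iff.2 (hq a ha)
    have h1 := hval b hb
    have h2 := hval s hs2.le
    have h3 := hdiff s hs2.le
    have h4 := hs3 b hb2
    have h5 : ρ / 2 * ‖N1.eval b‖ ≤ 2 * M * ‖q.eval a‖ ^ 2 := by
      calc ρ / 2 * ‖N1.eval b‖ ≤ ‖s - a‖ * ‖N1.eval s‖ := by gcongr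
        _ = _ := h2.symm
        _ ≤ _ := by gcongr
    have h6 : ‖N1.eval b‖ ≤ 4 * M / ρ * ‖q.eval a‖ ^ 2 := by
      rw [div_mul_eq_mul_div, le_div_iff₀ hρ]; nlinarith
    have h7 : ‖p.eval b / q.eval b - p.eval a / q.eval a‖ * ‖q.eval a‖ ^ 2 ≤
        (4 * M / ρ * ‖b - a‖) * ‖q.eval a‖ ^ 2 := by
      rw [h1]
      calc ‖b - a‖ * ‖N1.eval b‖ ≤ ‖b - a‖ * (4 * M / ρ * ‖q.eval a‖ ^ 2) := by gcongr
        _ = _ := by ring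
    exact le_of_mul_le_mul_right h7 (by positivity)
  · refine (hdiff b hb).trans ?_
    rw [div_mul_eq_mul_div, le_div_iff₀ hρ]
    nlinarith

theorem polynomial_lipschitz {k : Type u} [NontriviallyNormedField k] (P : k[X]) (M : ℝ) :
    ∃ C : ℝ, 0 ≤ C ∧ ∀ a b : k, ‖a‖ ≤ M → ‖b‖ ≤ M →
      ‖P.eval b‖ ≤ C ∧ ‖P.eval b - P.eval a‖ ≤ C * ‖b - a‖ := by
  induction P using Polynomial.induction_on with
  | C c => exact ⟨‖c‖, norm_nonneg _, fun a b _ _ => by simp; positivity⟩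
  | add p q hp hq =>
    obtain ⟨C1, h1, h1'⟩ := hp
    obtain ⟨C2, h2, h2'⟩ := hq
    refine ⟨C1 + C2, by positivity, fun a b ha hb => ⟨?_, ?_⟩⟩
    · rw [eval_add]
      exact (norm_add_le _ _).trans (add_le_add (h1' a b ha hb).1 (h2' a b ha hb).1)
    · rw [eval_add, eval_add, add_sub_add_comm, add_mul]
      exact (norm_add_le _ _).trans (add_le_add (h1' a b ha hb).2 (h2' a b ha hb).2)
  | monomial n c h =>
    obtain ⟨C1, h1, h1'⟩ := h
    refine ⟨C1 * |M| + C1, by positivity, fun a b ha hb => ?_⟩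
    have e : ∀ z : k, (C c * X ^ (n + 1)).eval z = (C c * X ^ n).eval z * z := by
      intro z; simp [pow_succ, mul_assoc]
    have hb' : ‖b‖ ≤ |M| := hb.trans (le_abs_self M)
    obtain ⟨h2, h3⟩ := h1' a b ha hb
    have h4 := (h1' b a hb ha).1
    rw [e, e]
    constructor
    · rw [norm_mul]
      nlinarith [norm_nonneg b, norm_nonneg ((C c * X ^ n).eval b)]
    · have : (C c * X ^ n).eval b * b - (C c * X ^ n).eval a * a =
          ((C c * X ^ n).eval b - (C c * X ^ n).eval a) * b + (C c * X ^ n).eval a * (b - a) := by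
        ring
      rw [this, add_mul]
      refine (norm_add_le _ _).trans (add_le_add ?_ ?_)
      · rw [norm_mul]
        calc _ ≤ (C1 * ‖b - a‖) * |M| := by gcongr
          _ = _ := by ring
      · rw [norm_mul]; gcongr

/-! ### The Berkovich affine line and its open discs -/

/-- A point of the analytic affine line over `k`: a multiplicative seminorm on `k[T]` that extends
the norm of `k`. -/
structure BerkovichLine (k : Type u) [NontriviallyNormedField k] where
  seminorm : MulRingSeminorm k[X]
  seminorm_C : ∀ a : k, seminorm (C a) = ‖a‖

/-- The coarsest topology for which all the evaluations `v ↦ |P(v)|`, `P ∈ k[T]`, are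
continuous. -/
noncomputable instance {k : Type u} [NontriviallyNormedField k] : TopologicalSpace (BerkovichLine k) :=
  TopologicalSpace.induced (fun v (P : k[X]) => v.seminorm P) inferInstance

theorem BerkovichLine.isInducing (k : Type u) [NontriviallyNormedField k] :
    Topology.IsInducing fun (v : BerkovichLine k) (P : k[X]) => v.seminorm P := ⟨rfl⟩

/-- The rational point `a`, that is the seminorm `P ↦ |P(a)|`. -/
noncomputable def BerkovichLine.rational {k : Type u} [NontriviallyNormedField k] (a : k) : BerkovichLine k where
  seminorm :=
    { toFun := fun P => ‖P.eval a‖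
      map_zero' := by simp
      add_le' := fun P Q => by simpa using norm_add_le (P.eval a) (Q.eval a)
      neg' := fun P => by simp
      map_one' := by simp
      map_mul' := fun P Q => by simp }
  seminorm_C := fun b => by
    change ‖(C b).eval a‖ = ‖b‖
    simp

theorem BerkovichLine.rational_apply {k : Type u} [NontriviallyNormedField k] (a : k) (P : k[X]) :
    (BerkovichLine.rational a).seminorm P = ‖P.eval a‖ := rfl

/-- A strict open disc `D(c, R⁻)`, with `c ∈ k` and `R ∈ |k^*|`. -/
structure StrictOpenDisc (k : Type u) [NontriviallyNormedField k] where
  center : k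
  radius : ℝ
  radius_pos : 0 < radius
  radius_mem : ∃ b : k, ‖b‖ = radius

/-- The points of the disc (in the sense of Berkovich), with the topology induced by the line. -/
abbrev StrictOpenDisc.Point {k : Type u} [NontriviallyNormedField k] (D : StrictOpenDisc k) :
    Type u :=
  {v : BerkovichLine k // v.seminorm (X - C D.center) < D.radius}

/-- The set `D(k)` of rational points. -/
abbrev StrictOpenDisc.RatPoint {k : Type u} [NontriviallyNormedField k] (D : StrictOpenDisc k) :
    Type u :=
  {a : k // ‖a - D.center‖ < D.radius}

/-- A rational point, seen as a point of the disc. -/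
noncomputable def StrictOpenDisc.ratPt {k : Type u} [NontriviallyNormedField k] (D : StrictOpenDisc k)
    (a : D.RatPoint) : D.Point :=
  ⟨BerkovichLine.rational a.1, by
    rw [BerkovichLine.rational_apply]
    simpa using a.2⟩

theorem continuous_seminorm {k : Type u} [NontriviallyNormedField k] (D : StrictOpenDisc k)
    (P : k[X]) : Continuous fun v : D.Point => v.1.seminorm P :=
  ((continuous_apply P).comp (BerkovichLine.isInducing k).continuous).comp continuous_subtype_val

/-- For a rational point `x` of `D` and `s ∈ (0, 1]`, the disc `D(x, s⁻)`, where `s` is normalized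
so that `D` has radius `1`. -/
noncomputable def StrictOpenDisc.subdisc {k : Type u} [NontriviallyNormedField k] (D : StrictOpenDisc k)
    (x : D.RatPoint) (s : ℝ) : Opens D.Point :=
  ⟨{v | v.1.seminorm (X - C x.1) < s * D.radius},
    isOpen_lt (continuous_seminorm D _) continuous_const⟩

/-! ### Analytic functions -/

/-- The set `U(k)` of rational points of an open subset `U` of the disc. -/
abbrev RatIn {k : Type u} [NontriviallyNormedField k] {D : StrictOpenDisc k}
    (U : Opens D.Point) : Type u :=
  {a : D.RatPoint // D.ratPt a ∈ U}

/-- Analytic functions on `U`: local uniform limits of rational functions without poles, where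
"local" refers to the Berkovich topology. Since `k` is algebraically closed and nontrivially valued,
`U(k)` is dense in `U`, so that an analytic function may be, and is here, given by its values at
the rational points. -/
def IsAnalytic {k : Type u} [NontriviallyNormedField k] {D : StrictOpenDisc k}
    {U : Opens D.Point} (f : RatIn U → k) : Prop :=
  ∀ y ∈ U, ∃ V : Opens D.Point, y ∈ V ∧ V ≤ U ∧ ∀ ε : ℝ, 0 < ε → ∃ p q : k[X],
    (∀ v ∈ V, v.1.seminorm q ≠ 0) ∧
    ∀ a : RatIn U, D.ratPt a.1 ∈ V → ‖f a - p.eval a.1.1 / q.eval a.1.1‖ ≤ ε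

theorem eval_ne_zero {k : Type u} [NontriviallyNormedField k] {D : StrictOpenDisc k}
    {V : Opens D.Point} {q : k[X]} (hq : ∀ v ∈ V, v.1.seminorm q ≠ 0) {a : D.RatPoint}
    (ha : D.ratPt a ∈ V) : q.eval a.1 ≠ 0 :=
  norm_ne_zero_iff.1 (hq _ ha)

theorem isAnalytic_polynomial {k : Type u} [NontriviallyNormedField k] {D : StrictOpenDisc k}
    {U : Opens D.Point} (p : k[X]) : IsAnalytic (U := U) fun a => p.eval a.1.1 :=
  fun y hy => ⟨U, hy, le_rfl, fun ε hε => ⟨p, 1, fun v _ => by simp, fun a _ => by simp [hε.le]⟩⟩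

theorem isAnalytic_mono {k : Type u} [NontriviallyNormedField k] {D : StrictOpenDisc k}
    {U V : Opens D.Point} (h : V ≤ U) {f : RatIn U → k} (hf : IsAnalytic f) :
    IsAnalytic (U := V) fun a => f ⟨a.1, h a.2⟩ := by
  intro y hy
  obtain ⟨W, hyW, hWU, hW⟩ := hf y (h hy)
  refine ⟨W ⊓ V, ⟨hyW, hy⟩, inf_le_right, fun ε hε => ?_⟩
  obtain ⟨p, q, hq, hpq⟩ := hW ε hε
  exact ⟨p, q, fun v hv => hq v hv.1, fun a ha => hpq ⟨a.1, h a.2⟩ ha.1⟩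

theorem isAnalytic_of_local {k : Type u} [NontriviallyNormedField k] {D : StrictOpenDisc k}
    {U : Opens D.Point} {f : RatIn U → k}
    (hf : ∀ y ∈ U, ∃ (V : Opens D.Point) (h : V ≤ U), y ∈ V ∧
      IsAnalytic (U := V) fun a => f ⟨a.1, h a.2⟩) : IsAnalytic f := by
  intro y hy
  obtain ⟨V, hVU, hyV, hV⟩ := hf y hy
  obtain ⟨W, hyW, hWV, hW⟩ := hV y hyV
  refine ⟨W, hyW, hWV.trans hVU, fun ε hε => ?_⟩
  obtain ⟨p, q, hq, hpq⟩ := hW ε hε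
  exact ⟨p, q, hq, fun a ha => hpq ⟨a.1, hWV ha⟩ ha⟩

theorem isAnalytic_bounded {k : Type u} [NontriviallyNormedField k] {D : StrictOpenDisc k}
    {U : Opens D.Point} {f : RatIn U → k} (hf : IsAnalytic f) {y : D.Point} (hy : y ∈ U) :
    ∃ V : Opens D.Point, y ∈ V ∧ V ≤ U ∧ ∃ B : ℝ, 0 ≤ B ∧
      ∀ a : RatIn U, D.ratPt a.1 ∈ V → ‖f a‖ ≤ B := by
  obtain ⟨W, hyW, hWU, hW⟩ := hf y hy
  obtain ⟨p, q, hq, hpq⟩ := hW 1 one_pos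
  have hq0 : 0 < y.1.seminorm q := lt_of_le_of_ne (apply_nonneg _ _) (hq y hyW).symm
  let W1 : Opens D.Point := ⟨{v | v.1.seminorm p < y.1.seminorm p + 1},
    isOpen_lt (continuous_seminorm D p) continuous_const⟩
  let W2 : Opens D.Point := ⟨{v | y.1.seminorm q / 2 < v.1.seminorm q},
    isOpen_lt continuous_const (continuous_seminorm D q)⟩
  have hp0 : 0 ≤ y.1.seminorm p := apply_nonneg _ _
  refine ⟨W ⊓ (W1 ⊓ W2), ⟨hyW, show y.1.seminorm p < y.1.seminorm p + 1 by linarith,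
    show y.1.seminorm q / 2 < y.1.seminorm q by linarith⟩,
    inf_le_left.trans hWU, 1 + (y.1.seminorm p + 1) / (y.1.seminorm q / 2), by positivity, ?_⟩
  rintro a ⟨ha, ha1, ha2⟩
  have ha1 : ‖p.eval a.1.1‖ < y.1.seminorm p + 1 := ha1
  have ha2 : y.1.seminorm q / 2 < ‖q.eval a.1.1‖ := ha2
  calc ‖f a‖ = ‖(f a - p.eval a.1.1 / q.eval a.1.1) + p.eval a.1.1 / q.eval a.1.1‖ := by ring_nf
    _ ≤ _ := norm_add_le _ _
    _ ≤ _ := add_le_add (hpq a ha) (by rw [norm_div]; gcongr)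

theorem isAnalytic_add {k : Type u} [NontriviallyNormedField k] {D : StrictOpenDisc k}
    {U : Opens D.Point} {f g : RatIn U → k} (hf : IsAnalytic f) (hg : IsAnalytic g) :
    IsAnalytic (f + g) := by
  intro y hy
  obtain ⟨V, hyV, hVU, hV⟩ := hf y hy
  obtain ⟨W, hyW, hWU, hW⟩ := hg y hy
  refine ⟨V ⊓ W, ⟨hyV, hyW⟩, inf_le_left.trans hVU, fun ε hε => ?_⟩
  obtain ⟨p, q, hq, hpq⟩ := hV (ε / 2) (by positivity)
  obtain ⟨p', q', hq', hpq'⟩ := hW (ε / 2) (by positivity)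
  refine ⟨p * q' + p' * q, q * q', fun v hv => ?_, fun a ha => ?_⟩
  · rw [map_mul]; exact mul_ne_zero (hq v hv.1) (hq' v hv.2)
  · have h1 := eval_ne_zero hq ha.1
    have h2 := eval_ne_zero hq' ha.2
    have e : (f + g) a - (p * q' + p' * q).eval a.1.1 / (q * q').eval a.1.1 =
        (f a - p.eval a.1.1 / q.eval a.1.1) + (g a - p'.eval a.1.1 / q'.eval a.1.1) := by
      simp only [Pi.add_apply, eval_add, eval_mul]
      field_simp
      ring
    rw [e]
    linarith [norm_add_le (f a - p.eval a.1.1 / q.eval a.1.1)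
      (g a - p'.eval a.1.1 / q'.eval a.1.1), hpq a ha.1, hpq' a ha.2]

theorem isAnalytic_mul {k : Type u} [NontriviallyNormedField k] {D : StrictOpenDisc k}
    {U : Opens D.Point} {f g : RatIn U → k} (hf : IsAnalytic f) (hg : IsAnalytic g) :
    IsAnalytic (f * g) := by
  intro y hy
  obtain ⟨V, hyV, hVU, hV⟩ := hf y hy
  obtain ⟨W, hyW, hWU, hW⟩ := hg y hy
  obtain ⟨V', hyV', -, B, hB, hVB⟩ := isAnalytic_bounded hf hy
  obtain ⟨W', hyW', -, B', hB', hWB⟩ := isAnalytic_bounded hg hy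
  refine ⟨(V ⊓ W) ⊓ (V' ⊓ W'), ⟨⟨hyV, hyW⟩, hyV', hyW'⟩,
    (inf_le_left.trans inf_le_left).trans hVU, fun ε hε => ?_⟩
  set δ : ℝ := min 1 (ε / (B + B' + 1)) with hδ
  have hδ0 : 0 < δ := by positivity
  have hδ1 : δ ≤ 1 := min_le_left _ _
  have hδ2 : δ * (B + B' + 1) ≤ ε := by
    rw [← le_div_iff₀ (by positivity)]; exact min_le_right _ _
  obtain ⟨p, q, hq, hpq⟩ := hV δ hδ0
  obtain ⟨p', q', hq', hpq'⟩ := hW δ hδ0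
  refine ⟨p * p', q * q', fun v hv => ?_, fun a ha => ?_⟩
  · rw [map_mul]; exact mul_ne_zero (hq v hv.1.1) (hq' v hv.1.2)
  · have h1 := hpq a ha.1.1
    have h2 := hpq' a ha.1.2
    have h3 := hVB a ha.2.1
    have h4 := hWB a ha.2.2
    set r := p.eval a.1.1 / q.eval a.1.1
    set r' := p'.eval a.1.1 / q'.eval a.1.1
    have e : (f * g) a - (p * p').eval a.1.1 / (q * q').eval a.1.1 =
        (f a - r) * g a + (f a - (f a - r)) * (g a - r') := by
      simp only [Pi.mul_apply, eval_mul, r, r', mul_div_mul_comm]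
      ring
    rw [e]
    refine (norm_add_le _ _).trans ?_
    rw [norm_mul, norm_mul]
    have h5 : ‖f a - (f a - r)‖ ≤ B + δ := (norm_sub_le _ _).trans (add_le_add h3 h1)
    calc ‖f a - r‖ * ‖g a‖ + ‖f a - (f a - r)‖ * ‖g a - r'‖ ≤ δ * B' + (B + δ) * δ := by
          gcongr
      _ ≤ δ * (B + B' + 1) := by nlinarith
      _ ≤ ε := hδ2

/-- The `k`-algebra `𝒪(U)` of analytic functions on `U`. -/
noncomputable def analytic {k : Type u} [NontriviallyNormedField k] {D : StrictOpenDisc k}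
    (U : Opens D.Point) : Subalgebra k (RatIn U → k) where
  carrier := {f | IsAnalytic f}
  mul_mem' := isAnalytic_mul
  add_mem' := isAnalytic_add
  algebraMap_mem' := fun c => by
    have := isAnalytic_polynomial (U := U) (C c)
    simp only [eval_C] at this
    exact this

/-- The restriction `𝒪(U) → 𝒪(V)`, for `V ⊆ U`. -/
noncomputable def restrict {k : Type u} [NontriviallyNormedField k] {D : StrictOpenDisc k}
    {U V : Opens D.Point} (h : V ≤ U) : analytic U →ₐ[k] analytic V where
  toFun f := ⟨fun a => f.1 ⟨a.1, h a.2⟩, isAnalytic_mono h f.2⟩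
  map_one' := rfl
  map_mul' _ _ := rfl
  map_zero' := rfl
  map_add' _ _ := rfl
  commutes' _ := rfl

/-! ### The derivation `d/dT` -/

/-- Extension by zero of a function on `U(k)` to a function on `k`. -/
noncomputable def zeroExt {k : Type u} [NontriviallyNormedField k] {D : StrictOpenDisc k}
    {U : Opens D.Point} (f : RatIn U → k) : k → k :=
  Function.extend (fun a : RatIn U => a.1.1) f 0

theorem zeroExt_apply {k : Type u} [NontriviallyNormedField k] {D : StrictOpenDisc k}
    {U : Opens D.Point} (f : RatIn U → k) (a : RatIn U) : zeroExt f a.1.1 = f a :=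
  Function.Injective.extend_apply
    (fun _ _ h => Subtype.ext (Subtype.ext h)) f 0 a

/-- Every neighbourhood `V` of `y` contains the discs of some fixed positive radius around the
rational points of a smaller neighbourhood of `y`. -/
theorem exists_uniform_radius {k : Type u} [NontriviallyNormedField k] [IsUltrametricDist k]
    {D : StrictOpenDisc k} {V : Opens D.Point} {y : D.Point} (hy : y ∈ V) :
    ∃ W : Opens D.Point, y ∈ W ∧ W ≤ V ∧ ∃ ρ : ℝ, 0 < ρ ∧
      ∀ a : D.RatPoint, D.ratPt a ∈ W → ∀ b : k, ‖b - a.1‖ ≤ ρ →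
        ∃ h : ‖b - D.center‖ < D.radius, D.ratPt ⟨b, h⟩ ∈ V := by
  have hind : Topology.IsInducing (fun (v : D.Point) (P : k[X]) => v.1.seminorm P) :=
    (BerkovichLine.isInducing k).comp Topology.IsInducing.subtypeVal
  have hV : (V : Set D.Point) ∈ 𝓝 y := V.isOpen.mem_nhds hy
  rw [hind.nhds_eq_comap, Filter.mem_comap] at hV
  obtain ⟨S, hS, hSV⟩ := hV
  rw [nhds_pi, Filter.mem_pi] at hS
  obtain ⟨I, hI, t, ht, htS⟩ := hS
  have hball : ∀ P : k[X], ∃ δ : ℝ, 0 < δ ∧ Metric.ball (y.1.seminorm P) δ ⊆ t P :=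
    fun P => Metric.mem_nhds_iff.1 (ht P)
  choose δ hδ hδt using hball
  choose L hL0 hL using fun P : k[X] => polynomial_lipschitz (k := k) P (‖D.center‖ + D.radius)
  let W : Opens D.Point := V ⊓ ⟨{v | ∀ P ∈ I, v.1.seminorm P ∈
      Metric.ball (y.1.seminorm P) (δ P / 2)}, by
    have : {v : D.Point | ∀ P ∈ I, v.1.seminorm P ∈ Metric.ball (y.1.seminorm P) (δ P / 2)} =
        ⋂ P ∈ I, (fun v : D.Point => v.1.seminorm P) ⁻¹'
          Metric.ball (y.1.seminorm P) (δ P / 2) := by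
      ext v; simp
    rw [this]
    exact hI.isOpen_biInter fun P _ => Metric.isOpen_ball.preimage (continuous_seminorm D P)⟩
  have hρ : ∃ ρ : ℝ, 0 < ρ ∧ ρ < D.radius ∧ ∀ P ∈ I, L P * ρ < δ P / 2 := by
    have h1 : ∀ᶠ ρ in 𝓝[>] (0 : ℝ), ∀ P ∈ I, L P * ρ < δ P / 2 := by
      refine (Filter.eventually_all_finite hI).2 fun P _ => ?_
      have : Filter.Tendsto (fun ρ : ℝ => L P * ρ) (𝓝[>] 0) (𝓝 0) := by
        have : Continuous fun ρ : ℝ => L P * ρ := by fun_prop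
        simpa using (this.tendsto 0).mono_left nhdsWithin_le_nhds
      exact this.eventually (gt_mem_nhds (by linarith [hδ P]))
    have h2 : ∀ᶠ ρ in 𝓝[>] (0 : ℝ), ρ < D.radius :=
      nhdsWithin_le_nhds (gt_mem_nhds D.radius_pos)
    obtain ⟨ρ, ⟨hρ1, hρ2⟩, hρ3⟩ := ((h1.and h2).and self_mem_nhdsWithin).exists
    exact ⟨ρ, hρ3, hρ2, hρ1⟩
  obtain ⟨ρ, hρ0, hρR, hρP⟩ := hρ
  refine ⟨W, ⟨hy, fun P _ => Metric.mem_ball_self (by linarith [hδ P])⟩, inf_le_left, ρ, hρ0, ?_⟩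
  rintro a ⟨-, haW⟩ b hb
  have hbD : ‖b - D.center‖ < D.radius := by
    have : b - D.center = (b - a.1) + (a.1 - D.center) := by ring
    rw [this]
    exact (IsUltrametricDist.norm_add_le_max _ _).trans_lt (max_lt (by linarith) a.2)
  have hnorm : ∀ z : k, ‖z - D.center‖ < D.radius → ‖z‖ ≤ ‖D.center‖ + D.radius := by
    intro z hz
    have : z = D.center + (z - D.center) := by ring
    rw [this]
    exact (norm_add_le _ _).trans (by simpa using hz.le)
  refine ⟨hbD, hSV (htS fun P hP => hδt P ?_)⟩
  have h1 := haW P hP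
  rw [Metric.mem_ball, Real.dist_eq] at h1 ⊢
  have h1 : |‖P.eval a.1‖ - y.1.seminorm P| < δ P / 2 := h1
  change |‖P.eval b‖ - y.1.seminorm P| < δ P
  have h2 := (hL P a.1 b (hnorm _ a.2) (hnorm _ hbD)).2
  have h3 := abs_norm_sub_norm_le (P.eval b) (P.eval a.1)
  have h4 : L P * ‖b - a.1‖ ≤ L P * ρ := mul_le_mul_of_nonneg_left hb (hL0 P)
  have h5 := hρP P hP
  calc |‖P.eval b‖ - y.1.seminorm P|
      = |(‖P.eval b‖ - ‖P.eval a.1‖) + (‖P.eval a.1‖ - y.1.seminorm P)| := by ring_nf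
    _ ≤ _ := abs_add_le _ _
    _ < δ P := by linarith

theorem eventually_mem {k : Type u} [NontriviallyNormedField k] [IsUltrametricDist k]
    {D : StrictOpenDisc k} {U : Opens D.Point} (a : RatIn U) :
    ∀ᶠ z in 𝓝 a.1.1, ∃ b : RatIn U, b.1.1 = z := by
  obtain ⟨W, hyW, -, ρ, hρ, h⟩ := exists_uniform_radius a.2
  filter_upwards [Metric.closedBall_mem_nhds a.1.1 hρ] with z hz
  rw [Metric.mem_closedBall, dist_eq_norm] at hz
  obtain ⟨h1, h2⟩ := h a.1 hyW z hz
  exact ⟨⟨⟨z, h1⟩, h2⟩, rfl⟩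

/-- Near each point, an analytic function is differentiable at the rational points and its
derivative is a uniform limit of the derivatives of rational approximations. -/
theorem exists_deriv_approx {k : Type u} [NontriviallyNormedField k] [IsUltrametricDist k]
    [CompleteSpace k] [IsAlgClosed k] {D : StrictOpenDisc k} {U : Opens D.Point} {f : RatIn U → k}
    (hf : IsAnalytic f) {y : D.Point} (hy : y ∈ U) :
    ∃ W : Opens D.Point, y ∈ W ∧ W ≤ U ∧
      (∀ a : RatIn U, D.ratPt a.1 ∈ W → DifferentiableAt k (zeroExt f) a.1.1) ∧
      ∀ ε : ℝ, 0 < ε → ∃ p q : k[X], (∀ v ∈ W, v.1.seminorm q ≠ 0) ∧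
        ∀ a : RatIn U, D.ratPt a.1 ∈ W →
          ‖deriv (zeroExt f) a.1.1 - p.eval a.1.1 / q.eval a.1.1‖ ≤ ε := by
  obtain ⟨V, hyV, hVU, hV⟩ := hf y hy
  obtain ⟨W, hyW, hWV, ρ, hρ, hball⟩ := exists_uniform_radius hyV
  have hclose : ∀ ε : ℝ, 0 < ε → ∃ p q : k[X], (∀ v ∈ V, v.1.seminorm q ≠ 0) ∧
      ∀ a : RatIn U, D.ratPt a.1 ∈ W → ∀ b : k, ‖b - a.1.1‖ ≤ ρ →
        q.eval b ≠ 0 ∧ ‖zeroExt f b - p.eval b / q.eval b‖ ≤ ε := by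
    intro ε hε
    obtain ⟨p, q, hq, hpq⟩ := hV ε hε
    refine ⟨p, q, hq, fun a ha b hb => ?_⟩
    obtain ⟨h1, h2⟩ := hball a.1 ha b hb
    have := hpq ⟨⟨b, h1⟩, hVU h2⟩ h2
    rw [← zeroExt_apply f] at this
    exact ⟨eval_ne_zero hq h2, this⟩
  have hlip : ∀ (ε : ℝ) (_ : 0 < ε) (p q : k[X]) (a : RatIn U), D.ratPt a.1 ∈ W →
      (∀ b : k, ‖b - a.1.1‖ ≤ ρ → q.eval b ≠ 0 ∧ ‖zeroExt f b - p.eval b / q.eval b‖ ≤ ε) →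
      ∀ b : k, ‖b - a.1.1‖ ≤ ρ →
        ‖(zeroExt f b - p.eval b / q.eval b) -
          (zeroExt f a.1.1 - p.eval a.1.1 / q.eval a.1.1)‖ ≤ 4 * ε / ρ * ‖b - a.1.1‖ := by
    intro ε hε p q a ha h b hb
    refine le_of_forall_pos_le_add fun η hη => ?_
    set C : ℝ := 2 + 4 / ρ * ‖b - a.1.1‖ with hC
    have hC0 : 0 < C := by positivity
    obtain ⟨p', q', -, h'⟩ := hclose (η / C) (by positivity)
    have h' := h' a ha
    have haa : ‖a.1.1 - a.1.1‖ ≤ ρ := by simp [hρ.le]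
    have hdiff : ∀ b : k, ‖b - a.1.1‖ ≤ ρ →
        (p' * q - p * q').eval b / (q' * q).eval b =
          p'.eval b / q'.eval b - p.eval b / q.eval b := by
      intro b hb
      have h1 := (h b hb).1
      have h2 := (h' b hb).1
      simp only [eval_sub, eval_mul]
      field_simp
    have key := rational_lipschitz (p' * q - p * q') (q' * q) a.1.1 (M := ε + η / C) hρ
      (fun b hb => by rw [eval_mul]; exact mul_ne_zero (h' b hb).1 (h b hb).1)
      (fun b hb => by
        rw [hdiff b hb]
        have e : p'.eval b / q'.eval b - p.eval b / q.eval b =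
          (zeroExt f b - p.eval b / q.eval b) - (zeroExt f b - p'.eval b / q'.eval b) := by ring
        rw [e]
        exact (norm_sub_le _ _).trans (add_le_add (h b hb).2 (h' b hb).2)) b hb
    rw [hdiff b hb, hdiff a.1.1 haa] at key
    have e : (zeroExt f b - p.eval b / q.eval b) -
          (zeroExt f a.1.1 - p.eval a.1.1 / q.eval a.1.1) =
        (zeroExt f b - p'.eval b / q'.eval b) -
          (zeroExt f a.1.1 - p'.eval a.1.1 / q'.eval a.1.1) +
        ((p'.eval b / q'.eval b - p.eval b / q.eval b) -
          (p'.eval a.1.1 / q'.eval a.1.1 - p.eval a.1.1 / q.eval a.1.1)) := by ring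
    rw [e]
    have h1 := (h' b hb).2
    have h2 := (h' _ haa).2
    have h3 := norm_sub_le (zeroExt f b - p'.eval b / q'.eval b)
      (zeroExt f a.1.1 - p'.eval a.1.1 / q'.eval a.1.1)
    have h4 : η / C * C = η := by field_simp
    have h5 : 4 * (ε + η / C) / ρ * ‖b - a.1.1‖ + 2 * (η / C) =
        4 * ε / ρ * ‖b - a.1.1‖ + η / C * C := by rw [hC]; ring
    refine (norm_add_le _ _).trans ?_
    rw [← h4, ← h5]
    linarith
  have hrat : ∀ (p q : k[X]) (b : k), q.eval b ≠ 0 →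
      HasDerivAt (fun z => p.eval z / q.eval z)
        ((derivative p * q - p * derivative q).eval b / (q ^ 2).eval b) b := by
    intro p q b hb
    have h := (p.hasDerivAt b).div (q.hasDerivAt b) hb
    rw [eval_sub, eval_mul, eval_mul, eval_pow]
    exact h
  have hdif : ∀ a : RatIn U, D.ratPt a.1 ∈ W → DifferentiableAt k (zeroExt f) a.1.1 := by
    intro a ha
    have haa : ‖a.1.1 - a.1.1‖ ≤ ρ := by simp [hρ.le]
    choose p q hq hpq using fun n : ℕ => hclose (1 / ((n : ℝ) + 1)) (by positivity)
    let D' : ℕ → k := fun n =>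
      (derivative (p n) * q n - p n * derivative (q n)).eval a.1.1 / (q n ^ 2).eval a.1.1
    have hD : ∀ n, HasDerivAt (fun z => (p n).eval z / (q n).eval z) (D' n) a.1.1 :=
      fun n => hrat _ _ _ (hpq n a ha _ haa).1
    have hnear : ∀ᶠ b in 𝓝 a.1.1, ‖b - a.1.1‖ ≤ ρ := by
      filter_upwards [Metric.closedBall_mem_nhds a.1.1 hρ] with z hz
      rwa [Metric.mem_closedBall, dist_eq_norm] at hz
    have hcl : ∀ n m, ‖D' n - D' m‖ ≤ 4 * (1 / ((n : ℝ) + 1)) / ρ + 4 * (1 / ((m : ℝ) + 1)) / ρ := by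
      intro n m
      refine ((hD n).sub (hD m)).le_of_lip' (by positivity) ?_
      filter_upwards [hnear] with b hb
      have h1 := hlip _ (by positivity) (p n) (q n) a ha (hpq n a ha) b hb
      have h2 := hlip _ (by positivity) (p m) (q m) a ha (hpq m a ha) b hb
      rw [add_mul]
      refine le_trans (le_of_eq ?_) ((norm_sub_le _ _).trans ((add_comm _ _).le.trans
        (add_le_add h1 h2)))
      congr 1
      simp only [Pi.sub_apply]
      ring
    have hlim : Filter.Tendsto (fun n : ℕ => 4 * (1 / ((n : ℝ) + 1)) / ρ) Filter.atTop (𝓝 0) := by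
      have := (tendsto_one_div_add_atTop_nhds_zero_nat (𝕜 := ℝ)).const_mul 4 |>.div_const ρ
      simpa using this
    have hcau : CauchySeq D' := by
      rw [Metric.cauchySeq_iff']
      intro ε hε
      obtain ⟨N, hN⟩ := Filter.eventually_atTop.1
        (hlim.eventually (gt_mem_nhds (show (0 : ℝ) < ε / 2 by positivity)))
      refine ⟨N, fun n hn => ?_⟩
      rw [dist_eq_norm]
      linarith [hcl n N, hN n hn, hN N le_rfl]
    obtain ⟨d, hd⟩ := cauchySeq_tendsto_of_complete hcau
    have hd' : HasDerivAt (zeroExt f) d a.1.1 := by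
      rw [hasDerivAt_iff_isLittleO, Asymptotics.isLittleO_iff]
      intro ε hε
      obtain ⟨n, hn1, hn2⟩ := ((hlim.eventually (gt_mem_nhds (show (0 : ℝ) < ε / 3 by positivity))).and
        (Metric.tendsto_nhds.1 hd (ε / 3) (by positivity))).exists
      have h3 := Asymptotics.isLittleO_iff.1 (hasDerivAt_iff_isLittleO.1 (hD n))
        (show (0 : ℝ) < ε / 3 by positivity)
      filter_upwards [hnear, h3] with b hb hb3
      have h1 := hlip _ (by positivity) (p n) (q n) a ha (hpq n a ha) b hb
      rw [dist_eq_norm] at hn2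
      have e : zeroExt f b - zeroExt f a.1.1 - (b - a.1.1) • d =
          ((zeroExt f b - (p n).eval b / (q n).eval b) -
            (zeroExt f a.1.1 - (p n).eval a.1.1 / (q n).eval a.1.1)) +
          ((p n).eval b / (q n).eval b - (p n).eval a.1.1 / (q n).eval a.1.1 -
            (b - a.1.1) • D' n) + (b - a.1.1) * (D' n - d) := by
        simp only [smul_eq_mul]; ring
      rw [e]
      refine (norm_add₃_le).trans ?_
      rw [norm_mul]
      nlinarith [norm_nonneg (b - a.1.1)]
    exact hd'.differentiableAt
  refine ⟨W, hyW, hWV.trans hVU, hdif, fun ε hε => ?_⟩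
  obtain ⟨p, q, hq, hpq⟩ := hclose (ρ * ε / 4) (by positivity)
  refine ⟨derivative p * q - p * derivative q, q ^ 2, fun v hv => ?_, fun a ha => ?_⟩
  · rw [map_pow]; exact pow_ne_zero _ (hq v (hWV hv))
  · have haa : ‖a.1.1 - a.1.1‖ ≤ ρ := by simp [hρ.le]
    refine ((hdif a ha).hasDerivAt.sub (hrat p q a.1.1 (hpq a ha _ haa).1)).le_of_lip' hε.le ?_
    filter_upwards [Metric.closedBall_mem_nhds a.1.1 hρ] with b hb
    rw [Metric.mem_closedBall, dist_eq_norm] at hb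
    have := hlip _ (by positivity) p q a ha (hpq a ha) b hb
    have e : 4 * (ρ * ε / 4) / ρ = ε := by field_simp
    rwa [e] at this

theorem differentiableAt_zeroExt {k : Type u} [NontriviallyNormedField k] [IsUltrametricDist k]
    [CompleteSpace k] [IsAlgClosed k] {D : StrictOpenDisc k} {U : Opens D.Point} {f : RatIn U → k}
    (hf : IsAnalytic f) (a : RatIn U) : DifferentiableAt k (zeroExt f) a.1.1 := by
  obtain ⟨W, hyW, -, h, -⟩ := exists_deriv_approx hf a.2
  exact h a hyW

theorem isAnalytic_deriv {k : Type u} [NontriviallyNormedField k] [IsUltrametricDist k]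
    [CompleteSpace k] [IsAlgClosed k] {D : StrictOpenDisc k} {U : Opens D.Point} {f : RatIn U → k}
    (hf : IsAnalytic f) : IsAnalytic fun a : RatIn U => deriv (zeroExt f) a.1.1 := by
  intro y hy
  obtain ⟨W, hyW, hWU, -, h⟩ := exists_deriv_approx hf hy
  exact ⟨W, hyW, hWU, h⟩

theorem hasDerivAt_congr {k : Type u} [NontriviallyNormedField k] [IsUltrametricDist k]
    {D : StrictOpenDisc k} {U : Opens D.Point} {f : RatIn U → k} {g : k → k} {a : RatIn U} {d : k}
    (hg : HasDerivAt g d a.1.1) (h : ∀ b : RatIn U, f b = g b.1.1) :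
    HasDerivAt (zeroExt f) d a.1.1 := by
  refine hg.congr_of_eventuallyEq ?_
  filter_upwards [eventually_mem a] with z hz
  obtain ⟨b, rfl⟩ := hz
  rw [zeroExt_apply, h]

/-- The derivation `f ↦ f'` of `𝒪(U)`, where `df = f' dT`. -/
noncomputable def derivation {k : Type u} [NontriviallyNormedField k] [IsUltrametricDist k]
    [CompleteSpace k] [IsAlgClosed k] {D : StrictOpenDisc k} (U : Opens D.Point) :
    Derivation k (analytic U) (analytic U) :=
  Derivation.mk'
    { toFun := fun f => ⟨fun a => deriv (zeroExt f.1) a.1.1, isAnalytic_deriv f.2⟩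
      map_add' := fun f g => by
        ext a
        exact (hasDerivAt_congr ((differentiableAt_zeroExt f.2 a).hasDerivAt.add
          (differentiableAt_zeroExt g.2 a).hasDerivAt)
          (fun b => by simp [zeroExt_apply])).deriv
      map_smul' := fun c f => by
        ext a
        exact (hasDerivAt_congr ((differentiableAt_zeroExt f.2 a).hasDerivAt.const_mul c)
          (fun b => by simp [zeroExt_apply])).deriv }
    (fun f g => by
      ext a
      have h : deriv (zeroExt (f * g).1) a.1.1 = deriv (zeroExt f.1) a.1.1 * zeroExt g.1 a.1.1 +
          zeroExt f.1 a.1.1 * deriv (zeroExt g.1) a.1.1 :=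
        (hasDerivAt_congr ((differentiableAt_zeroExt f.2 a).hasDerivAt.mul
          (differentiableAt_zeroExt g.2 a).hasDerivAt)
          (fun b => by simp [zeroExt_apply])).deriv
      rw [zeroExt_apply, zeroExt_apply] at h
      change deriv (zeroExt (f * g).1) a.1.1 = f.1 a * deriv (zeroExt g.1) a.1.1 +
        g.1 a * deriv (zeroExt f.1) a.1.1
      rw [h]
      ring)

theorem derivation_apply {k : Type u} [NontriviallyNormedField k] [IsUltrametricDist k]
    [CompleteSpace k] [IsAlgClosed k] {D : StrictOpenDisc k} (U : Opens D.Point) (f : analytic U)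
    (a : RatIn U) : (derivation U f).1 a = deriv (zeroExt f.1) a.1.1 := rfl

theorem derivation_restrict {k : Type u} [NontriviallyNormedField k] [IsUltrametricDist k]
    [CompleteSpace k] [IsAlgClosed k] {D : StrictOpenDisc k} {U V : Opens D.Point} (h : V ≤ U)
    (f : analytic U) : derivation V (restrict h f) = restrict h (derivation U f) := by
  ext a
  exact (hasDerivAt_congr (U := V) (a := a) (differentiableAt_zeroExt f.2 ⟨a.1, h a.2⟩).hasDerivAt
    (fun b => (zeroExt_apply f.1 ⟨b.1, h b.2⟩).symm)).deriv

/-! ### Modules with connection on a disc -/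

/-- A sheaf of `𝒪`-modules on the disc `D`. -/
structure ModuleSheaf {k : Type u} [NontriviallyNormedField k] (D : StrictOpenDisc k) where
  sec : Opens D.Point → Type u
  [addCommGroup : ∀ U, AddCommGroup (sec U)]
  [moduleBase : ∀ U, Module k (sec U)]
  [module : ∀ U, Module (analytic U) (sec U)]
  [isScalarTower : ∀ U, IsScalarTower k (analytic U) (sec U)]
  res : ∀ {U V : Opens D.Point}, V ≤ U → sec U →ₗ[k] sec V
  res_smul : ∀ {U V : Opens D.Point} (h : V ≤ U) (f : analytic U) (m : sec U),
    res h (f • m) = restrict h f • res h m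
  res_refl : ∀ {U : Opens D.Point} (m : sec U), res le_rfl m = m
  res_res : ∀ {U V W : Opens D.Point} (h : V ≤ U) (h' : W ≤ V) (m : sec U),
    res h' (res h m) = res (h'.trans h) m
  existsUnique_glue : ∀ {ι : Type u} (U : Opens D.Point) (V : ι → Opens D.Point)
    (hV : ∀ i, V i ≤ U) (_ : U ≤ iSup V) (m : ∀ i, sec (V i))
    (_ : ∀ i j, res (inf_le_left : V i ⊓ V j ≤ V i) (m i) =
      res (inf_le_right : V i ⊓ V j ≤ V j) (m j)),
    ∃! t : sec U, ∀ i, res (hV i) t = m i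

attribute [instance] ModuleSheaf.addCommGroup ModuleSheaf.moduleBase ModuleSheaf.module
  ModuleSheaf.isScalarTower

/-- The sheaf is locally free of rank `r`: every point has a neighbourhood on which there are `r`
sections that form a basis of the sheaf. -/
def ModuleSheaf.IsLocallyFree {k : Type u} [NontriviallyNormedField k] {D : StrictOpenDisc k}
    (M : ModuleSheaf D) (r : ℕ) : Prop :=
  ∀ y : D.Point, ∃ U : Opens D.Point, y ∈ U ∧ ∃ e : Fin r → M.sec U,
    ∀ (V : Opens D.Point) (h : V ≤ U),
      Function.Bijective fun c : Fin r → analytic V => ∑ i, c i • M.res h (e i)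

/-- A connection on `M`. The sheaf of differential forms of `D` is free with basis `dT`, and
`nabla m` stands for the section `n` such that `∇ m = dT ⊗ n`. -/
structure Connection {k : Type u} [NontriviallyNormedField k] [IsUltrametricDist k]
    [CompleteSpace k] [IsAlgClosed k] {D : StrictOpenDisc k} (M : ModuleSheaf D) where
  nabla : ∀ U : Opens D.Point, M.sec U →ₗ[k] M.sec U
  leibniz : ∀ (U : Opens D.Point) (f : analytic U) (m : M.sec U),
    nabla U (f • m) = derivation U f • m + f • nabla U m
  nabla_res : ∀ {U V : Opens D.Point} (h : V ≤ U) (m : M.sec U),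
    nabla V (M.res h m) = M.res h (nabla U m)

/-- A differential equation of rank `r` on `D`: a locally free sheaf of rank `r` with a connection
(which is integrable since `D` has dimension one). -/
structure DifferentialEquation {k : Type u} [NontriviallyNormedField k] [IsUltrametricDist k]
    [CompleteSpace k] [IsAlgClosed k] (D : StrictOpenDisc k) (r : ℕ) where
  sheaf : ModuleSheaf D
  locallyFree : sheaf.IsLocallyFree r
  connection : Connection sheaf

/-- The space `H⁰(U, (ℰ, ∇))` of horizontal sections on `U`. -/
def DifferentialEquation.horizontal {k : Type u} [NontriviallyNormedField k]
    [IsUltrametricDist k] [CompleteSpace k] [IsAlgClosed k] {D : StrictOpenDisc k} {r : ℕ}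
    (E : DifferentialEquation D r) (U : Opens D.Point) : Submodule k (E.sheaf.sec U) :=
  LinearMap.ker (E.connection.nabla U)

/-- The `i`-th radius of convergence `ℛ_i(x, (ℰ, ∇))` at a rational point `x`, for
`1 ≤ i ≤ r`: the supremum of the `s ∈ (0, 1)` with
`dim_k H⁰(D(x, s⁻), (ℰ, ∇)) ≥ r - i + 1`. -/
noncomputable def DifferentialEquation.radius {k : Type u} [NontriviallyNormedField k]
    [IsUltrametricDist k] [CompleteSpace k] [IsAlgClosed k] {D : StrictOpenDisc k} {r : ℕ}
    (E : DifferentialEquation D r) (x : D.RatPoint) (i : ℕ) : ℝ :=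
  sSup {s : ℝ | s ∈ Set.Ioo 0 1 ∧
    ((r - i + 1 : ℕ) : Cardinal) ≤ Module.rank k (E.horizontal (D.subdisc x s))}

/-- The structure sheaf `𝒪`, as a sheaf of modules over itself. -/
noncomputable def structureSheaf {k : Type u} [NontriviallyNormedField k]
    (D : StrictOpenDisc k) : ModuleSheaf D where
  sec U := analytic U
  res h := (restrict h).toLinearMap
  res_smul h f m := map_mul (restrict h) f m
  res_refl _ := rfl
  res_res _ _ _ := rfl
  existsUnique_glue U V hV hU m hm := by
    have hex : ∀ a : RatIn U, ∃ i, D.ratPt a.1 ∈ V i := fun a => Opens.mem_iSup.1 (hU a.2)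
    choose c hc using hex
    have hval : ∀ (i) (a : RatIn (V i)), (m (c ⟨a.1, hV i a.2⟩)).1 ⟨a.1, hc ⟨a.1, hV i a.2⟩⟩ =
        (m i).1 a := fun i a =>
      congrFun (congrArg Subtype.val (hm (c ⟨a.1, hV i a.2⟩) i)) ⟨a.1, hc ⟨a.1, hV i a.2⟩, a.2⟩
    have han : IsAnalytic fun a : RatIn U => (m (c a)).1 ⟨a.1, hc a⟩ := by
      refine isAnalytic_of_local fun y hy => ?_
      obtain ⟨i, hi⟩ := Opens.mem_iSup.1 (hU hy)
      refine ⟨V i, hV i, hi, ?_⟩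
      have : (fun a : RatIn (V i) => (m (c ⟨a.1, hV i a.2⟩)).1 ⟨a.1, hc ⟨a.1, hV i a.2⟩⟩) =
          (m i).1 := funext (hval i)
      rw [this]
      exact (m i).2
    refine ⟨⟨_, han⟩, fun i => Subtype.ext (funext (hval i)), fun t ht => ?_⟩
    ext a
    exact congrFun (congrArg Subtype.val (ht (c a))) ⟨a.1, hc a⟩

/-- The constant connection `(𝒪, d)`. -/
noncomputable def constantConnection {k : Type u} [NontriviallyNormedField k]
    [IsUltrametricDist k] [CompleteSpace k] [IsAlgClosed k] (D : StrictOpenDisc k) :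
    DifferentialEquation D 1 where
  sheaf := structureSheaf D
  locallyFree y := by
    refine ⟨⊤, trivial, fun _ => (1 : analytic (⊤ : Opens D.Point)), fun V h => ?_⟩
    have : (fun c : Fin 1 → analytic V => ∑ i, c i • (structureSheaf D).res h
        (1 : analytic (⊤ : Opens D.Point))) = fun c => c 0 := by
      funext c
      rw [Fin.sum_univ_one]
      change c 0 * restrict h 1 = c 0
      rw [map_one, mul_one]
    rw [this]
    exact ⟨fun c c' hcc => funext fun i => by rw [Fin.eq_zero i]; exact hcc,
      fun f => ⟨fun _ => f, rfl⟩⟩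
  connection :=
    { nabla := fun U => (derivation U).toLinearMap
      leibniz := fun U (f m : analytic U) => by
        change derivation U (f * m) = derivation U f * m + f * derivation U m
        rw [Derivation.leibniz, smul_eq_mul, smul_eq_mul]
        ring
      nabla_res := fun h m => derivation_restrict h m }

/-! ### Finite étale morphisms of discs -/

/-- A continuous map between the underlying spaces of two discs, with an induced map on rational
points. -/
structure PointMap {k : Type u} [NontriviallyNormedField k] (D₂ D₁ : StrictOpenDisc k) where
  toMap : C(D₂.Point, D₁.Point)
  onRat : D₂.RatPoint → D₁.RatPoint
  map_ratPt : ∀ a, toMap (D₂.ratPt a) = D₁.ratPt (onRat a)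

/-- The preimage `φ⁻¹(U)`. -/
noncomputable def PointMap.preimage {k : Type u} [NontriviallyNormedField k]
    {D₂ D₁ : StrictOpenDisc k} (φ : PointMap D₂ D₁) (U : Opens D₁.Point) : Opens D₂.Point :=
  ⟨{y | φ.toMap y ∈ U}, U.isOpen.preimage φ.toMap.continuous⟩

theorem PointMap.preimage_mono {k : Type u} [NontriviallyNormedField k]
    {D₂ D₁ : StrictOpenDisc k} (φ : PointMap D₂ D₁) {U V : Opens D₁.Point} (h : V ≤ U) :
    φ.preimage V ≤ φ.preimage U :=
  fun _ hy => h hy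

theorem PointMap.onRat_mem {k : Type u} [NontriviallyNormedField k]
    {D₂ D₁ : StrictOpenDisc k} (φ : PointMap D₂ D₁) {U : Opens D₁.Point} {a : D₂.RatPoint}
    (ha : D₂.ratPt a ∈ φ.preimage U) : D₁.ratPt (φ.onRat a) ∈ U :=
  φ.map_ratPt a ▸ (show φ.toMap (D₂.ratPt a) ∈ U from ha)

/-- The map induced by `φ` on rational points of `φ⁻¹(U)` and `U`. -/
noncomputable def PointMap.ratIn {k : Type u} [NontriviallyNormedField k]
    {D₂ D₁ : StrictOpenDisc k} (φ : PointMap D₂ D₁) {U : Opens D₁.Point}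
    (a : RatIn (φ.preimage U)) : RatIn U :=
  ⟨φ.onRat a.1, φ.onRat_mem a.2⟩

/-- A morphism of analytic spaces `D₂ → D₁`: a continuous map on the underlying spaces that sends
rational points to rational points and pulls back analytic functions to analytic functions. -/
structure DiscMorphism {k : Type u} [NontriviallyNormedField k] (D₂ D₁ : StrictOpenDisc k)
    extends PointMap D₂ D₁ where
  isAnalytic_comp : ∀ (U : Opens D₁.Point) (h : RatIn U → k), IsAnalytic h →
    IsAnalytic fun a : RatIn (toPointMap.preimage U) => h (toPointMap.ratIn a)

/-- The pullback of functions `𝒪(U) → 𝒪(φ⁻¹(U))`. -/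
noncomputable def DiscMorphism.pullback {k : Type u} [NontriviallyNormedField k]
    {D₂ D₁ : StrictOpenDisc k} (φ : DiscMorphism D₂ D₁) (U : Opens D₁.Point) :
    analytic U →ₐ[k] analytic (φ.preimage U) where
  toFun h := ⟨fun a => h.1 (φ.ratIn a), φ.isAnalytic_comp U h.1 h.2⟩
  map_one' := rfl
  map_mul' _ _ := rfl
  map_zero' := rfl
  map_add' _ _ := rfl
  commutes' _ := rfl

/-- The coordinate `T` of a disc. -/
noncomputable def coordinate {k : Type u} [NontriviallyNormedField k] (D : StrictOpenDisc k) :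
    analytic (⊤ : Opens D.Point) :=
  ⟨fun a => a.1.1, by
    have h := isAnalytic_polynomial (D := D) (U := ⊤) X
    simp only [eval_X] at h
    exact h⟩

/-- The analytic function on `D₂` which describes `φ`, that is the pullback of the coordinate
of `D₁`. -/
noncomputable def DiscMorphism.function {k : Type u} [NontriviallyNormedField k]
    {D₂ D₁ : StrictOpenDisc k} (φ : DiscMorphism D₂ D₁) : analytic (⊤ : Opens D₂.Point) :=
  φ.pullback ⊤ (coordinate D₁)

/-- The derivative `φ'`, so that `φ^* dT₁ = φ' dT₂`. -/
noncomputable def DiscMorphism.derivative {k : Type u} [NontriviallyNormedField k]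
    [IsUltrametricDist k] [CompleteSpace k] [IsAlgClosed k] {D₂ D₁ : StrictOpenDisc k}
    (φ : DiscMorphism D₂ D₁) : analytic (⊤ : Opens D₂.Point) :=
  derivation (⊤ : Opens D₂.Point) φ.function

/-- A morphism of discs is finite if it is topologically proper with finite fibres (discs have no
boundary). -/
def DiscMorphism.IsFinite {k : Type u} [NontriviallyNormedField k] {D₂ D₁ : StrictOpenDisc k}
    (φ : DiscMorphism D₂ D₁) : Prop :=
  IsProperMap φ.toMap ∧ ∀ y : D₁.Point, (φ.toMap ⁻¹' {y}).Finite

/-- A morphism of discs is étale if `φ^* Ω¹ → Ω¹` is an isomorphism, that is if `φ'` is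
invertible. -/
def DiscMorphism.IsEtale {k : Type u} [NontriviallyNormedField k] [IsUltrametricDist k]
    [CompleteSpace k] [IsAlgClosed k] {D₂ D₁ : StrictOpenDisc k} (φ : DiscMorphism D₂ D₁) : Prop :=
  IsUnit φ.derivative

/-- The pushforward of a sheaf of modules. -/
noncomputable def ModuleSheaf.pushforward {k : Type u} [NontriviallyNormedField k]
    {D₂ D₁ : StrictOpenDisc k} (φ : DiscMorphism D₂ D₁) (M : ModuleSheaf D₂) :
    ModuleSheaf D₁ where
  sec U := M.sec (φ.preimage U)
  addCommGroup U := M.addCommGroup (φ.preimage U)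
  moduleBase U := M.moduleBase (φ.preimage U)
  module U := Module.compHom (M.sec (φ.preimage U)) (φ.pullback U).toRingHom
  isScalarTower U :=
    letI := Module.compHom (M.sec (φ.preimage U)) (φ.pullback U).toRingHom
    ⟨fun c f m => by
      change φ.pullback U (c • f) • m = c • (φ.pullback U f • m)
      rw [map_smul, smul_assoc]⟩
  res h := M.res (φ.preimage_mono h)
  res_smul h f m := M.res_smul (φ.preimage_mono h) (φ.pullback _ f) m
  res_refl m := M.res_refl m
  res_res h h' m := M.res_res (φ.preimage_mono h) (φ.preimage_mono h') m
  existsUnique_glue U V hV hU m hm :=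
    M.existsUnique_glue (φ.preimage U) (fun i => φ.preimage (V i))
      (fun i => φ.preimage_mono (hV i))
      (fun _ hy => by
        obtain ⟨i, hi⟩ := Opens.mem_iSup.1 (hU hy)
        exact Opens.mem_iSup.2 ⟨i, hi⟩) m hm

/-- The morphism `φ` has degree `d`: the sheaf `φ_* 𝒪` is locally free of rank `d`. -/
def DiscMorphism.HasDegree {k : Type u} [NontriviallyNormedField k] {D₂ D₁ : StrictOpenDisc k}
    (φ : DiscMorphism D₂ D₁) (d : ℕ) : Prop :=
  ((structureSheaf D₂).pushforward φ).IsLocallyFree d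

/-- The inverse of `φ'`, on an open subset `U` of `D₂`. -/
noncomputable def DiscMorphism.IsEtale.derivInv {k : Type u} [NontriviallyNormedField k]
    [IsUltrametricDist k] [CompleteSpace k] [IsAlgClosed k] {D₂ D₁ : StrictOpenDisc k}
    {φ : DiscMorphism D₂ D₁} (hφ : φ.IsEtale) (U : Opens D₂.Point) : analytic U :=
  restrict le_top (↑hφ.unit⁻¹ : analytic (⊤ : Opens D₂.Point))

theorem DiscMorphism.IsEtale.derivInv_mul {k : Type u} [NontriviallyNormedField k]
    [IsUltrametricDist k] [CompleteSpace k] [IsAlgClosed k] {D₂ D₁ : StrictOpenDisc k}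
    {φ : DiscMorphism D₂ D₁} (hφ : φ.IsEtale) (U : Opens D₂.Point) :
    hφ.derivInv U * restrict le_top φ.derivative = 1 := by
  rw [DiscMorphism.IsEtale.derivInv, ← map_mul, hφ.val_inv_mul, map_one]

/-- The chain rule `(h ∘ φ)' = (h' ∘ φ) φ'`. -/
theorem derivation_pullback {k : Type u} [NontriviallyNormedField k]
    [IsUltrametricDist k] [CompleteSpace k] [IsAlgClosed k] {D₂ D₁ : StrictOpenDisc k}
    (φ : DiscMorphism D₂ D₁) (U : Opens D₁.Point) (h : analytic U) :
    derivation (φ.preimage U) (φ.pullback U h) =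
      φ.pullback U (derivation U h) * restrict le_top φ.derivative := by
  ext a
  have h1 := (differentiableAt_zeroExt φ.function.2 ⟨a.1, trivial⟩).hasDerivAt
  have h2 := (differentiableAt_zeroExt h.2 (φ.ratIn a)).hasDerivAt
  have h3 : ∀ b : RatIn (φ.preimage U),
      zeroExt φ.function.1 b.1.1 = (φ.ratIn b).1.1 :=
    fun b => zeroExt_apply φ.function.1 ⟨b.1, trivial⟩
  have h4 := HasDerivAt.comp (h₂ := zeroExt h.1) (h := zeroExt φ.function.1) a.1.1
    (by rw [h3 a]; exact h2) h1
  have h5 := (hasDerivAt_congr (f := (φ.pullback U h).1) h4 (fun b => by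
    rw [Function.comp_apply, h3 b, zeroExt_apply]; rfl)).deriv
  exact h5

/-- The pushforward of a connection along an étale morphism: from `∇ m = dT₂ ⊗ n` and
`φ^* dT₁ = φ' dT₂` one gets `(φ_* ∇) m = dT₁ ⊗ (φ')⁻¹ n`. -/
noncomputable def Connection.pushforward {k : Type u} [NontriviallyNormedField k]
    [IsUltrametricDist k] [CompleteSpace k] [IsAlgClosed k] {D₂ D₁ : StrictOpenDisc k}
    {φ : DiscMorphism D₂ D₁} (hφ : φ.IsEtale) {M : ModuleSheaf D₂} (N : Connection M) :
    Connection (M.pushforward φ) where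
  nabla U := (LinearMap.lsmul (analytic (φ.preimage U)) (M.sec (φ.preimage U))
    (hφ.derivInv (φ.preimage U))).restrictScalars k ∘ₗ N.nabla (φ.preimage U)
  leibniz U f (m : M.sec (φ.preimage U)) := by
    change hφ.derivInv (φ.preimage U) • N.nabla (φ.preimage U) (φ.pullback U f • m) =
      φ.pullback U (derivation U f) • m +
        φ.pullback U f • (hφ.derivInv (φ.preimage U) • N.nabla (φ.preimage U) m)
    rw [N.leibniz, derivation_pullback, smul_add, smul_smul, smul_smul, smul_smul]
    congr 2
    · rw [mul_left_comm, hφ.derivInv_mul, mul_one]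
    · rw [mul_comm]
  nabla_res {U V} h (m : M.sec (φ.preimage U)) := by
    change hφ.derivInv (φ.preimage V) • N.nabla (φ.preimage V) (M.res (φ.preimage_mono h) m) =
      M.res (φ.preimage_mono h) (hφ.derivInv (φ.preimage U) • N.nabla (φ.preimage U) m)
    rw [N.nabla_res, M.res_smul]
    rfl

/-- The pushforward `φ_* (𝒪, d)` of the constant connection by an étale morphism of degree `d`,
which is a differential equation of rank `d`. -/
noncomputable def pushforwardConstant {k : Type u} [NontriviallyNormedField k]
    [IsUltrametricDist k] [CompleteSpace k] [IsAlgClosed k] {D₂ D₁ : StrictOpenDisc k}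
    (φ : DiscMorphism D₂ D₁) (hφ : φ.IsEtale) (d : ℕ) (hd : φ.HasDegree d) :
    DifferentialEquation D₁ d where
  sheaf := (constantConnection D₂).sheaf.pushforward φ
  locallyFree := hd
  connection := (constantConnection D₂).connection.pushforward hφ

/-! ### The number of components of preimages of discs -/

/-- The function `N_x`: the number of connected components of `φ⁻¹(D(x, s⁻))`. -/
noncomputable def DiscMorphism.numComponents {k : Type u} [NontriviallyNormedField k]
    {D₂ D₁ : StrictOpenDisc k} (φ : DiscMorphism D₂ D₁) (x : D₁.RatPoint) (s : ℝ) : ℕ :=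
  Nat.card (ConnectedComponents (φ.preimage (D₁.subdisc x s)))

/-- The break-points of a function `N` on `(0, 1]`: the points of discontinuity in `(0, 1)`, together
with the boundary points `0` and `1`. -/
def breakPoints (N : ℝ → ℕ) : Set ℝ :=
  {0, 1} ∪ {s | s ∈ Set.Ioo 0 1 ∧ ¬ ContinuousAt N s}

end PushConst

set_option linter.unusedSectionVars false

namespace PushConst

/-! ### Points of the Berkovich line -/

section Line

variable {k : Type u} [NontriviallyNormedField k]

/-! Let f be the function on `D₂` that describes φ, and let S be the fibre over x. Finiteness makes
S finite, étaleness makes the zeros of f − x simple, and the degree hypothesis gives |S| = d.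
Dividing f − x by Q = ∏_{y ∈ S} (T − y) leaves a function without zeros on the disc `D₂`, whose
absolute value is therefore a constant κ. Hence |T − x| ∘ φ = κ|Q| on `D₂`
(`DiscMorphism.IsFinite.exists_fibre`), and φ⁻¹(D(x, s⁻)) is a sublevel set of |Q|.

Such a set is a union of discs B_y, y ∈ S: a point lies in B_y when the smallest closed disc around
y that contains it has a Gauss point at which |Q| is below the level. Let σ(y, z) be the normalized
value of |Q| at the Gauss point of the smallest disc containing y and z. Then σ is an ultrametric on
S with values less than 1, and B_y, B_z coincide if σ(y, z) < s and are disjoint otherwise. So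
N_x(s) is the number of open σ-balls of radius s. A horizontal section of φ_*(𝒪, d) is a function
with zero derivative; in characteristic 0 it is constant on each B_y, so the space of horizontal
sections has the same number as its dimension. This is `exists_ultrametric`. What remains is
combinatorial (`radii_of_breakPoints`): the ball count is left continuous, decreases from d to 1,
jumps only at values of σ, and the radii are the suprema of the sets {N ≥ d − j + 1}.

Two inputs carry the analysis. Analytic functions are only local uniform limits of rational
functions; `IsAnalytic.polyApprox` shows that on a closed disc they are uniform limits of
polynomials, and this reduces zeros, derivatives and division by T − y to estimates of Gauss norms.
The cardinality of the fibre is `DiscMorphism.HasDegree.card_eq`: evaluation identifies the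
reduction of φ_*𝒪 at x with the functions on S. -/

theorem BerkovichLine.ext_seminorm {v w : BerkovichLine k}
    (h : ∀ P, v.seminorm P = w.seminorm P) : v = w := by
  cases v; cases w; congr 1; exact DFunLike.ext _ _ h

theorem BerkovichLine.nonneg (v : BerkovichLine k) (P : k[X]) : 0 ≤ v.seminorm P :=
  apply_nonneg _ _

/-- The seminorms of the Berkovich line are non-archimedean. -/
theorem BerkovichLine.add_le_max [IsUltrametricDist k] (v : BerkovichLine k) (P Q : k[X]) :
    v.seminorm (P + Q) ≤ max (v.seminorm P) (v.seminorm Q) := by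
  set M := max (v.seminorm P) (v.seminorm Q) with hM
  have hM0 : 0 ≤ M := (v.nonneg P).trans (le_max_left _ _)
  have hnat : ∀ n : ℕ, v.seminorm (n : k[X]) ≤ 1 := fun n => by
    rw [← map_natCast C, v.seminorm_C]
    exact IsUltrametricDist.norm_natCast_le_one k n
  -- In the binomial expansion the coefficients have norm at most 1, so only the number m + 1 of
  -- terms is lost. Linear growth cannot compensate a ratio greater than 1 raised to the power m.
  have hpow : ∀ m : ℕ, v.seminorm (P + Q) ^ m ≤ ((m + 1 : ℕ) : ℝ) * M ^ m := by
    intro m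
    rw [← map_pow, (Commute.all P Q).add_pow]
    refine (le_trans (Finset.le_sum_of_subadditive v.seminorm (map_zero _).le
      (fun a b => map_add_le_add _ a b) _ _)
      (Finset.sum_le_card_nsmul _ _ (M ^ m) fun i hi => ?_)).trans_eq (by simp)
    have hi' : i ≤ m := Nat.lt_succ_iff.1 (Finset.mem_range.1 hi)
    rw [map_mul, map_mul, map_pow, map_pow]
    calc v.seminorm P ^ i * v.seminorm Q ^ (m - i) * v.seminorm (m.choose i : k[X])
        ≤ M ^ i * M ^ (m - i) * 1 := by
          gcongr
          · exact le_max_left _ _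
          · exact le_max_right _ _
          · exact hnat _
      _ = M ^ m := by rw [mul_one, ← pow_add, Nat.add_sub_cancel' hi']
  rcases hM0.eq_or_lt with h0 | h0
  · have := hpow 1
    rw [← h0] at this ⊢
    simpa using this
  · by_contra hlt
    rw [not_le] at hlt
    have h1 : 1 < v.seminorm (P + Q) / M := by rwa [one_lt_div h0]
    obtain ⟨m, hm⟩ := Real.exists_natCast_add_one_lt_pow_of_one_lt h1
    rw [div_pow, lt_div_iff₀ (by positivity)] at hm
    have := hpow m
    push_cast at this
    linarith

theorem BerkovichLine.X_sub_C_le_max [IsUltrametricDist k] (v : BerkovichLine k) (a b : k) :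
    v.seminorm (X - C b) ≤ max (v.seminorm (X - C a)) ‖a - b‖ := by
  have : (X - C b : k[X]) = (X - C a) + C (a - b) := by simp
  rw [this, ← v.seminorm_C]
  exact v.add_le_max _ _

theorem BerkovichLine.norm_sub_le_max [IsUltrametricDist k] (v : BerkovichLine k) (a b : k) :
    ‖a - b‖ ≤ max (v.seminorm (X - C a)) (v.seminorm (X - C b)) := by
  have h : (C (b - a) : k[X]) = (X - C a) + -(X - C b) := by simp
  rw [norm_sub_rev, ← v.seminorm_C, h, ← map_neg_eq_map v.seminorm (X - C b)]
  exact v.add_le_max _ _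

/-- If `a` is at least as close to `v` as `b`, then `|T - b|_v` is given by `max`. -/
theorem BerkovichLine.X_sub_C_eq_max [IsUltrametricDist k] (v : BerkovichLine k) {a b : k}
    (h : v.seminorm (X - C a) ≤ v.seminorm (X - C b)) :
    v.seminorm (X - C b) = max (v.seminorm (X - C a)) ‖a - b‖ := by
  refine le_antisymm (v.X_sub_C_le_max a b) (max_le h ?_)
  have := v.norm_sub_le_max a b
  rwa [max_eq_right h] at this

theorem BerkovichLine.X_sub_C_eq_norm [IsUltrametricDist k] (v : BerkovichLine k) {a b : k}
    (h : v.seminorm (X - C a) < ‖a - b‖) : v.seminorm (X - C b) = ‖a - b‖ := by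
  have h1 := v.norm_sub_le_max a b
  rw [le_max_iff, or_iff_right (not_le.2 h)] at h1
  have h2 := v.X_sub_C_le_max a b
  rw [max_eq_right h.le] at h2
  exact le_antisymm h2 h1

@[simp]
theorem BerkovichLine.rational_X_sub_C (a b : k) :
    (BerkovichLine.rational a).seminorm (X - C b) = ‖a - b‖ := by
  simp [BerkovichLine.rational_apply]

/-- Polynomials split over k, so a point is determined by its distances |T − a| to the elements of
k. Equality, order and topology of points are all checked on linear polynomials. -/
theorem BerkovichLine.seminorm_eq_prod_roots [IsAlgClosed k] (v : BerkovichLine k) (P : k[X]) :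
    v.seminorm P =
      ‖P.leadingCoeff‖ * (P.roots.map fun α => v.seminorm (X - C α)).prod := by
  conv_lhs => rw [(IsAlgClosed.splits P).eq_prod_roots]
  rw [map_mul, v.seminorm_C, map_multiset_prod, Multiset.map_map]
  rfl

theorem BerkovichLine.ext_X_sub_C [IsAlgClosed k] {v w : BerkovichLine k}
    (h : ∀ a : k, v.seminorm (X - C a) = w.seminorm (X - C a)) : v = w :=
  BerkovichLine.ext_seminorm fun P => by
    rw [v.seminorm_eq_prod_roots, w.seminorm_eq_prod_roots]; simp_rw [h]

theorem BerkovichLine.seminorm_mono [IsAlgClosed k] {v w : BerkovichLine k}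
    (h : ∀ a : k, v.seminorm (X - C a) ≤ w.seminorm (X - C a)) (P : k[X]) :
    v.seminorm P ≤ w.seminorm P := by
  rw [v.seminorm_eq_prod_roots, w.seminorm_eq_prod_roots]
  gcongr
  exact Multiset.prod_map_le_prod_map₀ _ _ (fun _ _ => v.nonneg _) fun a _ => h a

theorem BerkovichLine.eq_rational [IsUltrametricDist k] [IsAlgClosed k] {v : BerkovichLine k}
    {a : k} (h : v.seminorm (X - C a) = 0) : v = BerkovichLine.rational a :=
  BerkovichLine.ext_X_sub_C fun b => by
    rw [BerkovichLine.rational_X_sub_C, v.X_sub_C_eq_max (a := a) (by rw [h]; exact v.nonneg _), h]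
    simp

theorem BerkovichLine.rational_injective :
    Function.Injective (BerkovichLine.rational : k → BerkovichLine k) := fun a b h => by
  have := BerkovichLine.rational_X_sub_C a b
  rw [h, BerkovichLine.rational_X_sub_C, sub_self, norm_zero] at this
  exact sub_eq_zero.1 (norm_eq_zero.1 this.symm)

/-- The topology of the line is induced by the functions `v ↦ |T - a|_v`. -/
theorem BerkovichLine.isInducing_X_sub_C [IsAlgClosed k] :
    Topology.IsInducing fun (v : BerkovichLine k) (a : k) => v.seminorm (X - C a) := by
  refine ⟨le_antisymm ?_ ?_⟩
  · rw [← continuous_iff_le_induced]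
    exact continuous_pi fun a =>
      (continuous_apply (X - C a)).comp (BerkovichLine.isInducing k).continuous
  · rw [(BerkovichLine.isInducing k).eq_induced, ← continuous_iff_le_induced]
    refine @continuous_pi _ _ _ (_) _ _ fun P => ?_
    simp_rw [BerkovichLine.seminorm_eq_prod_roots _ P]
    have h : Continuous fun x : k → ℝ => ‖P.leadingCoeff‖ * (P.roots.map fun α => x α).prod :=
      continuous_const.mul (continuous_multiset_prod _ fun a _ => continuous_apply a)
    exact @Continuous.comp _ (k → ℝ) ℝ (_) _ _
      (fun (v : BerkovichLine k) (a : k) => v.seminorm (X - C a)) _ h continuous_induced_dom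

theorem BerkovichLine.continuous_seminorm (P : k[X]) :
    Continuous fun v : BerkovichLine k => v.seminorm P :=
  (continuous_apply P).comp (BerkovichLine.isInducing k).continuous

/-- A basic neighbourhood in a product constrains finitely many coordinates, and their tolerances
can be replaced by the smallest one. -/
theorem exists_finset_nhds {ι Y : Type*} [TopologicalSpace Y] {F : Y → ι → ℝ}
    (hF : Topology.IsInducing F) {V : Set Y} (hV : IsOpen V) {v : Y} (hv : v ∈ V) :
    ∃ (S : Finset ι) (δ : ℝ), 0 < δ ∧ ∀ w : Y, (∀ a ∈ S, |F w a - F v a| < δ) → w ∈ V := by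
  classical
  have hV' := hV.mem_nhds hv
  rw [hF.nhds_eq_comap, Filter.mem_comap] at hV'
  obtain ⟨S, hS, hSV⟩ := hV'
  rw [nhds_pi, Filter.mem_pi] at hS
  obtain ⟨I, hI, t, ht, htS⟩ := hS
  choose δ hδ hδt using fun a => Metric.mem_nhds_iff.1 (ht a)
  obtain ⟨ε, hε0, hε⟩ : ∃ ε : ℝ, 0 < ε ∧ ∀ a ∈ hI.toFinset, ε ≤ δ a := by
    induction hI.toFinset using Finset.induction_on with
    | empty => exact ⟨1, one_pos, by simp⟩
    | insert a s _ ih =>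
      obtain ⟨ε, h0, h⟩ := ih
      refine ⟨min ε (δ a), lt_min h0 (hδ a), fun b hb => ?_⟩
      rcases Finset.mem_insert.1 hb with rfl | hb
      · exact min_le_right _ _
      · exact (min_le_left _ _).trans (h b hb)
  refine ⟨hI.toFinset, ε, hε0, fun w hw => hSV (htS fun a ha => hδt a ?_)⟩
  rw [Metric.mem_ball, Real.dist_eq]
  exact (hw a (hI.mem_toFinset.2 ha)).trans_le (hε a (hI.mem_toFinset.2 ha))

/-! ### Gauss points -/

variable [IsUltrametricDist k]

theorem isNonarchimedean_norm :
    IsNonarchimedean (IsAbsoluteValue.toAbsoluteValue (norm : k → ℝ)) :=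
  fun a b => IsUltrametricDist.norm_add_le_max a b

/-- The Gauss point of the closed disc of radius `|t|` around `a`. -/
noncomputable def gaussPoint (a : k) (t : ℝ) : BerkovichLine k where
  seminorm :=
    { toFun := fun P =>
        -- With |t| in place of t this is a seminorm for every real t.
        (taylor a P).gaussNorm (IsAbsoluteValue.toAbsoluteValue (norm : k → ℝ)) |t|
      map_zero' := by simp
      add_le' := fun P Q => by
        rw [map_add]
        exact (isNonarchimedean_gaussNorm _ isNonarchimedean_norm (abs_nonneg t) _ _).trans
          (max_le_add_of_nonneg (gaussNorm_nonneg _ _ (abs_nonneg t))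
            (gaussNorm_nonneg _ _ (abs_nonneg t)))
      neg' := fun P => by
        rw [map_neg]
        simp only [gaussNorm, support_neg, coeff_neg, AbsoluteValue.map_neg]
      map_one' := by
        change gaussNorm _ _ (taylor a 1) = 1
        rw [taylor_one, gaussNorm_C]
        exact norm_one
      map_mul' := fun P Q => by
        change gaussNorm _ _ (taylor a (P * Q)) = gaussNorm _ _ (taylor a P) * _
        rw [taylor_mul]
        -- Radius 0 is separate: there the Gauss norm is the norm of the constant coefficient.
        rcases (abs_nonneg t).eq_or_lt with h | h
        · rw [← h]
          simp [mul_coeff_zero]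
        · exact gaussNorm_mul isNonarchimedean_norm h _ _ }
  seminorm_C := fun b => by
    change gaussNorm _ _ (taylor a (C b)) = _
    rw [taylor_C, gaussNorm_C]
    rfl

theorem coeff_le_gaussPoint (a : k) {t : ℝ} (ht : 0 ≤ t) (P : k[X]) (i : ℕ) :
    ‖(taylor a P).coeff i‖ * t ^ i ≤ (gaussPoint a t).seminorm P := by
  have := le_gaussNorm (IsAbsoluteValue.toAbsoluteValue (norm : k → ℝ)) (taylor a P)
    (abs_nonneg t) i
  conv_lhs => rw [← abs_of_nonneg ht]
  exact this

theorem exists_coeff_eq_gaussPoint (a : k) {t : ℝ} (ht : 0 ≤ t) (P : k[X]) :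
    ∃ i, (gaussPoint a t).seminorm P = ‖(taylor a P).coeff i‖ * t ^ i := by
  obtain ⟨i, hi⟩ := exists_eq_gaussNorm (IsAbsoluteValue.toAbsoluteValue (norm : k → ℝ)) |t|
    (taylor a P)
  refine ⟨i, ?_⟩
  conv_rhs => rw [← abs_of_nonneg ht]
  exact hi

theorem gaussPoint_X_sub_C (a b : k) {t : ℝ} (ht : 0 ≤ t) :
    (gaussPoint a t).seminorm (X - C b) = max t ‖a - b‖ := by
  have e : taylor a (X - C b) = X + C (a - b) := by simp; ring
  apply le_antisymm
  · obtain ⟨i, hi⟩ := exists_coeff_eq_gaussPoint a ht (X - C b)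
    rw [hi, e]
    match i with
    | 0 => simp
    | 1 => simp
    | n + 2 => simp [coeff_X, ht]
  · have h0 := coeff_le_gaussPoint a ht (X - C b) 0
    have h1 := coeff_le_gaussPoint a ht (X - C b) 1
    rw [e] at h0 h1
    simp at h0 h1
    exact max_le h1 h0

theorem gaussPoint_zero [IsAlgClosed k] (a : k) : gaussPoint a 0 = BerkovichLine.rational a :=
  BerkovichLine.ext_X_sub_C fun b => by
    rw [gaussPoint_X_sub_C a b le_rfl, BerkovichLine.rational_X_sub_C,
      max_eq_right (norm_nonneg _)]

theorem norm_sub_max_comm {a b : k} {t : ℝ} (h : ‖a - b‖ ≤ t) (c : k) :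
    max t ‖a - c‖ = max t ‖b - c‖ := by
  apply le_antisymm
  · refine max_le (le_max_left _ _) ?_
    rw [← sub_add_sub_cancel a b c]
    exact (IsUltrametricDist.norm_add_le_max _ _).trans (max_le_max h le_rfl)
  · refine max_le (le_max_left _ _) ?_
    rw [← sub_add_sub_cancel b a c]
    exact (IsUltrametricDist.norm_add_le_max _ _).trans
      (max_le_max (by rwa [norm_sub_rev]) le_rfl)

variable [IsAlgClosed k]

theorem gaussPoint_eq {a b : k} {t : ℝ} (h : ‖a - b‖ ≤ t) : gaussPoint a t = gaussPoint b t :=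
  BerkovichLine.ext_X_sub_C fun c => by
    have ht := (norm_nonneg _).trans h
    rw [gaussPoint_X_sub_C a c ht, gaussPoint_X_sub_C b c ht, norm_sub_max_comm h]

/-- The Gauss point is the largest seminorm among the points of its closed disc; linear polynomials
suffice, where this is the ultrametric inequality. -/
theorem le_gaussPoint {v : BerkovichLine k} {a : k} {t : ℝ} (h : v.seminorm (X - C a) ≤ t)
    (P : k[X]) : v.seminorm P ≤ (gaussPoint a t).seminorm P :=
  BerkovichLine.seminorm_mono (fun b => by
    rw [gaussPoint_X_sub_C a b ((v.nonneg _).trans h)]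
    exact (v.X_sub_C_le_max a b).trans (max_le_max h le_rfl)) P

theorem norm_eval_le_gaussPoint {a b : k} {t : ℝ} (h : ‖b - a‖ ≤ t) (P : k[X]) :
    ‖P.eval b‖ ≤ (gaussPoint a t).seminorm P :=
  le_gaussPoint (v := BerkovichLine.rational b) (by simpa using h) P

theorem gaussPoint_mono (a : k) {s t : ℝ} (hs : 0 ≤ s) (h : s ≤ t) (P : k[X]) :
    (gaussPoint a s).seminorm P ≤ (gaussPoint a t).seminorm P :=
  le_gaussPoint (by rw [gaussPoint_X_sub_C a a hs]; simpa using ⟨h, hs.trans h⟩) P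

theorem gaussPoint_pos (a : k) {t : ℝ} (ht : 0 < t) {P : k[X]} (hP : P ≠ 0) :
    0 < (gaussPoint a t).seminorm P := by
  rw [BerkovichLine.seminorm_eq_prod_roots]
  refine mul_pos (norm_pos_iff.2 (leadingCoeff_ne_zero.2 hP)) (Multiset.prod_pos fun x hx => ?_)
  obtain ⟨b, -, rfl⟩ := Multiset.mem_map.1 hx
  rw [gaussPoint_X_sub_C a b ht.le]
  exact ht.trans_le (le_max_left _ _)

theorem continuous_gaussPoint (a : k) : Continuous fun t : ℝ => gaussPoint a |t| := by
  rw [BerkovichLine.isInducing_X_sub_C.continuous_iff]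
  refine continuous_pi fun b => ?_
  simp only [Function.comp_def, gaussPoint_X_sub_C a b (abs_nonneg _)]
  fun_prop

theorem continuousOn_gaussPoint (a : k) : ContinuousOn (gaussPoint a) (Set.Ici 0) :=
  (continuous_gaussPoint a).continuousOn.congr fun t ht => by
    simp only [abs_of_nonneg (Set.mem_Ici.1 ht)]

/-- At a generic point of a circle, a polynomial takes the value of the Gauss norm. -/
theorem norm_eval_eq_gaussPoint {a b : k} {P : k[X]}
    (h : ∀ α ∈ P.roots, ‖a - α‖ ≠ ‖b - a‖) :
    ‖P.eval b‖ = (gaussPoint a ‖b - a‖).seminorm P := by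
  rw [← BerkovichLine.rational_apply, BerkovichLine.seminorm_eq_prod_roots,
    BerkovichLine.seminorm_eq_prod_roots]
  congr 2
  refine Multiset.map_congr rfl fun α hα => ?_
  rw [BerkovichLine.rational_X_sub_C, gaussPoint_X_sub_C a α (norm_nonneg _),
    ← sub_add_sub_cancel b a α,
    IsUltrametricDist.norm_add_eq_max_of_norm_ne_norm (h α hα).symm]

/-- Inequalities that hold at the rational points of an open annulus hold at its Gauss points. -/
theorem gaussPoint_le_of_annulus {a : k} {s t : ℝ} (hs : 0 ≤ s) (P Q : k[X]) {c : ℝ}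
    (h : ∀ b, s < ‖b - a‖ → ‖b - a‖ < t → ‖P.eval b‖ ≤ c * ‖Q.eval b‖) {r : ℝ}
    (hsr : s ≤ r) (hrt : r ≤ t) (hst : s < t) :
    (gaussPoint a r).seminorm P ≤ c * (gaussPoint a r).seminorm Q := by
  classical
  have hcont : ∀ P : k[X], ContinuousOn (fun r => (gaussPoint a r).seminorm P) (Set.Icc s t) :=
    fun P => (BerkovichLine.continuous_seminorm P).comp_continuousOn
      ((continuousOn_gaussPoint a).mono fun r hr => hs.trans hr.1)
  -- The radii at which some b computes the Gauss norms of both P and Q. They lie in the value group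
  -- and avoid finitely many numbers, so they are dense, and the inequality extends to the other
  -- radii by continuity.
  set T : Set ℝ := {r | ∃ b : k, ‖b - a‖ = r ∧ (∀ α ∈ P.roots, ‖a - α‖ ≠ ‖b - a‖) ∧
    ∀ α ∈ Q.roots, ‖a - α‖ ≠ ‖b - a‖} with hT
  have hdense : Set.Icc s t ⊆ closure (Set.Ioo s t ∩ T) := by
    have h1 : Set.Ioo s t ⊆ closure (Set.Ioo s t ∩ T) := by
      intro r hr
      rw [Metric.mem_closure_iff]
      intro ε hε
      obtain ⟨b, hb1, hb2, hb3⟩ := exists_norm_avoid (k := k) (α := r) (β := min t (r + ε))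
        (hs.trans_lt hr.1) (lt_min hr.2 (by linarith))
        (F := (fun β : k => ‖a - β‖) '' ((P.roots.toFinset ∪ Q.roots.toFinset : Finset k) : Set k))
        ((Finset.finite_toSet _).image _)
      have hb4 : ‖a + b - a‖ = ‖b‖ := by simp
      refine ⟨‖b‖, ⟨⟨hr.1.trans hb1, hb2.trans_le (min_le_left _ _)⟩, a + b, hb4, ?_, ?_⟩, ?_⟩
      · intro α hα he
        exact hb3 ⟨α, by simpa using Or.inl (mem_roots'.1 hα), he.trans hb4⟩
      · intro α hα he
        exact hb3 ⟨α, by simpa using Or.inr (mem_roots'.1 hα), he.trans hb4⟩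
      · have := hb2.trans_le (min_le_right _ _)
        rw [Real.dist_eq, abs_lt]; constructor <;> linarith
    calc Set.Icc s t = closure (Set.Ioo s t) := (closure_Ioo hst.ne).symm
      _ ⊆ _ := closure_minimal h1 isClosed_closure
  have hsub : closure (Set.Ioo s t ∩ T) ⊆ Set.Icc s t :=
    closure_minimal (fun r hr => Set.Ioo_subset_Icc_self hr.1) isClosed_Icc
  have heq : closure (Set.Ioo s t ∩ T) = Set.Icc s t := hsub.antisymm hdense
  refine le_on_closure (s := Set.Ioo s t ∩ T)
    (f := fun r => (gaussPoint a r).seminorm P)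
    (g := fun r => c * (gaussPoint a r).seminorm Q) ?_ ?_ ?_ (hdense ⟨hsr, hrt⟩)
  · rintro r ⟨hr, b, rfl, hP, hQ⟩
    simp only [← norm_eval_eq_gaussPoint hP, ← norm_eval_eq_gaussPoint hQ]
    exact h b hr.1 hr.2
  · rw [heq]; exact hcont P
  · rw [heq]; exact continuousOn_const.mul (hcont Q)

/-- Maximum modulus principle. -/
theorem gaussPoint_le_of_forall {a : k} {t : ℝ} (ht : 0 < t) (P : k[X]) {c : ℝ}
    (h : ∀ b, ‖b - a‖ ≤ t → ‖P.eval b‖ ≤ c) : (gaussPoint a t).seminorm P ≤ c := by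
  have := gaussPoint_le_of_annulus (a := a) (s := 0) (t := t) le_rfl P 1 (c := c)
    (fun b _ hb => by simpa using h b hb.le) ht.le le_rfl ht
  simpa using this

/-! ### Density of the rational points, connectedness of discs -/

/-- Among the finitely many centres that define a neighbourhood of v, let β be the closest to v, at
distance r. A rational point whose distance to β is slightly more than r and differs from all
distances from β to the other centres has nearly the same distances to all centres as v. -/
theorem denseRange_rational : DenseRange (BerkovichLine.rational : k → BerkovichLine k) := by
  rw [DenseRange, dense_iff_inter_open]
  rintro V hV ⟨v, hv⟩
  obtain ⟨S, δ, hδ, h⟩ := exists_finset_nhds BerkovichLine.isInducing_X_sub_C hV hv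
  suffices ∃ b : k, ∀ a ∈ S, |‖b - a‖ - v.seminorm (X - C a)| < δ by
    obtain ⟨b, hb⟩ := this
    exact ⟨_, h _ fun a ha => by simpa using hb a ha, b, rfl⟩
  rcases S.eq_empty_or_nonempty with rfl | hS
  · exact ⟨0, by simp⟩
  obtain ⟨β, hβ, hmin⟩ := S.exists_min_image (fun a => v.seminorm (X - C a)) hS
  set r := v.seminorm (X - C β) with hr
  have hr0 : 0 ≤ r := v.nonneg _
  obtain ⟨b, hb1, hb2, hb3⟩ := exists_norm_avoid (k := k) (α := r + δ / 2) (β := r + δ)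
    (by positivity) (by linarith) (F := (fun a : k => ‖β - a‖) '' (S : Set k))
    ((Finset.finite_toSet _).image _)
  refine ⟨β + b, fun a ha => ?_⟩
  have hne : ‖b‖ ≠ ‖β - a‖ := fun he => hb3 ⟨a, ha, he.symm⟩
  rw [v.X_sub_C_eq_max (hmin a ha), ← hr, show β + b - a = b + (β - a) by ring,
    IsUltrametricDist.norm_add_eq_max_of_norm_ne_norm hne]
  refine (abs_max_sub_max_le_abs _ _ _).trans_lt ?_
  rw [abs_lt]; constructor <;> linarith

/-- The set of points `v` for which `|T - a|_v` satisfies a downward closed open condition is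
connected. -/
theorem isPreconnected_disc (a : k) {p : ℝ → Prop}
    (hp : ∀ s t, 0 ≤ s → s ≤ t → p t → p s)
    (hopen : IsOpen {v : BerkovichLine k | p (v.seminorm (X - C a))}) :
    IsPreconnected {v : BerkovichLine k | p (v.seminorm (X - C a))} := by
  set B := {v : BerkovichLine k | p (v.seminorm (X - C a))} with hB
  have hpath : ∀ (c : k) (t : ℝ), IsPreconnected (gaussPoint c '' Set.Icc 0 t) := fun c t =>
    isPreconnected_Icc.image _ ((continuousOn_gaussPoint c).mono fun s hs => hs.1)
  -- Each rational point b of the disc is joined to a by growing the discs around b up to radius |b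
  -- − a|, where the Gauss points of a and b coincide, and then shrinking around a. The union R of
  -- these paths is connected and dense in the disc.
  set R : Set (BerkovichLine k) := ⋃ b : {b : k // p ‖b - a‖},
    gaussPoint b.1 '' Set.Icc 0 ‖b.1 - a‖ ∪ gaussPoint a '' Set.Icc 0 ‖b.1 - a‖ with hR
  have hRB : R ⊆ B := by
    intro v hv
    obtain ⟨b, hb⟩ := Set.mem_iUnion.1 hv
    rcases hb with ⟨s, hs, rfl⟩ | ⟨s, hs, rfl⟩
    · change p _
      rw [gaussPoint_X_sub_C _ _ hs.1, max_eq_right hs.2]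
      exact b.2
    · change p _
      rw [gaussPoint_X_sub_C _ _ hs.1, sub_self, norm_zero, max_eq_left hs.1]
      exact hp _ _ hs.1 hs.2 b.2
  have hBR : B ⊆ closure R := by
    refine (denseRange_rational.open_subset_closure_inter hopen).trans (closure_mono ?_)
    rintro v ⟨hv, b, rfl⟩
    rw [hB, Set.mem_ofPred_eq, BerkovichLine.rational_X_sub_C] at hv
    exact Set.mem_iUnion.2 ⟨⟨b, hv⟩, Or.inl ⟨0, ⟨le_rfl, norm_nonneg _⟩, gaussPoint_zero b⟩⟩
  refine IsPreconnected.subset_closure ?_ hRB hBR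
  refine isPreconnected_of_forall (BerkovichLine.rational a) fun v hv => ?_
  obtain ⟨b, hb⟩ := Set.mem_iUnion.1 hv
  refine ⟨_, Set.subset_iUnion _ b, Or.inr ⟨0, ⟨le_rfl, norm_nonneg _⟩, gaussPoint_zero a⟩, hb, ?_⟩
  exact IsPreconnected.union (gaussPoint a ‖b.1 - a‖)
    ⟨_, ⟨norm_nonneg _, le_rfl⟩, gaussPoint_eq le_rfl⟩ ⟨_, ⟨norm_nonneg _, le_rfl⟩, rfl⟩
    (hpath _ _) (hpath _ _)

end Line

/-! ### Uniform limits of polynomials on closed discs -/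

section PolyApprox

variable {k : Type u} [NontriviallyNormedField k]

/-- The function `F` is a uniform limit of polynomials on the closed disc of radius `r` around
`a`. -/
def PolyApprox (F : k → k) (a : k) (r : ℝ) : Prop :=
  ∀ ε : ℝ, 0 < ε → ∃ P : k[X], ∀ b, ‖b - a‖ ≤ r → ‖F b - P.eval b‖ ≤ ε

theorem PolyApprox.mono {F : k → k} {a : k} {r s : ℝ} (h : PolyApprox F a r) (hs : s ≤ r) :
    PolyApprox F a s := fun ε hε => by
  obtain ⟨P, hP⟩ := h ε hε
  exact ⟨P, fun b hb => hP b (hb.trans hs)⟩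

theorem PolyApprox.congr {F G : k → k} {a : k} {r : ℝ} (h : PolyApprox F a r)
    (hFG : ∀ b, ‖b - a‖ ≤ r → G b = F b) : PolyApprox G a r := fun ε hε => by
  obtain ⟨P, hP⟩ := h ε hε
  exact ⟨P, fun b hb => by rw [hFG b hb]; exact hP b hb⟩

theorem polyApprox_polynomial (P : k[X]) (a : k) (r : ℝ) : PolyApprox (fun b => P.eval b) a r :=
  fun ε hε => ⟨P, fun b _ => by simp [hε.le]⟩

variable [IsUltrametricDist k]

theorem norm_sub_le_of_le {x y : k} {c : ℝ} (hx : ‖x‖ ≤ c) (hy : ‖y‖ ≤ c) : ‖x - y‖ ≤ c := by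
  rw [sub_eq_add_neg]
  exact (IsUltrametricDist.norm_add_le_max _ _).trans (max_le hx (by rwa [norm_neg]))

theorem norm_add_le_of_le {x y : k} {c : ℝ} (hx : ‖x‖ ≤ c) (hy : ‖y‖ ≤ c) : ‖x + y‖ ≤ c :=
  (IsUltrametricDist.norm_add_le_max _ _).trans (max_le hx hy)

theorem norm_sub_le_trans {a b c : k} {r : ℝ} (h : ‖a - b‖ ≤ r) (h' : ‖b - c‖ ≤ r) :
    ‖a - c‖ ≤ r := by
  rw [← sub_add_sub_cancel a b c]; exact norm_add_le_of_le h h'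

theorem PolyApprox.recenter {F : k → k} {a b : k} {r : ℝ} (h : PolyApprox F a r)
    (hb : ‖b - a‖ ≤ r) : PolyApprox F b r := fun ε hε => by
  obtain ⟨P, hP⟩ := h ε hε
  exact ⟨P, fun c hc => hP c (norm_sub_le_trans hc hb)⟩

variable [IsAlgClosed k]

theorem PolyApprox.bounded {F : k → k} {a : k} {r : ℝ} (h : PolyApprox F a r) :
    ∃ M : ℝ, 0 < M ∧ ∀ b, ‖b - a‖ ≤ r → ‖F b‖ ≤ M := by
  obtain ⟨P, hP⟩ := h 1 one_pos
  refine ⟨max 1 ((gaussPoint a r).seminorm P), lt_max_of_lt_left one_pos, fun b hb => ?_⟩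
  rw [← sub_add_cancel (F b) (P.eval b)]
  exact norm_add_le_of_le ((hP b hb).trans (le_max_left _ _))
    ((norm_eval_le_gaussPoint hb P).trans (le_max_right _ _))

theorem PolyApprox.mul {F G : k → k} {a : k} {r : ℝ} (hF : PolyApprox F a r)
    (hG : PolyApprox G a r) : PolyApprox (fun b => F b * G b) a r := fun ε hε => by
  obtain ⟨M, hM0, hM⟩ := hF.bounded
  obtain ⟨Q, hQ⟩ := hG (ε / M) (by positivity)
  obtain ⟨M', hM0', hM'⟩ := (polyApprox_polynomial Q a r).bounded
  obtain ⟨P, hP⟩ := hF (ε / M') (by positivity)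
  refine ⟨P * Q, fun b hb => ?_⟩
  rw [eval_mul, show F b * G b - P.eval b * Q.eval b =
    F b * (G b - Q.eval b) + (F b - P.eval b) * Q.eval b by ring]
  refine norm_add_le_of_le ?_ ?_
  · rw [norm_mul]
    calc _ ≤ M * (ε / M) := by gcongr; exacts [hM b hb, hQ b hb]
      _ = ε := by field_simp
  · rw [norm_mul]
    calc _ ≤ (ε / M') * M' := by gcongr; exacts [hP b hb, hM' b hb]
      _ = ε := by field_simp

/-- The geometric series in (b − a)/(α − a) converges uniformly, since its ratio has norm at most
r/|α − a| < 1. -/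
theorem polyApprox_inv_sub {a α : k} {r : ℝ} (h : r < ‖α - a‖) :
    PolyApprox (fun b => (b - α)⁻¹) a r := fun ε hε => by
  rcases lt_or_ge r 0 with hr | hr
  · exact ⟨0, fun b hb => absurd (norm_nonneg (b - a)) (by linarith)⟩
  set s := ‖α - a‖ with hs
  have hs0 : 0 < s := hr.trans_lt h
  have hαa : α - a ≠ 0 := norm_pos_iff.1 hs0
  obtain ⟨n, hn⟩ := exists_pow_lt_of_lt_one (show 0 < ε * s by positivity)
    (show r / s < 1 by rwa [div_lt_one hs0])
  refine ⟨-C (α - a)⁻¹ * ∑ i ∈ Finset.range n, (C (α - a)⁻¹ * (X - C a)) ^ i, fun b hb => ?_⟩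
  set x := (α - a)⁻¹ * (b - a) with hx
  have hxn : ‖x‖ ≤ r / s := by
    rw [hx, norm_mul, norm_inv, ← hs, div_eq_inv_mul]; gcongr
  have hbα : ‖b - α‖ = s := by
    rw [← sub_sub_sub_cancel_right b α a, sub_eq_add_neg,
      IsUltrametricDist.norm_add_eq_max_of_norm_ne_norm (by rw [norm_neg]; linarith), norm_neg,
      max_eq_right (by linarith)]
  have hbα0 : b - α ≠ 0 := norm_pos_iff.1 (hbα ▸ hs0)
  have e1 : b - α = -(α - a) * (1 - x) := by rw [hx]; field_simp; ring
  have hx1 : 1 - x ≠ 0 := fun h0 => hbα0 (by rw [e1, h0, mul_zero])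
  have e2 : (b - α)⁻¹ - (-C (α - a)⁻¹ * ∑ i ∈ Finset.range n,
      (C (α - a)⁻¹ * (X - C a)) ^ i).eval b = x ^ n * (b - α)⁻¹ := by
    have h1 : (-C (α - a)⁻¹ * ∑ i ∈ Finset.range n, (C (α - a)⁻¹ * (X - C a)) ^ i).eval b =
        -(α - a)⁻¹ * ∑ i ∈ Finset.range n, x ^ i := by
      simp [eval_finsetSum, hx]
    rw [h1, geom_sum_eq (fun h0 => hx1 (by rw [h0, sub_self])), e1]
    have : x - 1 ≠ 0 := fun h0 => hx1 (by rw [← neg_sub, h0, neg_zero])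
    field_simp
    ring
  rw [e2, norm_mul, norm_pow, norm_inv, hbα, ← div_eq_mul_inv, div_le_iff₀ hs0]
  exact (pow_le_pow_left₀ (norm_nonneg _) hxn n).trans hn.le

theorem polyApprox_inv_eval {a : k} {r : ℝ} {q : k[X]}
    (hq : ∀ b, ‖b - a‖ ≤ r → q.eval b ≠ 0) : PolyApprox (fun b => (q.eval b)⁻¹) a r := by
  have key : ∀ m : Multiset k, (∀ α ∈ m, r < ‖α - a‖) →
      PolyApprox (fun b => ((m.map fun α => b - α).prod)⁻¹) a r := by
    intro m
    induction m using Multiset.induction with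
    | empty =>
      intro _
      simpa using polyApprox_polynomial (1 : k[X]) a r
    | cons α m ih =>
      intro h
      simp only [Multiset.map_cons, Multiset.prod_cons, mul_inv]
      exact (polyApprox_inv_sub (h α (Multiset.mem_cons_self _ _))).mul
        (ih fun β hβ => h β (Multiset.mem_cons_of_mem hβ))
  have h1 := (polyApprox_polynomial (C (q.leadingCoeff)⁻¹) a r).mul (key q.roots fun α hα => by
    by_contra hlt
    exact hq α (not_lt.1 hlt) (mem_roots'.1 hα).2)
  refine h1.congr fun b _ => ?_
  rw [(IsAlgClosed.splits q).eval_eq_prod_roots, mul_inv, eval_C]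

/-- A uniform limit on a closed disc of rational functions without poles in the disc is a uniform
limit of polynomials. -/
theorem polyApprox_of_rational {F : k → k} {a : k} {r : ℝ}
    (h : ∀ ε : ℝ, 0 < ε → ∃ p q : k[X], (∀ b, ‖b - a‖ ≤ r → q.eval b ≠ 0) ∧
      ∀ b, ‖b - a‖ ≤ r → ‖F b - p.eval b / q.eval b‖ ≤ ε) : PolyApprox F a r := fun ε hε => by
  obtain ⟨p, q, hq, hpq⟩ := h ε hε
  obtain ⟨P, hP⟩ := (polyApprox_polynomial p a r).mul (polyApprox_inv_eval hq) ε hε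
  refine ⟨P, fun b hb => ?_⟩
  rw [← sub_add_sub_cancel (F b) (p.eval b / q.eval b) (P.eval b)]
  exact norm_add_le_of_le (hpq b hb) (by rw [div_eq_mul_inv]; exact hP b hb)

/-! ### Difference quotients and derivatives of uniform limits of polynomials. -/

theorem exists_slope_polynomial (P : k[X]) {a y : k} {ρ c : ℝ} (hρ : 0 < ρ) (hy : ‖y - a‖ ≤ ρ)
    (h : ∀ b, ‖b - a‖ ≤ ρ → ‖P.eval b‖ ≤ c) :
    ∃ S : k[X], P - C (P.eval y) = (X - C y) * S ∧ ∀ b, ‖b - a‖ ≤ ρ → ‖S.eval b‖ ≤ c / ρ := by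
  have hroot : (P - C (P.eval y)).IsRoot y := by simp
  obtain ⟨S, hS⟩ := dvd_iff_isRoot.2 hroot
  refine ⟨S, hS, fun b hb => (norm_eval_le_gaussPoint hb S).trans ?_⟩
  have h1 : (gaussPoint a ρ).seminorm (P - C (P.eval y)) ≤ c :=
    gaussPoint_le_of_forall hρ _ fun b hb => by
      rw [eval_sub, eval_C]
      exact norm_sub_le_of_le (h b hb) (h y hy)
  -- Gauss norms are multiplicative and |T − y| has the value ρ at this Gauss point, so division by
  -- T − y costs exactly a factor 1/ρ.
  rw [hS, map_mul, gaussPoint_X_sub_C a y hρ.le, max_eq_left (by rwa [norm_sub_rev])] at h1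
  rwa [le_div_iff₀' hρ]

theorem PolyApprox.continuousAt {F : k → k} {a y : k} {r : ℝ} (h : PolyApprox F a r) (hr : 0 < r)
    (hy : ‖y - a‖ ≤ r) : ContinuousAt F y := by
  rw [Metric.continuousAt_iff']
  intro ε hε
  obtain ⟨P, hP⟩ := h (ε / 3) (by positivity)
  have h1 := Metric.continuousAt_iff'.1 (P.continuous.continuousAt (x := y)) (ε / 3) (by positivity)
  filter_upwards [h1, Metric.closedBall_mem_nhds y hr] with b hb hb'
  rw [Metric.mem_closedBall, dist_eq_norm] at hb'
  rw [dist_eq_norm] at hb ⊢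
  have e : F b - F y = (F b - P.eval b) + (P.eval b - P.eval y) - (F y - P.eval y) := by ring
  rw [e]
  refine (norm_sub_le _ _).trans_lt ?_
  have := norm_add_le (F b - P.eval b) (P.eval b - P.eval y)
  linarith [hP b (norm_sub_le_trans hb' hy), hP y hy]

theorem norm_le_of_forall_ne {G : k → k} {y : k} {r c : ℝ} (hr : 0 < r) (hG : ContinuousAt G y)
    (h : ∀ b, ‖b - y‖ ≤ r → b ≠ y → ‖G b‖ ≤ c) : ‖G y‖ ≤ c := by
  have h1 : Filter.Tendsto (fun b => ‖G b‖) (𝓝[≠] y) (𝓝 ‖G y‖) :=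
    (hG.norm.tendsto).mono_left nhdsWithin_le_nhds
  refine le_of_tendsto h1 ?_
  filter_upwards [self_mem_nhdsWithin, nhdsWithin_le_nhds (Metric.closedBall_mem_nhds y hr)]
    with b hb hb'
  rw [Metric.mem_closedBall, dist_eq_norm] at hb'
  exact h b hb' hb

variable [CompleteSpace k]

theorem PolyApprox.differentiableAt {F : k → k} {a y : k} {r : ℝ} (h : PolyApprox F a r)
    (hr : 0 < r) (hy : ‖y - a‖ ≤ r) : DifferentiableAt k F y := by
  -- A radius in the value group, so that there is a strict disc around y on which F is analytic.
  obtain ⟨s, hs0, hsr⟩ := exists_norm_mem_Ioo (k := k) (α := r / 2) (β := r) (by positivity)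
    (by linarith)
  let D : StrictOpenDisc k := ⟨y, ‖s‖, by linarith, s, rfl⟩
  have hf : IsAnalytic (U := (⊤ : Opens D.Point)) fun b => F b.1.1 := fun v _ =>
    ⟨⊤, trivial, le_rfl, fun ε hε => by
      obtain ⟨P, hP⟩ := h.recenter hy ε hε
      exact ⟨P, 1, fun v _ => by simp, fun b _ => by simpa using hP b.1.1 (b.1.2.trans hsr).le⟩⟩
  let y' : RatIn (⊤ : Opens D.Point) := ⟨⟨y, by simpa [D] using D.radius_pos⟩, trivial⟩
  refine (differentiableAt_zeroExt hf y').congr_of_eventuallyEq ?_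
  filter_upwards [eventually_mem y'] with z hz
  obtain ⟨b, rfl⟩ := hz
  rw [zeroExt_apply]

/-- Dividing the error c by |b − y| is useless near y. Instead F is compared with a much finer
approximant R, and the difference quotient of the polynomial R − P is bounded on the whole disc by
Gauss norms. The value at y itself follows by continuity. -/
theorem PolyApprox.norm_dslope_sub_le {F : k → k} {a y : k} {ρ c : ℝ} (h : PolyApprox F a ρ)
    (hρ : 0 < ρ) (hy : ‖y - a‖ ≤ ρ) {P S : k[X]}
    (hP : ∀ b, ‖b - a‖ ≤ ρ → ‖F b - P.eval b‖ ≤ c)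
    (hS : P - C (P.eval y) = (X - C y) * S) {b : k} (hb : ‖b - a‖ ≤ ρ) :
    ‖dslope F y b - S.eval b‖ ≤ c / ρ := by
  have hc : 0 ≤ c := (norm_nonneg _).trans (hP y hy)
  have hS' : ∀ b, (b - y) * S.eval b = P.eval b - P.eval y := fun b => by
    have := congrArg (eval b) hS
    simpa using this.symm
  have main : ∀ b, ‖b - a‖ ≤ ρ → b ≠ y → ‖dslope F y b - S.eval b‖ ≤ c / ρ := by
    intro b hb hby
    have hby' : 0 < ‖b - y‖ := norm_pos_iff.2 (sub_ne_zero.2 hby)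
    refine le_of_forall_pos_le_add fun η hη => ?_
    -- The accuracy of R may depend on b: the term η‖b − y‖ absorbs the division by b − y.
    obtain ⟨R, hR⟩ := h (min (η * ρ) (η * ‖b - y‖)) (by positivity)
    obtain ⟨S', hS1, hS2⟩ := exists_slope_polynomial (R - P) (c := c + η * ρ) hρ hy fun b hb => by
      rw [eval_sub, ← sub_sub_sub_cancel_left _ _ (F b)]
      exact norm_sub_le_of_le ((hP b hb).trans (by simp; positivity))
        (((hR b hb).trans (min_le_left _ _)).trans (by linarith))
    have e : (b - y) * (dslope F y b - S.eval b) =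
        (b - y) * S'.eval b + ((F b - R.eval b) - (F y - R.eval y)) := by
      have e1 := congrArg (eval b) hS1
      have e2 := sub_smul_dslope F y b
      rw [smul_eq_mul] at e2
      simp only [eval_sub, eval_mul, eval_X, eval_C] at e1
      rw [mul_sub, e2, hS', ← e1]
      ring
    refine le_of_mul_le_mul_left ?_ hby'
    rw [← norm_mul, e]
    refine norm_add_le_of_le ?_ ?_
    · rw [norm_mul]
      gcongr
      refine (hS2 b hb).trans_eq ?_
      field_simp
    · refine (norm_sub_le_of_le ((hR b hb).trans (min_le_right _ _))
        ((hR y hy).trans (min_le_right _ _))).trans ?_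
      rw [mul_comm]
      gcongr
      linarith [show 0 ≤ c / ρ by positivity]
  rcases eq_or_ne b y with rfl | hby
  · refine norm_le_of_forall_ne (G := fun z => dslope F b z - S.eval z) hρ
      ((continuousAt_dslope_same.2 (h.differentiableAt hρ hb)).sub S.continuous.continuousAt) ?_
    exact fun z hz hzb => main z (norm_sub_le_trans hz hb) hzb
  · exact main b hb hby

theorem PolyApprox.dslope {F : k → k} {a y : k} {ρ : ℝ} (h : PolyApprox F a ρ)
    (hρ : 0 < ρ) (hy : ‖y - a‖ ≤ ρ) : PolyApprox (dslope F y) a ρ := fun ε hε => by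
  obtain ⟨P, hP⟩ := h (ε * ρ) (by positivity)
  obtain ⟨S, hS⟩ := dvd_iff_isRoot.2 (show (P - C (P.eval y)).IsRoot y by simp)
  refine ⟨S, fun b hb => (h.norm_dslope_sub_le hρ hy hP hS hb).trans_eq ?_⟩
  field_simp

/-- A uniform limit of polynomials on a disc with zero derivative is constant. -/
theorem PolyApprox.eq_of_deriv_eq_zero [CharZero k] {F : k → k} {a : k} {ρ : ℝ}
    (h : PolyApprox F a ρ) (hρ : 0 < ρ) (h0 : ∀ b, ‖b - a‖ ≤ ρ → deriv F b = 0) {b : k}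
    (hb : ‖b - a‖ ≤ ρ) : F b = F a := by
  have haa : ‖a - a‖ ≤ ρ := by simp [hρ.le]
  rw [← sub_eq_zero, ← norm_le_zero_iff]
  refine le_of_forall_pos_le_add fun ε hε => ?_
  rw [zero_add]
  obtain ⟨P, hP⟩ := h ε hε
  -- The nonconstant Taylor coefficients of an approximant of F are small, because approximants have
  -- small derivative.
  have hcoeff : ∀ i, i ≠ 0 → ‖(taylor a P).coeff i‖ * ρ ^ i ≤ ε := by
    intro i hi
    obtain ⟨j, rfl⟩ := Nat.exists_eq_succ_of_ne_zero hi
    have hj : 0 < ‖((j + 1 : ℕ) : k)‖ := norm_pos_iff.2 (Nat.cast_ne_zero.2 hi)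
    -- The coefficients of Q' carry the factor j + 1, whose norm may be less than 1 in positive
    -- residue characteristic. It is nonzero in characteristic 0, and choosing a finer Q compensates
    -- for it.
    obtain ⟨Q, hQ⟩ := h (min ε (ε * ‖((j + 1 : ℕ) : k)‖)) (by positivity)
    have h1 : (gaussPoint a ρ).seminorm (derivative Q) ≤ ε * ‖((j + 1 : ℕ) : k)‖ / ρ := by
      refine gaussPoint_le_of_forall hρ _ fun y hy => ?_
      obtain ⟨S, hS⟩ := dvd_iff_isRoot.2 (show (Q - C (Q.eval y)).IsRoot y by simp)
      have h2 := h.norm_dslope_sub_le hρ hy hQ hS hy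
      -- Differentiating Q − Q(y) = (T − y)S at y gives Q'(y) = S(y), so Q'(y) is close to F'(y) =
      -- 0.
      have h3 := congrArg (fun R => eval y (derivative R)) hS
      simp at h3
      rw [dslope_same, h0 y hy, zero_sub, norm_neg, ← h3] at h2
      exact h2.trans (by gcongr; exact min_le_right _ _)
    have h2 := (coeff_le_gaussPoint a hρ.le _ j).trans h1
    have h3 : taylor a (derivative Q) = derivative (taylor a Q) := by
      simp [taylor_apply, derivative_comp]
    have h4 : ‖(taylor a Q).coeff (j + 1)‖ * ρ ^ (j + 1) ≤ ε := by
      rw [h3, coeff_derivative, norm_mul, le_div_iff₀ hρ] at h2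
      push_cast at hj h2
      refine le_of_mul_le_mul_right (le_trans (le_of_eq ?_) h2) hj
      ring
    have h5 : (gaussPoint a ρ).seminorm (P - Q) ≤ ε :=
      gaussPoint_le_of_forall hρ _ fun y hy => by
        rw [eval_sub, ← sub_sub_sub_cancel_left _ _ (F y)]
        exact norm_sub_le_of_le ((hQ y hy).trans (min_le_left _ _)) (hP y hy)
    have h6 := (coeff_le_gaussPoint a hρ.le _ (j + 1)).trans h5
    rw [map_sub, coeff_sub] at h6
    rw [← le_div_iff₀ (by positivity)] at h4 h6 ⊢
    rw [Nat.succ_eq_add_one,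
      ← sub_add_cancel ((taylor a P).coeff (j + 1)) ((taylor a Q).coeff (j + 1))]
    exact norm_add_le_of_le h6 h4
  have hconst : (gaussPoint a ρ).seminorm (P - C (P.eval a)) ≤ ε := by
    obtain ⟨i, hi⟩ := exists_coeff_eq_gaussPoint a hρ.le (P - C (P.eval a))
    rw [hi, map_sub, taylor_C, coeff_sub]
    rcases eq_or_ne i 0 with rfl | hi0
    · simp [hε.le]
    · rw [coeff_C, if_neg hi0, sub_zero]
      exact hcoeff i hi0
  have h1 := (norm_eval_le_gaussPoint hb _).trans hconst
  rw [eval_sub, eval_C] at h1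
  rw [show F b - F a = (F b - P.eval b) + (P.eval b - P.eval a) - (F a - P.eval a) by ring]
  exact norm_sub_le_of_le (norm_add_le_of_le (hP b hb) h1) (hP a haa)

/-! ### Zeros of uniform limits of polynomials. -/

theorem prod_map_ite_eq_pow {ι : Type*} (p : ι → Prop) [DecidablePred p] (x : ℝ)
    (m : Multiset ι) : (m.map fun i => if p i then x else 1).prod = x ^ m.countP p := by
  induction m using Multiset.induction with
  | empty => simp
  | cons a m ih =>
    by_cases h : p a
    · simp [h, ih, pow_succ, mul_comm]
    · simp [h, ih]

theorem norm_eval_eq_prod_roots (u : k[X]) (z : k) :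
    ‖u.eval z‖ = ‖u.leadingCoeff‖ * (u.roots.map fun α => ‖z - α‖).prod := by
  rw [← BerkovichLine.rational_apply, BerkovichLine.seminorm_eq_prod_roots]
  simp

/-- A lower bound for a polynomial away from its zeros. -/
theorem mul_pow_le_norm_eval (u : k[X]) {c z : k} {ρ θ : ℝ} [DecidablePred fun α => ‖α - c‖ ≤ ρ]
    (hθ : 0 ≤ θ) (hz : ‖z - c‖ ≤ ρ)
    (h : ∀ α ∈ u.roots, ‖α - c‖ ≤ ρ → ρ * θ ≤ ‖z - α‖) :
    ‖u.eval c‖ * θ ^ u.roots.countP (fun α => ‖α - c‖ ≤ ρ) ≤ ‖u.eval z‖ := by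
  rw [norm_eval_eq_prod_roots, norm_eval_eq_prod_roots, ← prod_map_ite_eq_pow, mul_assoc,
    ← Multiset.prod_map_mul]
  gcongr
  refine Multiset.prod_map_le_prod_map₀ _ _ (fun α _ => ?_) fun α hα => ?_
  · have : 0 ≤ if ‖α - c‖ ≤ ρ then θ else 1 := by split_ifs <;> positivity
    positivity
  · split_ifs with hc
    · rw [norm_sub_rev] at hc
      exact le_trans (by gcongr) (h α hα (by rwa [norm_sub_rev]))
    · rw [mul_one]
      by_contra hlt
      rw [not_le] at hlt hc
      have h1 : ‖c - α‖ ≤ max ‖z - c‖ ‖z - α‖ := by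
        rw [norm_sub_rev z c, ← sub_add_sub_cancel c z α]
        exact IsUltrametricDist.norm_add_le_max _ _
      rw [norm_sub_rev] at hc
      exact absurd h1 (not_le.2 (max_lt (hz.trans_lt hc) hlt))

/-- A uniform limit of polynomials on a disc without zeros has constant absolute value. -/
theorem PolyApprox.norm_eq_of_ne_zero {F : k → k} {c : k} {ρ ρ' : ℝ} (hF : PolyApprox F c ρ')
    (hρ : 0 < ρ) (hρρ' : ρ < ρ') (h0 : ∀ b, ‖b - c‖ ≤ ρ → F b ≠ 0) {b : k} (hb : ‖b - c‖ ≤ ρ) :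
    ‖F b‖ = ‖F c‖ := by
  classical
  by_contra hne
  have hcc : ‖c - c‖ ≤ ρ := by simp [hρ.le]
  set G := ‖F c‖ with hG
  have hG0 : 0 < G := norm_pos_iff.2 (h0 c hcc)
  have hnorm : ∀ {x y : k}, ‖x - y‖ < ‖x‖ → ‖y‖ = ‖x‖ := fun {x y} h => by
    have := IsUltrametricDist.norm_add_eq_max_of_norm_ne_norm (x := x - y) (y := -x)
      (by rw [norm_neg]; exact h.ne)
    rw [norm_neg, max_eq_right h.le] at this
    rw [← this, ← norm_neg y]
    congr 1; ring
  -- A zero-free polynomial has constant absolute value on the disc, and an approximant with error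
  -- less than |F(c)| would pass this on to F. So all such approximants have a zero in the disc of
  -- radius ρ.
  have hA : ∀ ε, ε < G → ∀ u : k[X], (∀ b, ‖b - c‖ ≤ ρ' → ‖F b - u.eval b‖ ≤ ε) →
      ‖u.eval c‖ = G ∧ ∃ α, ‖α - c‖ ≤ ρ ∧ u.eval α = 0 := by
    intro ε hε u hu
    have h1 : ‖u.eval c‖ = G := hnorm ((hu c (hcc.trans hρρ'.le)).trans_lt hε)
    refine ⟨h1, ?_⟩
    by_contra! hno
    have h2 := norm_eval_const u c hno b hb
    refine hne ?_
    rw [h1] at h2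
    rw [← h2]
    refine hnorm ?_
    rw [h2, norm_sub_rev]
    exact (hu b (hb.trans hρρ'.le)).trans_lt hε
  obtain ⟨u0, hu0⟩ := hF G hG0
  set M := max ((gaussPoint c ρ').seminorm u0) G with hM
  -- N bounds the number of zeros of every approximant in the smaller disc: each zero contributes at
  -- least a factor ρ'/ρ to the Gauss norm at radius ρ', which is at most M, over the value G at c.
  obtain ⟨N, hN⟩ := pow_unbounded_of_one_lt (M / G) (show 1 < ρ' / ρ by rwa [one_lt_div hρ])
  have hcount : ∀ ε, ε < G → ∀ u : k[X], (∀ b, ‖b - c‖ ≤ ρ' → ‖F b - u.eval b‖ ≤ ε) →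
      u.roots.countP (fun α => ‖α - c‖ ≤ ρ) ≤ N := by
    intro ε hε u hu
    have h1 : (gaussPoint c ρ').seminorm u ≤ M :=
      gaussPoint_le_of_forall (hρ.trans hρρ') u fun b hb => by
        rw [show u.eval b = u0.eval b - ((F b - u.eval b) - (F b - u0.eval b)) by ring]
        exact norm_sub_le_of_le ((norm_eval_le_gaussPoint hb u0).trans (le_max_left _ _))
          ((norm_sub_le_of_le ((hu b hb).trans hε.le) (hu0 b hb)).trans (le_max_right _ _))
    have h2 : G * (ρ' / ρ) ^ u.roots.countP (fun α => ‖α - c‖ ≤ ρ) ≤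
        (gaussPoint c ρ').seminorm u := by
      rw [← (hA ε hε u hu).1, norm_eval_eq_prod_roots, BerkovichLine.seminorm_eq_prod_roots,
        ← prod_map_ite_eq_pow, mul_assoc, ← Multiset.prod_map_mul]
      gcongr
      refine Multiset.prod_map_le_prod_map₀ _ _ (fun α _ => ?_) fun α hα => ?_
      · have : 0 ≤ if ‖α - c‖ ≤ ρ then ρ' / ρ else 1 := by
          have := hρ.trans hρρ'
          split_ifs <;> positivity
        positivity
      · rw [gaussPoint_X_sub_C _ _ (hρ.trans hρρ').le]
        split_ifs with hc
        · refine le_max_of_le_left ?_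
          rw [norm_sub_rev] at hc
          calc ‖c - α‖ * (ρ' / ρ) ≤ ρ * (ρ' / ρ) := by
                have := hρ.trans hρρ'
                gcongr
            _ = ρ' := by field_simp
        · rw [mul_one]; exact le_max_right _ _
    by_contra! hlt
    have h3 : (ρ' / ρ) ^ N ≤ (ρ' / ρ) ^ u.roots.countP (fun α => ‖α - c‖ ≤ ρ) :=
      pow_le_pow_right₀ (by rw [one_le_div hρ]; exact hρρ'.le) hlt.le
    rw [div_lt_iff₀ hG0] at hN
    have := mul_le_mul_of_nonneg_left h3 hG0.le
    linarith
  have hθ : ∀ n : ℕ, 0 < ((1 : ℝ) / 2) ^ n ∧ ((1 : ℝ) / 2) ^ n ≤ 1 := fun n =>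
    ⟨pow_pos (by norm_num) n, pow_le_one₀ (by norm_num) (by norm_num)⟩
  -- With at most N zeros, a point at distance at least ρ·2⁻ⁿ from all of them has value at least
  -- G·(2⁻ⁿ)^N, which exceeds ε n. The exponent N + 1 also makes ε tend to 0 when N = 0.
  set ε : ℕ → ℝ := fun n => G * (((1 : ℝ) / 2) ^ n) ^ (N + 1) / 2 with hε
  have hε0 : ∀ n, 0 < ε n := fun n => by have := hθ n; simp only [hε]; positivity
  have hεG : ∀ n, ε n < G := fun n => by
    have := pow_le_one₀ (n := N + 1) (hθ n).1.le (hθ n).2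
    simp only [hε]
    nlinarith
  have hεanti : ∀ n, ε (n + 1) ≤ ε n := fun n => by
    simp only [hε]
    have h1 : ((1 : ℝ) / 2) ^ (n + 1) ≤ (1 / 2) ^ n :=
      pow_le_pow_of_le_one (by norm_num) (by norm_num) (Nat.le_add_right n 1)
    exact div_le_div_of_nonneg_right (mul_le_mul_of_nonneg_left
      (pow_le_pow_left₀ (hθ _).1.le h1 _) hG0.le) (by norm_num)
  choose u hu using fun n => hF (ε n) (hε0 n)
  -- Zeros of consecutive approximants can be chosen at distance less than ρ·2⁻ⁿ. The resulting
  -- Cauchy sequence converges to a zero of F in the disc, which is the contradiction.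
  have hstep : ∀ n, ∀ α, ‖α - c‖ ≤ ρ → (u n).eval α = 0 →
      ∃ β, (‖β - c‖ ≤ ρ ∧ (u (n + 1)).eval β = 0) ∧ ‖α - β‖ < ρ * (1 / 2) ^ n := by
    intro n α hα h
    by_contra! hcon
    have h1 := mul_pow_le_norm_eval (u (n + 1)) (hθ n).1.le hα fun β hβ hβc =>
      hcon β ⟨hβc, (mem_roots'.1 hβ).2⟩
    rw [(hA _ (hεG _) _ (hu (n + 1))).1] at h1
    have h2 : ‖(u (n + 1)).eval α‖ ≤ ε n := by
      have h3 := norm_sub_le_of_le (hu n α (hα.trans hρρ'.le))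
        ((hu (n + 1) α (hα.trans hρρ'.le)).trans (hεanti n))
      rwa [sub_sub_sub_cancel_left, h, sub_zero] at h3
    have h4 := pow_le_pow_of_le_one (hθ n).1.le (hθ n).2 
      ((hcount _ (hεG _) _ (hu (n + 1))).trans (Nat.le_add_right N 1))
    have h5 := mul_le_mul_of_nonneg_left h4 hG0.le
    have h6 : ε n = G * (((1 : ℝ) / 2) ^ n) ^ (N + 1) / 2 := rfl
    have h7 := hε0 n
    linarith
  obtain ⟨α0, hα0⟩ := (hA _ (hεG 0) _ (hu 0)).2
  choose! g hg hgd using hstep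
  let α : ℕ → k := fun n => Nat.rec α0 (fun n a => g n a) n
  have hα : ∀ n, ‖α n - c‖ ≤ ρ ∧ (u n).eval (α n) = 0 := by
    intro n
    induction n with
    | zero => exact hα0
    | succ n ih => exact hg n _ ih.1 ih.2
  have hcau : CauchySeq α := cauchySeq_of_le_geometric (1 / 2) ρ (by norm_num) fun n => by
    rw [dist_eq_norm]
    exact (hgd n _ (hα n).1 (hα n).2).le
  obtain ⟨z, hz⟩ := cauchySeq_tendsto_of_complete hcau
  have hzc : ‖z - c‖ ≤ ρ :=
    le_of_tendsto (hz.sub_const c).norm (Filter.Eventually.of_forall fun n => (hα n).1)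
  refine h0 z hzc ?_
  have h1 := ((hF.continuousAt (hρ.trans hρρ') (hzc.trans hρρ'.le)).tendsto.comp hz).norm
  rw [← norm_le_zero_iff]
  have h2 : Filter.Tendsto (fun n : ℕ => G * ((1 : ℝ) / 2) ^ n) Filter.atTop (𝓝 0) := by
    simpa using (tendsto_pow_atTop_nhds_zero_of_lt_one (show (0 : ℝ) ≤ 1 / 2 by norm_num)
      (by norm_num)).const_mul G
  refine le_of_tendsto_of_tendsto' h1 h2 fun n => ?_
  have h3 := hu n (α n) ((hα n).1.trans hρρ'.le)
  rw [(hα n).2, sub_zero] at h3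
  refine h3.trans ?_
  have h4 := pow_le_of_le_one (hθ n).1.le (hθ n).2 (Nat.add_one_ne_zero N)
  have h5 := (hθ n).1
  simp only [hε]
  nlinarith

end PolyApprox

/-! ### Analytic functions on closed discs are uniform limits of polynomials -/

section MittagLeffler

variable {k : Type u} [NontriviallyNormedField k] [IsUltrametricDist k] [IsAlgClosed k]

/-- The quotient |P|_t / tⁿ is strictly decreasing in t, because a monomial that attains the Gauss
norm at t has degree less than n. This is how the principal part of a Laurent expansion behaves. -/
theorem gaussPoint_mul_pow_lt {a : k} {P : k[X]} {n : ℕ} (hP : P.degree < n) {s t : ℝ}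
    (hs : 0 < s) (hst : s < t) (h0 : 0 < (gaussPoint a t).seminorm P) :
    (gaussPoint a t).seminorm P * s ^ n < (gaussPoint a s).seminorm P * t ^ n := by
  have ht := hs.trans hst
  obtain ⟨i, hi⟩ := exists_coeff_eq_gaussPoint a ht.le P
  have h1 := coeff_le_gaussPoint a hs.le P i
  rw [hi] at h0 ⊢
  have hc : 0 < ‖(taylor a P).coeff i‖ := by
    by_contra hcon
    rw [le_antisymm (not_lt.1 hcon) (norm_nonneg _), zero_mul] at h0
    exact h0.false
  have hin : i < n := by
    have h2 : (i : WithBot ℕ) ≤ (taylor a P).degree := le_degree_of_ne_zero (norm_pos_iff.1 hc)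
    rw [degree_taylor] at h2
    exact_mod_cast h2.trans_lt hP
  obtain ⟨j, rfl⟩ := Nat.exists_eq_add_of_lt hin
  calc ‖(taylor a P).coeff i‖ * t ^ i * s ^ (i + j + 1)
      = ‖(taylor a P).coeff i‖ * s ^ i * t ^ i * s ^ (j + 1) := by ring
    _ < ‖(taylor a P).coeff i‖ * s ^ i * t ^ i * t ^ (j + 1) := by gcongr
    _ = ‖(taylor a P).coeff i‖ * s ^ i * t ^ (i + j + 1) := by ring
    _ ≤ _ := by gcongr

theorem gaussPoint_eq_pow {a : k} {P : k[X]} (hP : P.Monic) {t : ℝ} (ht : 0 ≤ t)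
    (h : ∀ α ∈ P.roots, ‖α - a‖ ≤ t) : (gaussPoint a t).seminorm P = t ^ P.natDegree := by
  rw [BerkovichLine.seminorm_eq_prod_roots, hP.leadingCoeff, norm_one, one_mul,
    (IsAlgClosed.splits P).natDegree_eq_card_roots]
  rw [Multiset.map_congr (g := fun _ => t) rfl fun α hα => ?_, Multiset.map_const',
    Multiset.prod_replicate]
  rw [gaussPoint_X_sub_C a α ht, max_eq_left (by rw [norm_sub_rev]; exact h α hα)]

theorem gaussPoint_eq_norm_eval {a : k} {P : k[X]} {t : ℝ} (ht : 0 ≤ t)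
    (h : ∀ α ∈ P.roots, t < ‖α - a‖) : (gaussPoint a t).seminorm P = ‖P.eval a‖ := by
  rw [← BerkovichLine.rational_apply, BerkovichLine.seminorm_eq_prod_roots,
    BerkovichLine.seminorm_eq_prod_roots]
  congr 2
  refine Multiset.map_congr rfl fun α hα => ?_
  rw [gaussPoint_X_sub_C a α ht, BerkovichLine.rational_X_sub_C,
    max_eq_right (by rw [norm_sub_rev]; exact (h α hα).le)]

/-- Factor a polynomial into the part with zeros in `s` and the part with zeros outside `s`. -/
theorem exists_factor (q : k[X]) (hq : q ≠ 0) (s : Set k) :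
    ∃ q₁ q₀ : k[X], q = q₁ * q₀ ∧ q₁.Monic ∧ (∀ α ∈ q₁.roots, α ∈ s) ∧
      (∀ α ∈ q₀.roots, α ∈ q.roots ∧ α ∉ s) ∧ q₀ ≠ 0 := by
  classical
  have h0 : C q.leadingCoeff ≠ 0 := C_ne_zero.2 (leadingCoeff_ne_zero.2 hq)
  have hm : ∀ m : Multiset k, (m.map fun α => X - C α).prod.Monic := fun m =>
    monic_multiset_prod_of_monic _ _ fun α _ => monic_X_sub_C α
  refine ⟨((q.roots.filter (· ∈ s)).map fun α => X - C α).prod,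
    C q.leadingCoeff * ((q.roots.filter (¬ · ∈ s)).map fun α => X - C α).prod, ?_, hm _, ?_, ?_,
    mul_ne_zero h0 (hm _).ne_zero⟩
  · conv_lhs => rw [(IsAlgClosed.splits q).eq_prod_roots, ← Multiset.filter_add_not (· ∈ s) q.roots,
      Multiset.map_add, Multiset.prod_add]
    ring
  · intro α hα
    rw [roots_multiset_prod_X_sub_C] at hα
    exact (Multiset.mem_filter.1 hα).2
  · intro α hα
    rw [roots_C_mul _ (leadingCoeff_ne_zero.2 hq), roots_multiset_prod_X_sub_C] at hα
    exact Multiset.mem_filter.1 hα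

/-- Bézout followed by reduction modulo q₁ gives p/(q₁q₀) = p₁/q₁ + p₀/q₀ with p₁/q₁ vanishing at
infinity. -/
theorem exists_partial_fraction (p : k[X]) {q₁ q₀ : k[X]} (h₁ : q₁.Monic)
    (h : ∀ α, q₁.eval α = 0 → q₀.eval α ≠ 0) :
    ∃ p₁ p₀ : k[X], p = p₁ * q₀ + p₀ * q₁ ∧ p₁.degree < q₁.natDegree := by
  have hcop : IsCoprime q₁ q₀ := by
    rw [isCoprime_iff_aeval_ne_zero_of_isAlgClosed k k]
    intro α
    by_cases hα : q₁.eval α = 0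
    · exact Or.inr (by simpa using h α hα)
    · exact Or.inl (by simpa using hα)
  obtain ⟨u, v, huv⟩ := hcop
  refine ⟨(p * v) %ₘ q₁, p * u + (p * v) /ₘ q₁ * q₀, ?_, ?_⟩
  · have e := modByMonic_add_div (p * v) q₁
    linear_combination p * (-huv) - q₀ * e
  · rw [← degree_eq_natDegree h₁.ne_zero]
    exact degree_modByMonic_lt _ h₁

/-- Remove the poles of `p / q` in a disc, if `p / q` is close to a polynomial on an annulus around
the disc. -/
theorem exists_remove_poles {p q h : k[X]} {β : k} {ρ ρ' ε : ℝ} (hρ : 0 ≤ ρ) (hρρ' : ρ < ρ')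
    {Y : Set k} (hA : ∀ b, ρ < ‖b - β‖ → ‖b - β‖ ≤ ρ' → b ∈ Y) (hq : ∀ b ∈ Y, q.eval b ≠ 0)
    (hd : ∀ b, ρ < ‖b - β‖ → ‖b - β‖ ≤ ρ' → ‖p.eval b / q.eval b - h.eval b‖ ≤ ε) :
    ∃ p₀ q₀ : k[X], (∀ b, b ∈ Y ∨ ‖b - β‖ ≤ ρ' → q₀.eval b ≠ 0) ∧
      (∀ b ∈ Y, ρ < ‖b - β‖ → ‖p.eval b / q.eval b - p₀.eval b / q₀.eval b‖ ≤ ε) ∧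
      ∀ b, ‖b - β‖ ≤ ρ' → ‖h.eval b - p₀.eval b / q₀.eval b‖ ≤ ε := by
  have hρ' : 0 < ρ' := hρ.trans_lt hρρ'
  obtain ⟨z, hz1, hz2⟩ : ∃ z, ρ < ‖z - β‖ ∧ ‖z - β‖ ≤ ρ' := by
    rcases hρ.eq_or_lt with h0 | h0
    · obtain ⟨s, hs1, hs2⟩ := exists_norm_mem_Ioo (k := k) (α := ρ' / 2) (β := ρ') (by linarith)
        (by linarith)
      exact ⟨β + s, by simp; linarith, by simpa using hs2.le⟩
    · obtain ⟨s, hs1, hs2⟩ := exists_norm_mem_Ioo (k := k) h0 hρρ'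
      exact ⟨β + s, by simpa using hs1, by simpa using hs2.le⟩
  have hε : 0 ≤ ε := (norm_nonneg _).trans (hd z hz1 hz2)
  have hq0 : q ≠ 0 := fun h0 => hq z (hA z hz1 hz2) (by simp [h0])
  -- The zeros of q₁ are the poles to be removed. Those of q₀ lie beyond ρ', since the annulus is
  -- contained in Y.
  obtain ⟨q₁, q₀, rfl, hq₁, hr₁, hr₀, hq₀⟩ := exists_factor q hq0 {α | ‖α - β‖ ≤ ρ}
  have hroot : ∀ {P : k[X]} {b}, P ≠ 0 → P.eval b = 0 → b ∈ P.roots := fun hP hb =>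
    (mem_roots hP).2 hb
  have hr₀' : ∀ α ∈ q₀.roots, ρ' < ‖α - β‖ := fun α hα => by
    by_contra hlt
    obtain ⟨h1, h2⟩ := hr₀ α hα
    exact hq α (hA α (not_le.1 h2) (not_lt.1 hlt)) (mem_roots'.1 h1).2
  have hq₀Y : ∀ b, b ∈ Y ∨ ‖b - β‖ ≤ ρ' → q₀.eval b ≠ 0 := by
    rintro b (hb | hb) h0
    · exact hq b hb (by simp [h0])
    · exact (hr₀' b (hroot hq₀ h0)).not_ge hb
  have hq₁Y : ∀ b, ρ < ‖b - β‖ → q₁.eval b ≠ 0 := fun b hb h0 =>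
    (hr₁ b (hroot hq₁.ne_zero h0)).not_gt hb
  obtain ⟨p₁, p₀, rfl, hdeg⟩ := exists_partial_fraction p hq₁ (q₀ := q₀) fun α hα =>
    hq₀Y α (Or.inr ((hr₁ α (hroot hq₁.ne_zero hα)).trans hρρ'.le))
  set n := q₁.natDegree with hn
  set K := ‖q₀.eval β‖ with hK
  have hK0 : 0 < K := norm_pos_iff.2 (hq₀Y β (Or.inr (by simpa using hρ'.le)))
  set N := p₀ - h * q₀ with hN
  have gq₁ : ∀ t, ρ ≤ t → (gaussPoint β t).seminorm q₁ = t ^ n := fun t ht =>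
    gaussPoint_eq_pow hq₁ (hρ.trans ht) fun α hα => (hr₁ α hα).trans ht
  have gq₀ : ∀ t, 0 ≤ t → t ≤ ρ' → (gaussPoint β t).seminorm q₀ = K := fun t h0 ht =>
    gaussPoint_eq_norm_eval h0 fun α hα => ht.trans_lt (hr₀' α hα)
  -- On the annulus p₁/q₁ + N/q₀ is the difference p/q − h, of size at most ε. Here |q₁| is tⁿ and
  -- |q₀| is the constant K.
  have key : ∀ t, ρ ≤ t → t ≤ ρ' →
      (gaussPoint β t).seminorm (p₁ * q₀ + N * q₁) ≤ ε * (t ^ n * K) := by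
    intro t h1 h2
    rw [← gq₁ t h1, ← gq₀ t (hρ.trans h1) h2, ← map_mul]
    refine gaussPoint_le_of_annulus hρ _ _ (fun b hb1 hb2 => ?_) h1 h2 hρρ'
    have h3 := hd b hb1 hb2.le
    have h4 := hq₀Y b (Or.inr hb2.le)
    have h5 := hq₁Y b hb1
    have h6 : eval b (q₁ * q₀) ≠ 0 := by simp [h4, h5]
    rw [← div_le_iff₀ (norm_pos_iff.2 h6), ← norm_div]
    refine le_of_eq_of_le ?_ h3
    congr 1
    simp only [hN, eval_add, eval_mul, eval_sub]
    field_simp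
    ring
  have hp₁ : ∀ t, ρ < t → t ≤ ρ' → (gaussPoint β t).seminorm p₁ ≤ ε * t ^ n := by
    -- The two summands are bounded separately. If |p₁/q₁| exceeded ε at t, both would have equal
    -- norm there, and likewise at any smaller s in the annulus, where |p₁/q₁| is larger. But
    -- |p₁/q₁| strictly decreases with the radius while |N/q₀| does not.
    have hNeq : ∀ t, ρ < t → t ≤ ρ' → ε * t ^ n < (gaussPoint β t).seminorm p₁ →
        (gaussPoint β t).seminorm N * t ^ n = (gaussPoint β t).seminorm p₁ * K := by
      intro t h1 h2 h3
      have h4 := key t h1.le h2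
      have h5 : ε * (t ^ n * K) < (gaussPoint β t).seminorm (p₁ * q₀) := by
        rw [map_mul, gq₀ t (hρ.trans h1.le) h2, ← mul_assoc]
        gcongr
      have h6 : (gaussPoint β t).seminorm (N * q₁) = (gaussPoint β t).seminorm (p₁ * q₀) := by
        apply le_antisymm
        · have e : N * q₁ = (p₁ * q₀ + N * q₁) + -(p₁ * q₀) := by ring
          rw [e]
          refine ((gaussPoint β t).add_le_max _ _).trans (max_le (h4.trans h5.le) ?_)
          rw [map_neg_eq_map]
        · have e : p₁ * q₀ = (p₁ * q₀ + N * q₁) + -(N * q₁) := by ring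
          have h7 := (gaussPoint β t).add_le_max (p₁ * q₀ + N * q₁) (-(N * q₁))
          rw [← e, map_neg_eq_map, le_max_iff, or_iff_right (by linarith)] at h7
          exact h7
      rwa [map_mul, map_mul, gq₁ t h1.le, gq₀ t (hρ.trans h1.le) h2] at h6
    intro t h1 h2
    by_contra! hlt
    obtain ⟨s, hs1, hs2⟩ := exists_between h1
    have hs0 : 0 < s := hρ.trans_lt hs1
    have ht0 : 0 < t := hs0.trans hs2
    have h3 := gaussPoint_mul_pow_lt hdeg hs0 hs2
      (lt_of_le_of_lt (by positivity : 0 ≤ ε * t ^ n) hlt)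
    have h4 : ε * s ^ n < (gaussPoint β s).seminorm p₁ := by
      have : ε * s ^ n * t ^ n < (gaussPoint β s).seminorm p₁ * t ^ n := by
        refine lt_of_le_of_lt ?_ h3
        calc ε * s ^ n * t ^ n = ε * t ^ n * s ^ n := by ring
          _ ≤ _ := by gcongr
      exact lt_of_mul_lt_mul_right this (by positivity)
    have h5 := hNeq t h1 h2 hlt
    have h6 := hNeq s hs1 (hs2.le.trans h2) h4
    have h7 := gaussPoint_mono β hs0.le hs2.le N
    have h8 : (gaussPoint β s).seminorm p₁ * t ^ n * K ≤
        (gaussPoint β t).seminorm p₁ * s ^ n * K := by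
      calc (gaussPoint β s).seminorm p₁ * t ^ n * K
          = (gaussPoint β s).seminorm N * s ^ n * t ^ n := by rw [h6]; ring
        _ ≤ (gaussPoint β t).seminorm N * s ^ n * t ^ n := by gcongr
        _ = (gaussPoint β t).seminorm N * t ^ n * s ^ n := by ring
        _ = _ := by rw [h5]; ring
    exact absurd (le_of_mul_le_mul_right h8 hK0) (not_le.2 h3)
  -- The principal part keeps decreasing beyond the annulus, so discarding it costs at most ε on all
  -- of Y outside the disc.
  have hp₁' : ∀ t, ρ < t → (gaussPoint β t).seminorm p₁ ≤ ε * t ^ n := by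
    intro t h1
    rcases le_or_gt t ρ' with h2 | h2
    · exact hp₁ t h1 h2
    rcases (BerkovichLine.nonneg (gaussPoint β t) p₁).eq_or_lt with h0 | h0
    · rw [← h0]
      have := hρ.trans_lt h1
      positivity
    have h3 := gaussPoint_mul_pow_lt hdeg hρ' h2 h0
    have h4 := hp₁ ρ' hρρ' le_rfl
    have h5 : 0 < t := hρ'.trans h2
    have h6 : (gaussPoint β t).seminorm p₁ * ρ' ^ n ≤ ε * t ^ n * ρ' ^ n := by
      refine h3.le.trans ?_
      calc _ ≤ ε * ρ' ^ n * t ^ n := by gcongr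
        _ = _ := by ring
    exact le_of_mul_le_mul_right h6 (by positivity)
  have hNle : (gaussPoint β ρ').seminorm N ≤ ε * K := by
    have h1 := key ρ' hρρ'.le le_rfl
    have h2 := hp₁ ρ' hρρ' le_rfl
    have h3 : (gaussPoint β ρ').seminorm (N * q₁) ≤ ε * (ρ' ^ n * K) := by
      have e : N * q₁ = (p₁ * q₀ + N * q₁) + -(p₁ * q₀) := by ring
      rw [e]
      refine ((gaussPoint β ρ').add_le_max _ _).trans (max_le h1 ?_)
      rw [map_neg_eq_map, map_mul, gq₀ ρ' hρ'.le le_rfl, ← mul_assoc]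
      gcongr
    rw [map_mul, gq₁ ρ' hρρ'.le] at h3
    have h4 : (gaussPoint β ρ').seminorm N * ρ' ^ n ≤ ε * K * ρ' ^ n := by
      linarith
    exact le_of_mul_le_mul_right h4 (by positivity)
  refine ⟨p₀, q₀, hq₀Y, fun b hb hb' => ?_, fun b hb => ?_⟩
  · have h1 := hq₀Y b (Or.inl hb)
    have h2 := hq₁Y b hb'
    have e : eval b (p₁ * q₀ + p₀ * q₁) / eval b (q₁ * q₀) - eval b p₀ / eval b q₀ =
        eval b p₁ / eval b q₁ := by
      simp only [eval_add, eval_mul]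
      field_simp
      ring
    rw [e, norm_div, div_le_iff₀ (norm_pos_iff.2 h2)]
    refine (norm_eval_le_gaussPoint le_rfl p₁).trans ((hp₁' _ hb').trans_eq ?_)
    rw [norm_eval_eq_gaussPoint fun α hα => ?_, gq₁ _ hb'.le]
    rw [norm_sub_rev]
    exact ((hr₁ α hα).trans_lt hb').ne
  · have h1 := hq₀Y b (Or.inr hb)
    have e : eval b h - eval b p₀ / eval b q₀ = -(eval b N / eval b q₀) := by
      simp only [hN, eval_sub, eval_mul]
      field_simp
      ring
    rw [e, norm_neg, norm_div, div_le_iff₀ (norm_pos_iff.2 h1)]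
    refine (norm_eval_le_gaussPoint hb N).trans (hNle.trans_eq ?_)
    congr 1
    refine (norm_eval_const q₀ β (fun c hc => hq₀Y c (Or.inr hc)) b hb).symm

/-- The function `F` is a uniform limit on `Y` of rational functions without poles in `Y`. -/
def RatApprox (F : k → k) (Y : Set k) : Prop :=
  ∀ ε : ℝ, 0 < ε → ∃ p q : k[X], (∀ b ∈ Y, q.eval b ≠ 0) ∧
    ∀ b ∈ Y, ‖F b - p.eval b / q.eval b‖ ≤ ε

/-- On the annulus around the hole both approximations are available and within ε of each other, so
the poles inside the hole can be removed without spoiling the approximation outside; inside, the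
result stays close to the polynomial. -/
theorem RatApprox.union_disc {F : k → k} {Y : Set k} {β : k} {ρ ρ' : ℝ} (hρ : 0 ≤ ρ)
    (hρρ' : ρ < ρ') (hY : RatApprox F (Y \ {b | ‖b - β‖ ≤ ρ})) (hF : PolyApprox F β ρ')
    (hA : ∀ b, ‖b - β‖ ≤ ρ' → b ∈ Y) : RatApprox F Y := fun ε hε => by
  obtain ⟨p, q, hq, hpq⟩ := hY ε hε
  obtain ⟨h, hh⟩ := hF ε hε
  have hA' : ∀ b, ρ < ‖b - β‖ → ‖b - β‖ ≤ ρ' → b ∈ Y \ {b | ‖b - β‖ ≤ ρ} := fun b h1 h2 =>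
    ⟨hA b h2, not_le.2 h1⟩
  obtain ⟨p₀, q₀, h1, h2, h3⟩ := exists_remove_poles (h := h) (ε := ε) hρ hρρ' hA' hq
    fun b hb1 hb2 => by
      have := norm_sub_le_of_le (hh b hb2) (hpq b (hA' b hb1 hb2))
      rwa [sub_sub_sub_cancel_left] at this
  refine ⟨p₀, q₀, fun b hb => h1 b ?_, fun b hb => ?_⟩
  · rcases le_or_gt ‖b - β‖ ρ with h4 | h4
    · exact Or.inr (h4.trans hρρ'.le)
    · exact Or.inl ⟨hb, not_le.2 h4⟩
  · rcases le_or_gt ‖b - β‖ ρ with h4 | h4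
    · rw [← sub_add_sub_cancel (F b) (h.eval b)]
      exact norm_add_le_of_le (hh b (h4.trans hρρ'.le)) (h3 b (h4.trans hρρ'.le))
    · rw [← sub_add_sub_cancel (F b) (p.eval b / q.eval b)]
      exact norm_add_le_of_le (hpq b ⟨hb, not_le.2 h4⟩) (h2 b ⟨hb, not_le.2 h4⟩ h4)

theorem RatApprox.union_discs {F : k → k} {Y : Set k} {ρ ρ' : ℝ} (hρ : 0 ≤ ρ)
    (hρρ' : ρ < ρ') (B : Finset k) (hY : RatApprox F {b ∈ Y | ∀ β ∈ B, ρ < ‖b - β‖})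
    (hF : ∀ β ∈ B, PolyApprox F β ρ') (hA : ∀ β ∈ B, ∀ b, ‖b - β‖ ≤ ρ' → b ∈ Y)
    (hB : ∀ β ∈ B, ∀ β' ∈ B, ‖β - β'‖ ≤ ρ ∨ ρ' < ‖β - β'‖) : RatApprox F Y := by
  classical
  induction B using Finset.induction_on with
  | empty => simpa using hY
  | insert β B hβ ih =>
    have hm : ∀ {b}, b ∈ B → b ∈ insert β B := fun h => Finset.mem_insert_of_mem h
    have hβm := Finset.mem_insert_self β B
    refine ih ?_ (fun b hb => hF b (hm hb)) (fun b hb => hA b (hm hb))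
      fun b hb c hc => hB b (hm hb) c (hm hc)
    have e : {b ∈ Y | ∀ β' ∈ insert β B, ρ < ‖b - β'‖} =
        {b ∈ Y | ∀ β ∈ B, ρ < ‖b - β‖} \ {b | ‖b - β‖ ≤ ρ} := by
      ext b
      simp only [Finset.forall_mem_insert, Set.mem_sdiff, Set.mem_ofPred_eq, not_le]
      tauto
    -- Two of the discs of radius ρ either coincide, and then removing the second changes nothing,
    -- or their centres are more than ρ' apart, and then the enlarged disc around β avoids the other
    -- holes.
    by_cases hnear : ∃ β' ∈ B, ‖β - β'‖ ≤ ρ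
    · obtain ⟨β', hβ', hle⟩ := hnear
      convert hY using 1
      rw [e, eq_comm, sdiff_eq_left, Set.disjoint_left]
      intro b hb hbβ
      exact (hb.2 β' hβ').not_ge (norm_sub_le_trans hbβ hle)
    · rw [e] at hY
      refine hY.union_disc hρ hρρ' (hF β hβm) fun b hb => ⟨hA β hβm b hb, fun β' hβ' => ?_⟩
      by_contra! hle
      have h1 : ‖β - β'‖ ≤ ρ' :=
        norm_sub_le_trans (b := b) (by rwa [norm_sub_rev]) (hle.trans hρρ'.le)
      exact hnear ⟨β', hβ', (hB β hβm β' (hm hβ')).resolve_right (not_lt.2 h1)⟩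

end MittagLeffler

/-! ### Nested discs, and polynomial approximation of analytic functions. -/

section Tate

variable {k : Type u} [NontriviallyNormedField k]

/-- Pointwise limits of multiplicative seminorms are multiplicative. This replaces compactness, and
gives a limit point to nested discs even when no rational point lies in all of them. -/
theorem BerkovichLine.exists_limit {v : ℕ → BerkovichLine k}
    (h : ∀ P, Antitone fun n => (v n).seminorm P) :
    ∃ w : BerkovichLine k, ∀ P,
      Filter.Tendsto (fun n => (v n).seminorm P) Filter.atTop (𝓝 (w.seminorm P)) := by
  have hlim : ∀ P, ∃ x, Filter.Tendsto (fun n => (v n).seminorm P) Filter.atTop (𝓝 x) := fun P =>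
    ⟨_, tendsto_atTop_ciInf (h P) ⟨0, by rintro _ ⟨n, rfl⟩; exact (v n).nonneg P⟩⟩
  choose L hL using hlim
  refine ⟨{ seminorm :=
    { toFun := L
      map_zero' := tendsto_nhds_unique (hL 0) (by simp)
      add_le' := fun P Q => le_of_tendsto_of_tendsto' (hL (P + Q)) ((hL P).add (hL Q)) fun n =>
        map_add_le_add _ P Q
      neg' := fun P => tendsto_nhds_unique (hL (-P)) (by simpa only [map_neg_eq_map] using hL P)
      map_one' := tendsto_nhds_unique (hL 1) (by simp)
      map_mul' := fun P Q => tendsto_nhds_unique (hL (P * Q))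
        (by simpa only [map_mul] using (hL P).mul (hL Q)) }
            seminorm_C := fun a => tendsto_nhds_unique (hL (C a))
              (by simp [BerkovichLine.seminorm_C]) }, hL⟩

theorem StrictOpenDisc.isInducing_X_sub_C [IsAlgClosed k] (D : StrictOpenDisc k) :
    Topology.IsInducing fun (v : D.Point) (a : k) => v.1.seminorm (X - C a) :=
  BerkovichLine.isInducing_X_sub_C.comp Topology.IsInducing.subtypeVal

theorem exists_gap {R δ : ℝ} (hR : 0 < R) (hδ : 0 < δ) {Φ : Set ℝ} (hΦ : Φ.Finite) :
    ∃ ρ ρ', 0 ≤ ρ ∧ R - δ < ρ ∧ ρ < ρ' ∧ ρ' < R ∧ ∀ x ∈ Φ, x ≤ ρ ∨ ρ' < x := by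
  obtain ⟨ρ, h1, h2⟩ := exists_between (show max 0 (R - δ) < R from max_lt hR (by linarith))
  have h3 : ∀ᶠ t in 𝓝[>] ρ, ∀ x ∈ Φ, x ≤ ρ ∨ t < x :=
    (Filter.eventually_all_finite hΦ).2 fun x _ => by
      rcases le_or_gt x ρ with h | h
      · exact Filter.Eventually.of_forall fun _ => Or.inl h
      · filter_upwards [nhdsWithin_le_nhds (gt_mem_nhds h)] with t ht using Or.inr ht
  have h4 : ∀ᶠ t in 𝓝[>] ρ, t < R := nhdsWithin_le_nhds (gt_mem_nhds h2)
  obtain ⟨ρ', ⟨h5, h6⟩, h7⟩ := ((h3.and h4).and self_mem_nhdsWithin).exists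
  exact ⟨ρ, ρ', (le_max_left _ _).trans h1.le, (le_max_right _ _).trans_lt h1, h7, h6, h5⟩

variable [IsUltrametricDist k] [IsAlgClosed k]

/-- A disc of nearly minimal radius among the discs with a property `p` inside a given one. -/
theorem exists_almost_minimal_disc {p : k → ℝ → Prop} {b : k} {t : ℝ} (ht : 0 ≤ t) (hb : p b t)
    {η : ℝ} (hη : 0 < η) :
    ∃ c s, (0 ≤ s ∧ p c s) ∧ ‖c - b‖ ≤ t ∧ s ≤ t ∧
      ∀ c' s', ‖c' - c‖ ≤ s → 0 ≤ s' → s' ≤ s → p c' s' → s - η < s' := by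
  set M : Set ℝ := {s | ∃ c, ‖c - b‖ ≤ t ∧ 0 ≤ s ∧ s ≤ t ∧ p c s} with hM
  have hbdd : BddBelow M := ⟨0, fun s hs => by obtain ⟨c, h⟩ := hs; exact h.2.1⟩
  have hne : M.Nonempty := ⟨t, b, by simpa using ht, ht, le_rfl, hb⟩
  obtain ⟨s, ⟨c, h1, h2, h3, h4⟩, hs⟩ := exists_lt_of_csInf_lt hne (lt_add_of_pos_right (sInf M) hη)
  refine ⟨c, s, ⟨h2, h4⟩, h1, h3, fun c' s' h5 h6 h7 h8 => ?_⟩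
  have := csInf_le hbdd
    (show s' ∈ M from ⟨c', norm_sub_le_trans (h5.trans h3) h1, h6, h7.trans h3, h8⟩)
  linarith

/-- A decreasing sequence of discs for which the radii of the smaller discs with property `p` are
eventually bounded below by numbers close to the radii in the sequence. -/
theorem exists_disc_sequence {p : k → ℝ → Prop} {a : k} {r : ℝ} (hr : 0 ≤ r) (ha : p a r) :
    ∃ (A : ℕ → k) (R : ℕ → ℝ), A 0 = a ∧ R 0 = r ∧ (∀ n, 0 ≤ R n ∧ p (A n) (R n)) ∧
      (∀ n, ‖A (n + 1) - A n‖ ≤ R n) ∧ Antitone R ∧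
      ∀ η, 0 < η → ∃ n, ∀ c s, ‖c - A n‖ ≤ R n → 0 ≤ s → s ≤ R n - η → ¬ p c s := by
  have hstep : ∀ (n : ℕ) (x : {x : k × ℝ // 0 ≤ x.2 ∧ p x.1 x.2}),
      ∃ y : {x : k × ℝ // 0 ≤ x.2 ∧ p x.1 x.2}, ‖y.1.1 - x.1.1‖ ≤ x.1.2 ∧ y.1.2 ≤ x.1.2 ∧
        ∀ c' s', ‖c' - y.1.1‖ ≤ y.1.2 → 0 ≤ s' → s' ≤ y.1.2 → p c' s' →
          y.1.2 - 1 / ((n : ℝ) + 1) < s' := by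
    rintro n ⟨⟨b, t⟩, ht, hb⟩
    obtain ⟨c, s, h1, h2, h3, h4⟩ :=
      exists_almost_minimal_disc ht hb (show 0 < 1 / ((n : ℝ) + 1) by positivity)
    exact ⟨⟨⟨c, s⟩, h1⟩, h2, h3, h4⟩
  choose g hg1 hg2 hg3 using hstep
  let x : ℕ → {x : k × ℝ // 0 ≤ x.2 ∧ p x.1 x.2} := fun n =>
    Nat.rec ⟨⟨a, r⟩, hr, ha⟩ (fun n y => g n y) n
  refine ⟨fun n => (x n).1.1, fun n => (x n).1.2, rfl, rfl, fun n => (x n).2,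
    fun n => hg1 n (x n), antitone_nat_of_succ_le fun n => hg2 n (x n), fun η hη => ?_⟩
  obtain ⟨n, hn⟩ := exists_nat_one_div_lt hη
  refine ⟨n + 1, fun c s h1 h2 h3 h4 => ?_⟩
  have := hg3 n (x n) c s h1 h2 (h3.trans (by linarith)) h4
  change (x (n + 1)).1.2 - _ < _ at this
  linarith

variable [CompleteSpace k]

/-- An analytic function on a neighbourhood of a closed disc is a uniform limit of polynomials
there. -/
theorem IsAnalytic.polyApprox {D : StrictOpenDisc k} {U : Opens D.Point} {f : RatIn U → k}
    (hf : IsAnalytic f) {a : k} {r : ℝ} (hr : 0 ≤ r)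
    (hU : ∀ v : BerkovichLine k, v.seminorm (X - C a) ≤ r →
      ∃ h : v.seminorm (X - C D.center) < D.radius, (⟨v, h⟩ : D.Point) ∈ U) :
    PolyApprox (zeroExt f) a r := by
  classical
  by_contra hbad
  set F := zeroExt f with hF
  -- Nested discs on which approximation fails, of nearly minimal radius. They shrink to a point v,
  -- and near v the function is a uniform limit of rational functions, which will contradict the
  -- failure on a late disc of the sequence.
  obtain ⟨A, R, hA0, hR0, hAR, hA, hR, hmin⟩ :=
    exists_disc_sequence (p := fun b t => ¬ PolyApprox F b t) hr hbad
  have hRnn : ∀ n, 0 ≤ R n := fun n => (hAR n).1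
  have hAA : ∀ n m, n ≤ m → ‖A m - A n‖ ≤ R n := by
    intro n m hnm
    induction m, hnm using Nat.le_induction with
    | base => simpa using hRnn n
    | succ m hm ih => exact norm_sub_le_trans ((hA m).trans (hR hm)) ih
  have hanti : ∀ P, Antitone fun n => (gaussPoint (A n) (R n)).seminorm P := fun P =>
    antitone_nat_of_succ_le fun n => le_gaussPoint (by
      rw [gaussPoint_X_sub_C _ _ (hRnn _)]
      exact max_le (hR n.le_succ) (hA n)) P
  obtain ⟨v, hv⟩ := BerkovichLine.exists_limit hanti
  have hvA : ∀ n, v.seminorm (X - C (A n)) ≤ R n := fun n => by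
    refine le_of_tendsto (hv (X - C (A n))) ?_
    filter_upwards [Filter.eventually_ge_atTop n] with m hm
    rw [gaussPoint_X_sub_C _ _ (hRnn m)]
    exact max_le (hR hm) (hAA n m hm)
  obtain ⟨hvD, hvU⟩ := hU v (by rw [← hA0, ← hR0]; exact hvA 0)
  obtain ⟨V, hvV, hVU, hV⟩ := hf ⟨v, hvD⟩ hvU
  obtain ⟨S, δ, hδ, hS⟩ := exists_finset_nhds D.isInducing_X_sub_C V.isOpen hvV
  have hRbdd : BddBelow (Set.range R) := ⟨0, by rintro _ ⟨n, rfl⟩; exact hRnn n⟩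
  have hRlim := tendsto_atTop_ciInf hR hRbdd
  set R' := ⨅ n, R n with hR'
  have hR'n : ∀ n, R' ≤ R n := fun n => ciInf_le hRbdd n
  have hR'0 : 0 ≤ R' := le_ciInf hRnn
  -- Among the centres that define the neighbourhood V of v, those that belong to all the discs.
  -- From these v has distance R', the limit of the radii; the others are eventually outside the
  -- disc.
  set Sin := S.filter fun α => ∀ n, ‖α - A n‖ ≤ R n with hSin
  have hvin : ∀ α ∈ Sin, v.seminorm (X - C α) = R' := fun α hα => by
    refine tendsto_nhds_unique (hv (X - C α)) ?_
    refine hRlim.congr fun n => ?_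
    rw [gaussPoint_X_sub_C _ _ (hRnn n), max_eq_left]
    rw [norm_sub_rev]
    exact (Finset.mem_filter.1 hα).2 n
  have hout : ∀ᶠ n in Filter.atTop, ∀ α ∈ S, α ∉ Sin → R n < ‖α - A n‖ := by
    refine (Finset.eventually_all S).2 fun α hα => ?_
    by_cases hα' : α ∈ Sin
    · exact Filter.Eventually.of_forall fun n h => absurd hα' h
    · have : ∃ n, R n < ‖α - A n‖ := by
        by_contra! hcon
        exact hα' (Finset.mem_filter.2 ⟨hα, hcon⟩)
      obtain ⟨n, hn⟩ := this
      filter_upwards [Filter.eventually_ge_atTop n] with m hm _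
      by_contra! hle
      exact hn.not_ge (norm_sub_le_trans (hle.trans (hR hm)) (hAA n m hm))
  obtain ⟨n, hnout, hnR⟩ := (hout.and (hRlim.eventually
    (gt_mem_nhds (show R' < R' + δ by linarith)))).exists
  -- Discs of radius ρ around the centres in `Sin` are cut out, with ρ < ρ' < R' and ρ > R' − δ, so
  -- that what remains of a late disc has its rational points in V. No mutual distance of these
  -- centres lies in (ρ, ρ']. If R' = 0 nothing needs to be cut out.
  obtain ⟨B, ρ, ρ', hρ, hρρ', hBin, hBρ, hBS, hBB⟩ : ∃ (B : Finset k) (ρ ρ' : ℝ), 0 ≤ ρ ∧ ρ < ρ' ∧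
      (∀ β ∈ B, β ∈ Sin) ∧ (∀ β ∈ B, ρ' < R') ∧
      (∀ α ∈ Sin, ∀ t, 0 ≤ t → (α ∈ B → ρ < t) → R' - δ < t) ∧
      ∀ β ∈ B, ∀ β' ∈ B, ‖β - β'‖ ≤ ρ ∨ ρ' < ‖β - β'‖ := by
    rcases hR'0.eq_or_lt with h0 | h0
    · exact ⟨∅, 0, 1, le_rfl, one_pos, by simp, by simp, fun α _ t ht _ => by linarith, by simp⟩
    · obtain ⟨ρ, ρ', h1, h2, h3, h4, h5⟩ := exists_gap h0 hδ
        (Φ := (fun x : k × k => ‖x.1 - x.2‖) '' ((Sin ×ˢ Sin : Finset (k × k)) : Set (k × k)))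
        ((Finset.finite_toSet _).image _)
      exact ⟨Sin, ρ, ρ', h1, h3, fun _ h => h, fun _ _ => h4,
        fun α hα t _ ht => h2.trans (ht hα), fun β hβ β' hβ' =>
          h5 _ ⟨⟨β, β'⟩, by simp [hβ, hβ'], rfl⟩⟩
  have hBA : ∀ β ∈ B, ∀ m, ‖β - A m‖ ≤ R m := fun β hβ => (Finset.mem_filter.1 (hBin β hβ)).2
  refine (hAR n).2 (polyApprox_of_rational ?_)
  refine RatApprox.union_discs (Y := {b | ‖b - A n‖ ≤ R n}) hρ hρρ' B ?_ ?_ ?_ hBB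
  · intro ε hε
    obtain ⟨p, q, hq, hpq⟩ := hV ε hε
    -- For a centre in `Sin` the distance from b lies between R' − δ and R' + δ. For a centre
    -- outside the disc the distances from b and from v both equal the distance from `A n`.
    have hmem : ∀ b ∈ {b ∈ {b | ‖b - A n‖ ≤ R n} | ∀ β ∈ B, ρ < ‖b - β‖},
        ∃ hb : ‖b - D.center‖ < D.radius, D.ratPt ⟨b, hb⟩ ∈ V := by
      rintro b ⟨hb1, hb2⟩
      have hb1 : ‖b - A n‖ ≤ R n := hb1
      have hbr : ‖b - a‖ ≤ r := by
        rw [← hA0, ← hR0]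
        exact norm_sub_le_trans (hb1.trans (hR (Nat.zero_le n))) (hAA 0 n (Nat.zero_le n))
      obtain ⟨hbD, -⟩ := hU (BerkovichLine.rational b) (by simpa using hbr)
      have hbD' : ‖b - D.center‖ < D.radius := by simpa using hbD
      refine ⟨hbD', hS _ fun α hα => ?_⟩
      change |(BerkovichLine.rational b).seminorm (X - C α) - v.seminorm (X - C α)| < δ
      rw [BerkovichLine.rational_X_sub_C]
      by_cases hα' : α ∈ Sin
      · have h1 : ‖b - α‖ ≤ R n := norm_sub_le_trans hb1 (by
          rw [norm_sub_rev]; exact (Finset.mem_filter.1 hα').2 n)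
        have h2 := hBS α hα' ‖b - α‖ (norm_nonneg _) (hb2 α)
        rw [hvin α hα', abs_lt]
        constructor <;> linarith
      · have h1 := hnout α hα hα'
        rw [norm_sub_rev] at h1
        rw [v.X_sub_C_eq_norm ((hvA n).trans_lt h1),
          ← (BerkovichLine.rational b).X_sub_C_eq_norm (a := A n) (b := α)
            (by rw [BerkovichLine.rational_X_sub_C]; exact hb1.trans_lt h1)]
        simpa using hδ
    refine ⟨p, q, fun b hb => ?_, fun b hb => ?_⟩
    · obtain ⟨hbD, hbV⟩ := hmem b hb
      exact eval_ne_zero hq hbV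
    · obtain ⟨hbD, hbV⟩ := hmem b hb
      have := hpq ⟨⟨b, hbD⟩, hVU hbV⟩ hbV
      rwa [← zeroExt_apply f] at this
  · intro β hβ
    -- Since ρ' stays below the limit radius, near-minimality forces polynomial approximation on the
    -- disc of radius ρ' around β. This fills the holes.
    obtain ⟨m, hm⟩ := hmin (R' - ρ') (by linarith [hBρ β hβ])
    have := hm β ρ' (hBA β hβ m) (hρ.trans hρρ'.le) (by linarith [hR'n m])
    exact not_not.1 this
  · intro β hβ b hb
    exact norm_sub_le_trans (hb.trans ((hBρ β hβ).le.trans (hR'n n))) (hBA β hβ n)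

end Tate

/-! ### Density of rational points in a disc, inverses of analytic functions -/

section Disc

variable {k : Type u} [NontriviallyNormedField k] [IsUltrametricDist k] [IsAlgClosed k]

theorem BerkovichLine.X_sub_C_lt_iff (v : BerkovichLine k) {a b : k} {r : ℝ} (h : ‖a - b‖ < r) :
    v.seminorm (X - C a) < r ↔ v.seminorm (X - C b) < r :=
  ⟨fun h' => (v.X_sub_C_le_max a b).trans_lt (max_lt h' h),
    fun h' => (v.X_sub_C_le_max b a).trans_lt (max_lt h' (by rwa [norm_sub_rev]))⟩

theorem StrictOpenDisc.isOpen_points (D : StrictOpenDisc k) :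
    IsOpen {v : BerkovichLine k | v.seminorm (X - C D.center) < D.radius} :=
  isOpen_lt (BerkovichLine.continuous_seminorm _) continuous_const

theorem StrictOpenDisc.exists_ratPt_mem (D : StrictOpenDisc k) {V : Set D.Point} (hV : IsOpen V)
    (hne : V.Nonempty) : ∃ a, D.ratPt a ∈ V := by
  have h1 : IsOpen (Subtype.val '' V) := D.isOpen_points.isOpenEmbedding_subtypeVal.isOpenMap V hV
  obtain ⟨a, v, hv, hva⟩ := denseRange_rational.exists_mem_open h1 (hne.image _)
  have ha : ‖a - D.center‖ < D.radius := by
    rw [← BerkovichLine.rational_X_sub_C, ← hva]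
    exact v.2
  refine ⟨⟨a, ha⟩, ?_⟩
  rwa [show D.ratPt ⟨a, ha⟩ = v from Subtype.ext hva.symm]

theorem StrictOpenDisc.le_of_rational (D : StrictOpenDisc k) {V : Set D.Point} (hV : IsOpen V)
    {f g : D.Point → ℝ} (hf : Continuous f) (hg : Continuous g)
    (h : ∀ a, D.ratPt a ∈ V → f (D.ratPt a) ≤ g (D.ratPt a)) {v : D.Point} (hv : v ∈ V) :
    f v ≤ g v := by
  by_contra! hlt
  obtain ⟨a, ha, ha'⟩ := D.exists_ratPt_mem (hV.inter (isOpen_lt hg hf)) ⟨v, hv, hlt⟩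
  exact (h a ha).not_gt ha'

/-- A nearby fraction p/q is also bounded below at rational points, and by density |p| is bounded
below by a multiple of |q| on the whole neighbourhood. Thus q/p has no poles at the non-rational
points either. -/
theorem IsAnalytic.inv {D : StrictOpenDisc k} {U : Opens D.Point} {g : RatIn U → k}
    (hg : IsAnalytic g) {c : ℝ} (hc : 0 < c) (h : ∀ a, c ≤ ‖g a‖) :
    IsAnalytic fun a => (g a)⁻¹ := by
  intro y hy
  obtain ⟨V, hyV, hVU, hV⟩ := hg y hy
  refine ⟨V, hyV, hVU, fun ε hε => ?_⟩
  obtain ⟨p, q, hq, hpq⟩ := hV (min (c / 2) (ε * (c * (c / 2)))) (by positivity)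
  have h1 : ∀ a : RatIn U, D.ratPt a.1 ∈ V → c / 2 ≤ ‖p.eval a.1.1 / q.eval a.1.1‖ := by
    intro a ha
    have h2 := (hpq a ha).trans (min_le_left _ _)
    have h3 := norm_sub_norm_le (g a) (p.eval a.1.1 / q.eval a.1.1)
    linarith [h a]
  refine ⟨q, p, fun v hv => ?_, fun a ha => ?_⟩
  · have h2 : c / 2 * v.1.seminorm q ≤ v.1.seminorm p :=
      D.le_of_rational V.isOpen (continuous_const.mul (continuous_seminorm D q))
        (continuous_seminorm D p) (fun a ha => by
          have h3 := h1 ⟨a, hVU ha⟩ ha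
          rwa [norm_div, le_div_iff₀ (norm_pos_iff.2 (eval_ne_zero hq ha))] at h3) hv
    have h3 : 0 < v.1.seminorm q := lt_of_le_of_ne (apply_nonneg _ _) (hq v hv).symm
    exact (lt_of_lt_of_le (by positivity) h2).ne'
  · set r := p.eval a.1.1 / q.eval a.1.1 with hr
    have h2 := (hpq a ha).trans (min_le_right _ _)
    have h3 := h1 a ha
    have hg0 : 0 < ‖g a‖ := hc.trans_le (h a)
    have hr0 : 0 < ‖r‖ := lt_of_lt_of_le (by positivity) h3
    have hg1 : g a ≠ 0 := norm_pos_iff.1 hg0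
    have hr1 : r ≠ 0 := norm_pos_iff.1 hr0
    have e : (g a)⁻¹ - q.eval a.1.1 / p.eval a.1.1 = -(g a - r) / (g a * r) := by
      rw [show q.eval a.1.1 / p.eval a.1.1 = r⁻¹ by rw [hr, inv_div]]
      field_simp
      ring
    rw [e, norm_div, norm_neg, norm_mul, div_le_iff₀ (by positivity)]
    refine h2.trans ?_
    have := h a
    gcongr

theorem isAnalytic_of_polyApprox {D : StrictOpenDisc k} {U : Opens D.Point}
    {F : k → k} {y : k} {r : ℝ} (hF : PolyApprox F y r)
    (hU : ∀ v ∈ U, v.1.seminorm (X - C y) < r) : IsAnalytic fun a : RatIn U => F a.1.1 :=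
  fun v hv => ⟨U, hv, le_rfl, fun ε hε => by
    obtain ⟨P, hP⟩ := hF ε hε
    refine ⟨P, 1, fun v _ => by simp, fun a _ => ?_⟩
    have h1 := hU _ a.2
    rw [StrictOpenDisc.ratPt, BerkovichLine.rational_X_sub_C] at h1
    simpa using hP a.1.1 h1.le⟩

/-- The open disc of radius `r` around `a`, inside `D`. -/
noncomputable def StrictOpenDisc.ball (D : StrictOpenDisc k) (a : k) (r : ℝ) : Opens D.Point :=
  ⟨{v | v.1.seminorm (X - C a) < r}, isOpen_lt (continuous_seminorm D _) continuous_const⟩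

theorem StrictOpenDisc.mem_ball {D : StrictOpenDisc k} {a : k} {r : ℝ} {v : D.Point} :
    v ∈ D.ball a r ↔ v.1.seminorm (X - C a) < r := Iff.rfl

theorem StrictOpenDisc.ratPt_mem_ball {D : StrictOpenDisc k} {a : k} {r : ℝ} {b : D.RatPoint} :
    D.ratPt b ∈ D.ball a r ↔ ‖b.1 - a‖ < r := by
  rw [StrictOpenDisc.mem_ball, StrictOpenDisc.ratPt, BerkovichLine.rational_X_sub_C]

/-- The discs around a rational point form a basis of neighbourhoods. -/
theorem StrictOpenDisc.exists_ball_le {D : StrictOpenDisc k} (a : D.RatPoint) {U : Opens D.Point}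
    (ha : D.ratPt a ∈ U) : ∃ r, 0 < r ∧ r < D.radius ∧ D.ball a.1 r ≤ U := by
  obtain ⟨S, δ, hδ, hS⟩ := exists_finset_nhds D.isInducing_X_sub_C U.isOpen ha
  refine ⟨min δ (D.radius / 2), lt_min hδ (by have := D.radius_pos; positivity),
    (min_le_right _ _).trans_lt (by linarith [D.radius_pos]), fun v hv => hS v fun α hα => ?_⟩
  have hv : v.1.seminorm (X - C a.1) < _ := hv
  have h1 := hv.trans_le (min_le_left _ _)
  rw [StrictOpenDisc.ratPt, BerkovichLine.rational_X_sub_C]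
  rcases lt_or_ge (v.1.seminorm (X - C a.1)) ‖a.1 - α‖ with h | h
  · rw [v.1.X_sub_C_eq_norm h]; simpa using hδ
  · have h2 := v.1.X_sub_C_le_max a.1 α
    rw [max_eq_left h] at h2
    have h3 := v.1.nonneg (X - C α)
    have h4 := norm_nonneg (a.1 - α)
    rw [abs_lt]
    constructor <;> linarith

variable [CompleteSpace k]

theorem IsAnalytic.polyApprox_of_ball_le {D : StrictOpenDisc k} {U : Opens D.Point}
    {f : RatIn U → k} (hf : IsAnalytic f) {a : k} (ha : ‖a - D.center‖ < D.radius) {r s : ℝ}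
    (hU : D.ball a r ≤ U) (hr : r ≤ D.radius) (hs : 0 ≤ s) (hsr : s < r) :
    PolyApprox (zeroExt f) a s := by
  refine hf.polyApprox hs fun v hv => ?_
  have h1 := hv.trans_lt hsr
  exact ⟨(v.X_sub_C_lt_iff ha).1 (h1.trans_le hr), hU h1⟩

/-- Division of analytic functions, at a simple zero of the denominator. -/
theorem IsAnalytic.div_of_simple_zeros {D : StrictOpenDisc k} {U : Opens D.Point}
    {h f : RatIn U → k} (hh : IsAnalytic h) (hf : IsAnalytic f)
    (hdisc : ∀ y ∈ U, (∀ a : RatIn U, D.ratPt a.1 = y → f a ≠ 0) →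
      ∃ V : Opens D.Point, y ∈ V ∧ V ≤ U ∧ ∃ c : ℝ, 0 < c ∧
        ∀ a : RatIn U, D.ratPt a.1 ∈ V → c ≤ ‖f a‖)
    (hsimple : ∀ a, f a = 0 → h a = 0 ∧ deriv (zeroExt f) a.1.1 ≠ 0) :
    ∃ g : RatIn U → k, IsAnalytic g ∧ h = f * g := by
  classical
  refine ⟨fun a => if f a = 0 then deriv (zeroExt h) a.1.1 / deriv (zeroExt f) a.1.1
    else h a / f a, ?_, ?_⟩
  swap
  · funext a
    by_cases ha : f a = 0
    · simp [ha, (hsimple a ha).1]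
    · simp [ha]
      field_simp
  refine isAnalytic_of_local fun y hy => ?_
  -- Away from the rational zeros, `hdisc` gives a lower bound and the quotient is h times an
  -- inverse. At a zero a, both functions are T − a times their difference quotients, and that of f
  -- is bounded away from 0 near a because f'(a) ≠ 0.
  by_cases hyf : ∀ a : RatIn U, D.ratPt a.1 = y → f a ≠ 0
  · obtain ⟨V, hyV, hVU, c, hc, hcV⟩ := hdisc y hy hyf
    refine ⟨V, hVU, hyV, ?_⟩
    have h1 := isAnalytic_mul (isAnalytic_mono hVU hh) ((isAnalytic_mono hVU hf).inv hc
      fun a => hcV ⟨a.1, hVU a.2⟩ a.2)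
    convert h1 using 1
    funext a
    have : f ⟨a.1, hVU a.2⟩ ≠ 0 := norm_pos_iff.1 (hc.trans_le (hcV ⟨a.1, hVU a.2⟩ a.2))
    simp [this, div_eq_mul_inv]
  · push Not at hyf
    obtain ⟨a, rfl, ha⟩ := hyf
    obtain ⟨ha1, ha2⟩ := hsimple a ha
    obtain ⟨r, hr0, hrD, hrU⟩ := D.exists_ball_le a.1 a.2
    have hr2 : 0 < r / 2 := by positivity
    have haa : ‖a.1.1 - a.1.1‖ ≤ r / 2 := by simp [hr2.le]
    have hF := (hf.polyApprox_of_ball_le a.1.2 hrU hrD.le hr2.le (by linarith)).dslope hr2 haa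
    have hH := (hh.polyApprox_of_ball_le a.1.2 hrU hrD.le hr2.le (by linarith)).dslope hr2 haa
    have hF0 : dslope (zeroExt f) a.1.1 a.1.1 ≠ 0 := by rwa [dslope_same]
    set c := ‖dslope (zeroExt f) a.1.1 a.1.1‖ with hc
    have hc0 : 0 < c := norm_pos_iff.2 hF0
    obtain ⟨t, ht0, ht⟩ := Metric.eventually_nhds_iff.1
      ((hF.continuousAt hr2 haa).norm.eventually (lt_mem_nhds (show c / 2 < c by linarith)))
    set V := D.ball a.1.1 (min t (r / 2)) with hV
    have hVt : ∀ {b : D.RatPoint}, D.ratPt b ∈ V → ‖b.1 - a.1.1‖ < t := fun hb =>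
      (StrictOpenDisc.ratPt_mem_ball.1 hb).trans_le (min_le_left _ _)
    have hVU : V ≤ U := le_trans (fun v hv => (show v.1.seminorm (X - C a.1.1) < r from
      (show v.1.seminorm (X - C a.1.1) < _ from hv).trans_le
        ((min_le_right _ _).trans (by linarith)))) hrU
    refine ⟨V, hVU, StrictOpenDisc.ratPt_mem_ball.2 (by simpa using ⟨ht0, hr0⟩), ?_⟩
    have hVr : ∀ v ∈ V, v.1.seminorm (X - C a.1.1) < r / 2 := fun v hv =>
      (StrictOpenDisc.mem_ball.1 hv).trans_le (min_le_right _ _)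
    have hFV := isAnalytic_of_polyApprox hF hVr
    have hHV := isAnalytic_of_polyApprox hH hVr
    have hFc : ∀ b : RatIn V, c / 2 ≤ ‖dslope (zeroExt f) a.1.1 b.1.1‖ := fun b =>
      (ht (by rw [dist_eq_norm]; exact hVt b.2)).le
    convert isAnalytic_mul hHV (hFV.inv (by positivity) hFc) using 1
    funext b
    have hb0 : dslope (zeroExt f) a.1.1 b.1.1 ≠ 0 :=
      norm_pos_iff.1 (lt_of_lt_of_le (by positivity) (hFc b))
    rcases eq_or_ne b.1.1 a.1.1 with hba | hba
    · have : (⟨b.1, hVU b.2⟩ : RatIn U) = a := Subtype.ext (Subtype.ext hba)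
      simp only [this, ha, if_true, Pi.mul_apply]
      rw [hba, dslope_same, dslope_same, div_eq_mul_inv]
    · have e1 := sub_smul_dslope (zeroExt f) a.1.1 b.1.1
      have e2 := sub_smul_dslope (zeroExt h) a.1.1 b.1.1
      have e3 := zeroExt_apply f ⟨b.1, hVU b.2⟩
      have e4 := zeroExt_apply h ⟨b.1, hVU b.2⟩
      simp only at e3 e4
      rw [zeroExt_apply f a, ha, sub_zero, e3, smul_eq_mul] at e1
      rw [zeroExt_apply h a, ha1, sub_zero, e4, smul_eq_mul] at e2
      have hne : b.1.1 - a.1.1 ≠ 0 := sub_ne_zero.2 hba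
      have : f ⟨b.1, hVU b.2⟩ ≠ 0 := by rw [← e1]; exact mul_ne_zero hne hb0
      simp only [this, if_false, Pi.mul_apply]
      rw [← e1, ← e2]
      field_simp

/-! ### Factorization of analytic functions with finitely many zeros -/

/-- Zeros are split off one at a time: if F(y) = 0, then F is T − y times its difference quotient,
which is again a uniform limit of polynomials and still vanishes at the other zeros. -/
theorem exists_factorization {F : k → k} {c : k} {R : ℝ} (hR : 0 < R)
    (hF : ∀ ρ < R, PolyApprox F c ρ) (S : Finset k) (hS : ∀ y ∈ S, ‖y - c‖ < R ∧ F y = 0) :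
    ∃ u : k → k, (∀ ρ < R, PolyApprox u c ρ) ∧
      ∀ b, ‖b - c‖ < R → F b = (∏ y ∈ S, (X - C y)).eval b * u b := by
  classical
  induction S using Finset.induction_on generalizing F with
  | empty => exact ⟨F, hF, by simp⟩
  | insert y S hy ih =>
    obtain ⟨hyR, hy0⟩ := hS y (Finset.mem_insert_self _ _)
    have hd : ∀ b, F b = (b - y) * dslope F y b := fun b => by
      have := sub_smul_dslope F y b
      rwa [hy0, sub_zero, smul_eq_mul, eq_comm] at this
    have hF' : ∀ ρ < R, PolyApprox (dslope F y) c ρ := fun ρ hρ => by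
      -- The radius is enlarged so that it is positive and the closed disc contains y.
      have h1 : max ρ (max ‖y - c‖ (R / 2)) < R := max_lt hρ (max_lt hyR (by linarith))
      refine ((hF _ h1).dslope ?_ ?_).mono (le_max_left _ _)
      · exact lt_max_of_lt_right (lt_max_of_lt_right (by linarith))
      · exact le_max_of_le_right (le_max_left _ _)
    obtain ⟨u, hu, hFu⟩ := ih hF' fun z hz => by
      obtain ⟨h1, h2⟩ := hS z (Finset.mem_insert_of_mem hz)
      refine ⟨h1, ?_⟩
      rw [hd] at h2
      refine (mul_eq_zero.1 h2).resolve_left (sub_ne_zero.2 ?_)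
      rintro rfl
      exact hy hz
    refine ⟨u, hu, fun b hb => ?_⟩
    rw [hd, hFu b hb, Finset.prod_insert hy]
    simp
    ring

theorem norm_eq_of_forall_ne_zero {u : k → k} {c : k} {R : ℝ}
    (hu : ∀ ρ < R, PolyApprox u c ρ) (h0 : ∀ b, ‖b - c‖ < R → u b ≠ 0) {b : k}
    (hb : ‖b - c‖ < R) : ‖u b‖ = ‖u c‖ := by
  have hR : 0 < R := (norm_nonneg _).trans_lt hb
  have h1 : max ‖b - c‖ (R / 2) < R := max_lt hb (by linarith)
  obtain ⟨ρ', h2, h3⟩ := exists_between h1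
  exact (hu ρ' h3).norm_eq_of_ne_zero (lt_max_of_lt_right (by linarith)) h2
    (fun z hz => h0 z (hz.trans_lt h1)) (le_max_left _ _)

end Disc

/-! ### Fibres of finite étale morphisms -/

section Fibre

variable {k : Type u} [NontriviallyNormedField k] [IsUltrametricDist k] [IsAlgClosed k]
  [CompleteSpace k] {D₂ D₁ : StrictOpenDisc k} {φ : DiscMorphism D₂ D₁}

theorem StrictOpenDisc.ratPt_injective (D : StrictOpenDisc k) : Function.Injective D.ratPt :=
  fun _ _ h => Subtype.ext (BerkovichLine.rational_injective (congrArg Subtype.val h))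

theorem DiscMorphism.IsEtale.deriv_ne_zero (het : φ.IsEtale) (a : D₂.RatPoint) :
    deriv (zeroExt φ.function.1) a.1 ≠ 0 := by
  obtain ⟨w, hw⟩ := het.exists_right_inv
  have h1 : deriv (zeroExt φ.function.1) a.1 * w.1 ⟨a, trivial⟩ = 1 :=
    congrArg (fun f : analytic (⊤ : Opens D₂.Point) => f.1 ⟨a, trivial⟩) hw
  exact left_ne_zero_of_mul_eq_one h1

theorem zeroExt_function (φ : DiscMorphism D₂ D₁) (a : D₂.RatPoint) :
    zeroExt φ.function.1 a.1 = (φ.onRat a).1 :=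
  zeroExt_apply φ.function.1 ⟨a, trivial⟩

theorem DiscMorphism.seminorm_ratPt (φ : DiscMorphism D₂ D₁) (x : D₁.RatPoint)
    (a : D₂.RatPoint) :
    (φ.toMap (D₂.ratPt a)).1.seminorm (X - C x.1) = ‖(φ.onRat a).1 - x.1‖ := by
  rw [φ.map_ratPt, StrictOpenDisc.ratPt, BerkovichLine.rational_X_sub_C]

/-- The fibre of a finite étale morphism over `x` is given by the simple zeros of a polynomial, and
the pullback of `|T - x|` is proportional to the absolute value of this polynomial. -/
theorem DiscMorphism.IsFinite.exists_fibre (hfin : φ.IsFinite) (het : φ.IsEtale)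
    (x : D₁.RatPoint) :
    ∃ S : Finset k, (∀ a : D₂.RatPoint, φ.onRat a = x ↔ a.1 ∈ S) ∧
      (∀ y ∈ S, ‖y - D₂.center‖ < D₂.radius) ∧ ∃ κ : ℝ, 0 < κ ∧ ∀ v : D₂.Point,
        (φ.toMap v).1.seminorm (X - C x.1) = κ * v.1.seminorm (∏ y ∈ S, (X - C y)) := by
  classical
  have hfib : {a : D₂.RatPoint | φ.onRat a = x}.Finite := by
    refine ((hfin.2 (D₁.ratPt x)).preimage D₂.ratPt_injective.injOn).subset fun a ha => ?_
    change φ.toMap (D₂.ratPt a) = _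
    rw [φ.map_ratPt, show φ.onRat a = x from ha]
  set S := hfib.toFinset.image Subtype.val with hS
  have hmem : ∀ a : D₂.RatPoint, φ.onRat a = x ↔ a.1 ∈ S := fun a => by
    rw [hS, Finset.mem_image]
    constructor
    · exact fun h => ⟨a, hfib.mem_toFinset.2 h, rfl⟩
    · rintro ⟨b, hb, hba⟩
      rw [← Subtype.ext hba]
      exact hfib.mem_toFinset.1 hb
  have hSD : ∀ y ∈ S, ‖y - D₂.center‖ < D₂.radius := fun y hy => by
    obtain ⟨b, -, rfl⟩ := Finset.mem_image.1 hy
    exact b.2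
  set F : k → k := fun b => zeroExt φ.function.1 b - x.1 with hF
  have hFa : ∀ a : D₂.RatPoint, F a.1 = (φ.onRat a).1 - x.1 := fun a => by
    rw [hF, ← zeroExt_function]
  have hFp : ∀ ρ < D₂.radius, PolyApprox F D₂.center ρ := fun ρ hρ ε hε => by
    have h1 : max ρ 0 < D₂.radius := max_lt hρ D₂.radius_pos
    obtain ⟨P, hP⟩ := (φ.function.2.polyApprox (a := D₂.center) (le_max_right ρ 0)
      fun v hv => ⟨hv.trans_lt h1, trivial⟩).mono (le_max_left _ _) ε hε
    exact ⟨P - C x.1, fun b hb => by simpa [hF] using hP b hb⟩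
  obtain ⟨u, hu, hFu⟩ := exists_factorization D₂.radius_pos hFp S fun y hy =>
    ⟨hSD y hy, by
      rw [hFa ⟨y, hSD y hy⟩, (hmem ⟨y, hSD y hy⟩).2 hy, sub_self]⟩
  set Q : k[X] := ∏ y ∈ S, (X - C y) with hQ
  have hu0 : ∀ b, ‖b - D₂.center‖ < D₂.radius → u b ≠ 0 := by
    intro b hb hub
    have hFb : F b = 0 := by rw [hFu b hb, hub, mul_zero]
    have hbS : b ∈ S := by
      rw [← hmem ⟨b, hb⟩]
      rw [hFa ⟨b, hb⟩, sub_eq_zero] at hFb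
      exact Subtype.ext hFb
    have hQb : Q.eval b = 0 := by
      rw [hQ, eval_prod]
      exact Finset.prod_eq_zero hbS (by simp)
    -- A zero of the cofactor u would lie in the fibre and be a zero of Q too, so the derivative of
    -- f would vanish there, against étaleness.
    refine het.deriv_ne_zero ⟨b, hb⟩ ?_
    have hR := D₂.radius_pos
    have h1 : max ‖b - D₂.center‖ (D₂.radius / 2) < D₂.radius := max_lt hb (by linarith)
    have hdu := ((hu _ h1).differentiableAt (lt_max_of_lt_right (by linarith))
      (le_max_left _ _)).hasDerivAt
    have h2 := (Q.hasDerivAt b).mul hdu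
    rw [hub, hQb, mul_zero, zero_mul, add_zero] at h2
    have h3 : HasDerivAt (fun z => F z + x.1) 0 b := by
      refine (h2.add_const x.1).congr_of_eventuallyEq ?_
      have hnear : ∀ᶠ z in 𝓝 b, ‖z - D₂.center‖ < D₂.radius :=
        (continuous_id.sub continuous_const).norm.continuousAt.eventually_lt continuousAt_const hb
      filter_upwards [hnear] with z hz
      rw [hFu z hz]
      rfl
    simpa [hF] using h3.deriv
  refine ⟨S, hmem, hSD, ‖u D₂.center‖, norm_pos_iff.2 (hu0 _ (by simpa using D₂.radius_pos)), ?_⟩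
  have key : ∀ a : D₂.RatPoint, (φ.toMap (D₂.ratPt a)).1.seminorm (X - C x.1) =
      ‖u D₂.center‖ * (D₂.ratPt a).1.seminorm Q := fun a => by
    rw [φ.seminorm_ratPt, ← hFa, hFu _ a.2, norm_mul, norm_eq_of_forall_ne_zero hu hu0 a.2, mul_comm]
    rfl
  have hc1 : Continuous fun v : D₂.Point => (φ.toMap v).1.seminorm (X - C x.1) :=
    (continuous_seminorm D₁ _).comp φ.toMap.continuous
  have hc2 : Continuous fun v : D₂.Point => ‖u D₂.center‖ * v.1.seminorm Q :=
    continuous_const.mul (continuous_seminorm D₂ Q)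
  exact fun v => le_antisymm
    (D₂.le_of_rational isOpen_univ hc1 hc2 (fun a _ => (key a).le) (Set.mem_univ v))
    (D₂.le_of_rational isOpen_univ hc2 hc1 (fun a _ => (key a).ge) (Set.mem_univ v))

/-- Local bases of `φ_* 𝒪`, in terms of functions. -/
theorem DiscMorphism.HasDegree.exists_basis {d : ℕ} (hd : φ.HasDegree d) (y : D₁.Point) :
    ∃ U : Opens D₁.Point, y ∈ U ∧ ∃ e : Fin d → analytic (φ.preimage U),
      (∀ h : analytic (φ.preimage U), ∃ c : Fin d → analytic U,
        ∀ b, h.1 b = ∑ i, (c i).1 (φ.ratIn b) * (e i).1 b) ∧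
      ∀ c : Fin d → analytic U, (∀ b, ∑ i, (c i).1 (φ.ratIn b) * (e i).1 b = 0) → c = 0 := by
  obtain ⟨U, hyU, e, he⟩ := hd y
  refine ⟨U, hyU, e, ?_⟩
  have hval : ∀ (c : Fin d → analytic U) (b : RatIn (φ.preimage U)),
      Subtype.val (p := fun f => f ∈ analytic (φ.preimage U))
        (∑ i, c i • ((structureSheaf D₂).pushforward φ).res (le_refl U) (e i)) b =
        ∑ i, (c i).1 (φ.ratIn b) * Subtype.val (p := fun f => f ∈ analytic (φ.preimage U)) (e i) b := by
    intro c b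
    let ev : ((structureSheaf D₂).pushforward φ).sec U →+ k :=
      { toFun := fun m => Subtype.val (p := fun f => f ∈ analytic (φ.preimage U)) m b
        map_zero' := rfl
        map_add' := fun _ _ => rfl }
    exact map_sum ev _ _
  obtain ⟨hinj, hsurj⟩ := he U le_rfl
  refine ⟨fun h => ?_, fun c hc => hinj ?_⟩
  · obtain ⟨c, hc⟩ := hsurj h
    exact ⟨c, fun b => by rw [← hval c b]; exact congrFun (congrArg Subtype.val hc.symm) b⟩
  · refine Subtype.ext (funext fun b => ?_)
    refine (hval c b).trans ((hc b).trans ?_)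
    refine Eq.trans ?_ (hval 0 b).symm
    simp

theorem DiscMorphism.HasDegree.pos {d : ℕ} (hd : φ.HasDegree d) : 0 < d := by
  have hc : ‖D₂.center - D₂.center‖ < D₂.radius := by simpa using D₂.radius_pos
  let z : D₂.RatPoint := ⟨D₂.center, hc⟩
  obtain ⟨U, hzU, e, he, -⟩ := hd.exists_basis (φ.toMap (D₂.ratPt z))
  -- In rank 0 the function 1 would be an empty sum at a rational point of the preimage.
  obtain ⟨c, hc⟩ := he 1
  rw [Nat.pos_iff_ne_zero]
  rintro rfl
  have := hc ⟨z, hzU⟩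
  simp at this

/-- The fibres of a finite étale morphism of degree `d` have `d` points. -/
theorem DiscMorphism.HasDegree.card_eq {d : ℕ} (hd : φ.HasDegree d) (het : φ.IsEtale)
    {x : D₁.RatPoint} {S : Finset k} (hS : ∀ a : D₂.RatPoint, φ.onRat a = x ↔ a.1 ∈ S)
    (hSD : ∀ y ∈ S, ‖y - D₂.center‖ < D₂.radius) {κ : ℝ} (hκ : 0 < κ)
    (hSκ : ∀ v : D₂.Point,
      (φ.toMap v).1.seminorm (X - C x.1) = κ * v.1.seminorm (∏ y ∈ S, (X - C y))) : S.card = d := by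
  classical
  obtain ⟨U, hxU, e, hspan, hind⟩ := hd.exists_basis (D₁.ratPt x)
  let x' : RatIn U := ⟨x, hxU⟩
  have hyU : ∀ y : S, D₂.ratPt ⟨y.1, hSD y.1 y.2⟩ ∈ φ.preimage U := fun y => by
    change φ.toMap _ ∈ U
    rw [φ.map_ratPt, (hS ⟨y.1, hSD y.1 y.2⟩).2 y.2]
    exact hxU
  let pt : S → RatIn (φ.preimage U) := fun y => ⟨⟨y.1, hSD y.1 y.2⟩, hyU y⟩
  have hpt : ∀ y, φ.ratIn (pt y) = x' := fun y => Subtype.ext ((hS _).2 y.2)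
  -- The map from the reduction of φ_*𝒪 at x, written in the local basis, to the functions on the
  -- fibre. Its bijectivity gives the cardinality.
  let ev : (Fin d → k) →ₗ[k] (S → k) :=
    { toFun := fun l y => ∑ i, l i * (e i).1 (pt y)
      map_add' := fun l l' => by funext y; simp [add_mul, Finset.sum_add_distrib]
      map_smul' := fun c l => by funext y; simp [mul_assoc, Finset.mul_sum] }
  -- Lagrange interpolation gives a polynomial with prescribed values on the fibre; its coefficients
  -- in the local basis are evaluated at x.
  have hsurj : Function.Surjective ev := fun w => by
    have hP := fun y => Lagrange.eval_interpolate_at_node (s := Finset.univ) (i := y)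
      (v := fun y : S => y.1) w Subtype.val_injective.injOn
    set P := Lagrange.interpolate Finset.univ (fun y : S => y.1) w with hPdef
    obtain ⟨c, hc⟩ := hspan ⟨_, isAnalytic_polynomial P⟩
    refine ⟨fun i => (c i).1 x', funext fun y => ?_⟩
    have := hc (pt y)
    rw [hpt] at this
    exact this.symm.trans (hP y (Finset.mem_univ y))
  -- A combination h that vanishes on the fibre is divisible by the pullback of T − x, which has
  -- simple zeros. Expanding the quotient in the basis and comparing coefficients gives l_i = (T −
  -- x)c_i, hence l_i = 0 at x.
  have hinj : Function.Injective ev := by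
    rw [← LinearMap.ker_eq_bot, LinearMap.ker_eq_bot']
    intro l hl
    let h : analytic (φ.preimage U) := ∑ i, l i • e i
    let T : analytic U := ⟨_, isAnalytic_polynomial (X - C x.1)⟩
    have hT : ∀ a, T.1 a = a.1.1 - x.1 := fun a => by simp [T]
    have hh : ∀ b, h.1 b = ∑ i, l i * (e i).1 b := fun b => by
      simp [h]
    have hf0 : ∀ b, (φ.pullback U T).1 b = 0 → b.1.1 ∈ S := fun b hb => by
      rw [← hS]
      exact Subtype.ext (sub_eq_zero.1 ((hT _).symm.trans hb))
    have hnorm : ∀ b, ‖(φ.pullback U T).1 b‖ =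
        (φ.toMap (D₂.ratPt b.1)).1.seminorm (X - C x.1) := fun b => by
      rw [φ.seminorm_ratPt]
      exact congrArg _ (hT _)
    have hdisc : ∀ y ∈ φ.preimage U,
        (∀ a : RatIn (φ.preimage U), D₂.ratPt a.1 = y → (φ.pullback U T).1 a ≠ 0) →
        ∃ V : Opens D₂.Point, y ∈ V ∧ V ≤ φ.preimage U ∧ ∃ c : ℝ, 0 < c ∧
          ∀ a : RatIn (φ.preimage U), D₂.ratPt a.1 ∈ V → c ≤ ‖(φ.pullback U T).1 a‖ := by
      intro y hy hne
      have hcont : Continuous fun v : D₂.Point => (φ.toMap v).1.seminorm (X - C x.1) :=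
        (continuous_seminorm D₁ _).comp φ.toMap.continuous
      set N := (φ.toMap y).1.seminorm (X - C x.1) with hN
      have hN0 : 0 < N := by
        refine lt_of_le_of_ne (BerkovichLine.nonneg _ _) fun h0 => ?_
        rw [hN, hSκ, eq_comm, mul_eq_zero, or_iff_right hκ.ne', map_prod,
          Finset.prod_eq_zero_iff] at h0
        obtain ⟨z, hz, hz0⟩ := h0
        have hyz : D₂.ratPt ⟨z, hSD z hz⟩ = y :=
          Subtype.ext (BerkovichLine.eq_rational hz0).symm
        refine hne ⟨⟨z, hSD z hz⟩, by rw [hyz]; exact hy⟩ hyz ?_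
        rw [← norm_eq_zero, hnorm, φ.seminorm_ratPt, (hS ⟨z, hSD z hz⟩).2 hz, sub_self, norm_zero]
      refine ⟨φ.preimage U ⊓ ⟨_, isOpen_lt (continuous_const (y := N / 2)) hcont⟩,
        ⟨hy, show N / 2 < N by linarith⟩, inf_le_left, N / 2, by positivity, fun a ha => ?_⟩
      rw [hnorm]
      exact le_of_lt ha.2
    have hsimple : ∀ b, (φ.pullback U T).1 b = 0 →
        h.1 b = 0 ∧ deriv (zeroExt (φ.pullback U T).1) b.1.1 ≠ 0 := by
      intro b hb
      refine ⟨?_, ?_⟩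
      · have hbS := hf0 b hb
        rw [hh]
        exact congrFun hl ⟨b.1.1, hbS⟩
      · have h1 := ((differentiableAt_zeroExt φ.function.2 ⟨b.1, trivial⟩).hasDerivAt).sub_const x.1
        rw [(hasDerivAt_congr h1 (f := (φ.pullback U T).1) (a := b) fun a => ?_).deriv]
        · exact het.deriv_ne_zero b.1
        · rw [zeroExt_function]
          exact hT _
    obtain ⟨g, hg, hgh⟩ := IsAnalytic.div_of_simple_zeros h.2 (φ.pullback U T).2 hdisc hsimple
    obtain ⟨c, hc⟩ := hspan ⟨g, hg⟩
    have h1 := hind (fun i => T * c i - algebraMap k _ (l i)) fun b => by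
      have h2 := congrFun hgh b
      rw [hh] at h2
      have h3 : g b = _ := hc b
      have h4 : (φ.pullback U T * g) b = T.1 (φ.ratIn b) * g b := rfl
      have h5 := h2.trans h4
      rw [h3, Finset.mul_sum] at h5
      calc ∑ i, (T * c i - algebraMap k _ (l i)).1 (φ.ratIn b) * (e i).1 b
          = ∑ i, T.1 (φ.ratIn b) * ((c i).1 (φ.ratIn b) * (e i).1 b) -
            ∑ i, l i * (e i).1 b := by
            rw [← Finset.sum_sub_distrib]
            refine Finset.sum_congr rfl fun i _ => ?_
            change (T.1 (φ.ratIn b) * (c i).1 (φ.ratIn b) - l i) * (e i).1 b = _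
            ring
        _ = 0 := by rw [← h5, sub_self]
    funext i
    have h2 := congrArg (fun f : analytic U => f.1 x') (congrFun h1 i)
    change T.1 x' * (c i).1 x' - l i = 0 at h2
    rw [hT] at h2
    simpa [x'] using h2
  have := LinearEquiv.finrank_eq (LinearEquiv.ofBijective ev ⟨hinj, hsurj⟩)
  simpa using this.symm

end Fibre

/-! ### Components of preimages of discs, horizontal sections -/

/-- If a locally constant map has connected fibres, its fibres are the connected components. -/
theorem card_connectedComponents_eq {X T : Type*} [TopologicalSpace X] {q : X → T}
    (hq : IsLocallyConstant q) (hfib : ∀ x, IsPreconnected {y | q y = q x}) :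
    Nat.card (ConnectedComponents X) = Nat.card (Set.range q) := by
  let _ : TopologicalSpace T := ⊥
  have : DiscreteTopology T := ⟨rfl⟩
  have hlift := hq.continuous.connectedComponentsLift_apply_coe
  refine Nat.card_congr ((Equiv.ofInjective hq.continuous.connectedComponentsLift ?_).trans
    (Equiv.setCongr ?_))
  · intro a b hab
    obtain ⟨x, rfl⟩ := ConnectedComponents.surjective_coe a
    obtain ⟨y, rfl⟩ := ConnectedComponents.surjective_coe b
    rw [hlift, hlift] at hab
    exact ConnectedComponents.coe_eq_coe'.2 ((hfib y).subset_connectedComponent rfl hab)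
  · rw [← ConnectedComponents.surjective_coe.range_comp]
    exact congrArg Set.range (funext hlift)

section Sections

variable {k : Type u} [NontriviallyNormedField k] [IsUltrametricDist k] [IsAlgClosed k]
  [CompleteSpace k] {D₂ D₁ : StrictOpenDisc k} {φ : DiscMorphism D₂ D₁}

/-- The pushed forward connection is f ↦ (φ')⁻¹f', and φ' is invertible. -/
theorem mem_horizontal_iff (het : φ.IsEtale) {d : ℕ} (hd : φ.HasDegree d) {U : Opens D₁.Point}
    (f : analytic (φ.preimage U)) :
    (show (pushforwardConstant φ het d hd).sheaf.sec U from f) ∈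
      (pushforwardConstant φ het d hd).horizontal U ↔ derivation (φ.preimage U) f = 0 := by
  have h1 : (show (pushforwardConstant φ het d hd).sheaf.sec U from f) ∈
      (pushforwardConstant φ het d hd).horizontal U ↔
      het.derivInv (φ.preimage U) * derivation (φ.preimage U) f = 0 := LinearMap.mem_ker
  rw [h1]
  refine ⟨fun h => ?_, fun h => by rw [h, mul_zero]⟩
  calc derivation (φ.preimage U) f = (het.derivInv (φ.preimage U) * restrict le_top φ.derivative) *
        derivation (φ.preimage U) f := by rw [het.derivInv_mul, one_mul]
    _ = restrict le_top φ.derivative *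
        (het.derivInv (φ.preimage U) * derivation (φ.preimage U) f) := by ring
    _ = 0 := by rw [h, mul_zero]

/-- Locally constant functions are analytic, with zero derivative. -/
theorem exists_analytic_of_locallyConstant {W : Opens D₂.Point} {f : RatIn W → k}
    (hf : ∀ v ∈ W, ∃ V : Opens D₂.Point, v ∈ V ∧ V ≤ W ∧ ∃ c, ∀ a : RatIn W, D₂.ratPt a.1 ∈ V →
      f a = c) : ∃ h : IsAnalytic f, derivation W ⟨f, h⟩ = 0 := by
  have han : IsAnalytic f := by
    refine isAnalytic_of_local fun v hv => ?_
    obtain ⟨V, hvV, hVW, c, hc⟩ := hf v hv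
    refine ⟨V, hVW, hvV, ?_⟩
    convert isAnalytic_polynomial (U := V) (C c) using 2 with a
    rw [eval_C]
    exact hc _ a.2
  refine ⟨han, ?_⟩
  ext a
  obtain ⟨V, haV, hVW, c, hc⟩ := hf _ a.2
  have h1 : derivation V (restrict hVW ⟨f, han⟩) = 0 := by
    ext b
    exact (hasDerivAt_congr (a := b) (hasDerivAt_const b.1.1 c) fun b => hc _ b.2).deriv
  rw [derivation_restrict] at h1
  exact congrFun (congrArg Subtype.val h1) ⟨a.1, haV⟩

/-- If functions with zero derivative are the functions that factor through a locally constant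
map, the dimension of the space of horizontal sections is the number of values of this map. -/
theorem rank_horizontal_eq (het : φ.IsEtale) {d : ℕ} (hd : φ.HasDegree d) {U : Opens D₁.Point}
    {T : Type u} [Finite T] {q : φ.preimage U → T} (hq : IsLocallyConstant q)
    (hconst : ∀ f : analytic (φ.preimage U), derivation (φ.preimage U) f = 0 → ∀ a b : RatIn (φ.preimage U),
      q ⟨_, a.2⟩ = q ⟨_, b.2⟩ → f.1 a = f.1 b) :
    Module.rank k ((pushforwardConstant φ het d hd).horizontal U) = Nat.card (Set.range q) := by
  classical
  have := Fintype.ofFinite (Set.range q)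
  let W := φ.preimage U
  let g : (Set.range q → k) → RatIn W → k := fun w a => w ⟨q ⟨_, a.2⟩, _, rfl⟩
  have hloc : ∀ v (hv : v ∈ W), ∃ V : Opens D₂.Point, v ∈ V ∧ V ≤ W ∧
      ∀ v' (hv' : v' ∈ V) (h : v' ∈ W), q ⟨v', h⟩ = q ⟨v, hv⟩ := by
    intro v hv
    obtain ⟨V, hV, hvV, hVq⟩ := (IsLocallyConstant.iff_exists_open q).1 hq ⟨v, hv⟩
    refine ⟨⟨Subtype.val '' V, W.isOpen.isOpenEmbedding_subtypeVal.isOpenMap V hV⟩,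
      ⟨_, hvV, rfl⟩, ?_, ?_⟩
    · rintro _ ⟨z, -, rfl⟩
      exact z.2
    · rintro _ ⟨z, hz, rfl⟩ h
      exact hVq z hz
  have hg : ∀ w, ∃ h : IsAnalytic (g w), derivation W ⟨g w, h⟩ = 0 := fun w =>
    exists_analytic_of_locallyConstant fun v hv => by
      obtain ⟨V, hvV, hVW, hV⟩ := hloc v hv
      refine ⟨V, hvV, hVW, w ⟨q ⟨v, hv⟩, _, rfl⟩, fun a ha => ?_⟩
      exact congrArg w (Subtype.ext (hV _ ha a.2))
  -- Functions are given by their values at rational points, so each value of q has to be attained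
  -- at one. Density and local constancy ensure this.
  have hrat : ∀ t : Set.range q, ∃ a : RatIn W, q ⟨_, a.2⟩ = t.1 := by
    rintro ⟨_, v, rfl⟩
    obtain ⟨V, hvV, hVW, hV⟩ := hloc v.1 v.2
    obtain ⟨a, ha⟩ := D₂.exists_ratPt_mem V.isOpen ⟨_, hvV⟩
    exact ⟨⟨a, hVW ha⟩, hV _ ha _⟩
  choose r hr using hrat
  let L : (Set.range q → k) →ₗ[k] (pushforwardConstant φ het d hd).horizontal U :=
    { toFun := fun w => ⟨(⟨g w, (hg w).1⟩ : analytic W), (mem_horizontal_iff het hd _).2 (hg w).2⟩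
      map_add' := fun _ _ => rfl
      map_smul' := fun _ _ => rfl }
  have hL : Function.Bijective L := by
    constructor
    · intro w w' h
      have h1 : g w = g w' := congrArg (fun z => (show analytic W from z.1).1) h
      funext t
      have h2 := congrFun h1 (r t)
      have h3 : (⟨q ⟨_, (r t).2⟩, _, rfl⟩ : Set.range q) = t := Subtype.ext (hr t)
      change w ⟨q ⟨_, (r t).2⟩, _, rfl⟩ = w' ⟨q ⟨_, (r t).2⟩, _, rfl⟩ at h2
      rwa [h3] at h2
    · rintro ⟨f, hf⟩
      change analytic W at f
      have hf' := (mem_horizontal_iff het hd f).1 hf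
      refine ⟨fun t => f.1 (r t), Subtype.ext (show (_ : analytic W) = f from
        Subtype.ext (funext fun a => ?_))⟩
      exact hconst f hf' _ _ (hr ⟨q ⟨_, a.2⟩, _, rfl⟩)
  rw [← (LinearEquiv.ofBijective L hL).rank_eq, rank_fun', Nat.card_eq_fintype_card]

end Sections

/-! ### The discs around the zeros of a polynomial -/

section Zeros

variable {k : Type u} [NontriviallyNormedField k] [IsUltrametricDist k]

variable [IsAlgClosed k]

/-- The value of `|Q|` at the smallest disc that contains `y` and `z`. -/
noncomputable def joinValue (Q : k[X]) (y z : k) : ℝ := (gaussPoint y ‖y - z‖).seminorm Q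

theorem joinValue_comm (Q : k[X]) (y z : k) : joinValue Q y z = joinValue Q z y := by
  rw [joinValue, joinValue, gaussPoint_eq (le_refl ‖y - z‖), norm_sub_rev]

theorem joinValue_self {Q : k[X]} {y : k} (h : Q.eval y = 0) : joinValue Q y y = 0 := by
  rw [joinValue, sub_self, norm_zero, gaussPoint_zero, BerkovichLine.rational_apply, h, norm_zero]

theorem joinValue_pos {Q : k[X]} (hQ : Q ≠ 0) {y z : k} (h : y ≠ z) : 0 < joinValue Q y z :=
  gaussPoint_pos _ (norm_pos_iff.2 (sub_ne_zero.2 h)) hQ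

theorem gaussPoint_le_joinValue {Q : k[X]} {y z : k} {t : ℝ} (ht : 0 ≤ t) (h : t ≤ ‖y - z‖) :
    (gaussPoint y t).seminorm Q ≤ joinValue Q y z := gaussPoint_mono _ ht h _

/-- The smallest disc containing x and z lies in the larger of the two discs for (x, y) and (y, z),
and Gauss norms grow with the disc. This makes the join value an ultrametric on the zeros of Q. -/
theorem joinValue_le_max (Q : k[X]) (x y z : k) :
    joinValue Q x z ≤ max (joinValue Q x y) (joinValue Q y z) := by
  have h : ‖x - z‖ ≤ max ‖x - y‖ ‖y - z‖ := by
    simpa using IsUltrametricDist.norm_add_le_max (x - y) (y - z)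
  rcases le_max_iff.1 h with h | h
  · exact le_max_of_le_left (gaussPoint_mono _ (norm_nonneg _) h _)
  · refine le_max_of_le_right ?_
    rw [joinValue_comm Q x z, joinValue_comm Q y z]
    rw [norm_sub_rev x z, norm_sub_rev y z] at h
    exact gaussPoint_mono _ (norm_nonneg _) h _

/-- With the next lemma, this says that v behaves as a further point of the ultrametric space: its
position relative to y is measured by Q at the smallest closed disc around y that contains v. -/
theorem joinValue_le_max_gaussPoint (Q : k[X]) (v : BerkovichLine k) (y z : k) :
    joinValue Q y z ≤ max ((gaussPoint y (v.seminorm (X - C y))).seminorm Q)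
      ((gaussPoint z (v.seminorm (X - C z))).seminorm Q) := by
  rcases le_max_iff.1 (v.norm_sub_le_max y z) with h | h
  · exact le_max_of_le_left (gaussPoint_mono _ (norm_nonneg _) h _)
  · refine le_max_of_le_right ?_
    rw [joinValue_comm Q y z]
    rw [norm_sub_rev y z] at h
    exact gaussPoint_mono _ (norm_nonneg _) h _

theorem gaussPoint_le_max_joinValue (Q : k[X]) (v : BerkovichLine k) (y z : k) :
    (gaussPoint y (v.seminorm (X - C y))).seminorm Q ≤
      max (joinValue Q y z) ((gaussPoint z (v.seminorm (X - C z))).seminorm Q) := by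
  rcases le_or_gt (v.seminorm (X - C y)) ‖y - z‖ with h | h
  · exact le_max_of_le_left (gaussPoint_le_joinValue (v.nonneg _) h)
  · refine le_max_of_le_right ?_
    rw [gaussPoint_eq h.le]
    refine gaussPoint_mono _ (v.nonneg _) ?_ _
    rw [norm_sub_rev] at h
    refine (v.X_sub_C_le_max z y).trans (max_le le_rfl ?_)
    by_contra! hlt
    have := v.X_sub_C_le_max z y
    have h3 := v.X_sub_C_eq_norm (h := hlt)
    linarith

theorem seminorm_le_gaussPoint (Q : k[X]) (v : BerkovichLine k) (y : k) :
    v.seminorm Q ≤ (gaussPoint y (v.seminorm (X - C y))).seminorm Q := le_gaussPoint le_rfl Q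

/-- Take the zero y nearest to v. For every other zero z, the value |T − z| at v is the maximum of
|T − y| at v and |y − z|, as at the Gauss point. -/
theorem exists_seminorm_prod_eq {S : Finset k} (hS : S.Nonempty) (v : BerkovichLine k) :
    ∃ y ∈ S, v.seminorm (∏ z ∈ S, (X - C z)) =
      (gaussPoint y (v.seminorm (X - C y))).seminorm (∏ z ∈ S, (X - C z)) := by
  obtain ⟨y, hy, hmin⟩ := S.exists_min_image (fun z => v.seminorm (X - C z)) hS
  refine ⟨y, hy, ?_⟩
  rw [map_prod, map_prod]
  refine Finset.prod_congr rfl fun z hz => ?_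
  rw [gaussPoint_X_sub_C _ _ (v.nonneg _), v.X_sub_C_eq_max (hmin z hz)]

theorem continuous_gaussPoint_seminorm (Q : k[X]) (y : k) :
    Continuous fun v : BerkovichLine k => (gaussPoint y (v.seminorm (X - C y))).seminorm Q := by
  have h1 := (BerkovichLine.continuous_seminorm Q).comp ((continuous_gaussPoint y).comp
    (BerkovichLine.continuous_seminorm (X - C y)))
  refine h1.congr fun v => ?_
  simp only [Function.comp_apply, abs_of_nonneg (v.nonneg (X - C y))]

end Zeros

theorem isPreconnected_of_image_eq {X Y : Type*} [TopologicalSpace X] [TopologicalSpace Y]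
    {f : X → Y} (hf : Topology.IsInducing f) {A : Set X} {B : Set Y} (h : f '' A = B)
    (hB : IsPreconnected B) : IsPreconnected A :=
  hf.isPreconnected_image.1 (h ▸ hB)

/-! ### Components and horizontal sections counted by balls of an ultrametric on the fibre. -/

section Count

variable {k : Type u} [NontriviallyNormedField k] [IsUltrametricDist k] [IsAlgClosed k]
  [CompleteSpace k] [CharZero k] {D₂ D₁ : StrictOpenDisc k} {φ : DiscMorphism D₂ D₁}

/-- The number of balls of radius `s` for a pairwise distance `σ`. -/
noncomputable def ballCount {T : Type*} (σ : T → T → ℝ) (s : ℝ) : ℕ :=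
  Nat.card (Set.range fun y => {z | σ y z < s})

/-- The points `v` of `D` such that `λ |Q|` is less than `s` at the boundary of the smallest disc
around `y` that contains `v`. -/
noncomputable def levelDisc (D : StrictOpenDisc k) (Q : k[X]) (l s : ℝ) (y : k) : Opens D.Point :=
  ⟨{v | l * (gaussPoint y (v.1.seminorm (X - C y))).seminorm Q < s},
    isOpen_lt (continuous_const.mul
      ((continuous_gaussPoint_seminorm Q y).comp continuous_subtype_val)) continuous_const⟩

theorem mem_levelDisc {D : StrictOpenDisc k} {Q : k[X]} {l s : ℝ} {y : k} {v : D.Point} :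
    v ∈ levelDisc D Q l s y ↔ l * (gaussPoint y (v.1.seminorm (X - C y))).seminorm Q < s := Iff.rfl

/-- Gauss norms increase with the radius, so the defining condition is downward closed in |T − y|.
The condition of lying in D is so as well, once D is recentred at y. -/
theorem isPreconnected_levelDisc {D : StrictOpenDisc k} {Q : k[X]} {l s : ℝ} (hl : 0 < l) {y : k}
    (hy : ‖y - D.center‖ < D.radius) : IsPreconnected (levelDisc D Q l s y : Set D.Point) := by
  have himg : Subtype.val '' (levelDisc D Q l s y : Set D.Point) =
      {v : BerkovichLine k | (fun t => l * (gaussPoint y t).seminorm Q < s ∧ t < D.radius)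
        (v.seminorm (X - C y))} := by
    ext v
    constructor
    · rintro ⟨w, hw, rfl⟩
      exact ⟨hw, (w.1.X_sub_C_lt_iff hy).2 w.2⟩
    · rintro ⟨hv, hvD⟩
      exact ⟨⟨v, (v.X_sub_C_lt_iff hy).1 hvD⟩, hv, rfl⟩
  refine isPreconnected_of_image_eq Topology.IsInducing.subtypeVal himg ?_
  refine isPreconnected_disc y (p := fun t => l * (gaussPoint y t).seminorm Q < s ∧ t < D.radius)
    (fun a b ha hab hb => ⟨lt_of_le_of_lt ?_ hb.1, hab.trans_lt hb.2⟩) ?_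
  · exact mul_le_mul_of_nonneg_left (gaussPoint_mono y ha hab Q) hl.le
  · exact (isOpen_lt (continuous_const.mul (continuous_gaussPoint_seminorm Q y))
      continuous_const).inter
      (isOpen_lt (BerkovichLine.continuous_seminorm (X - C y)) continuous_const)

/-- A function with zero derivative on an open set that contains the level disc is constant
there. -/
theorem eq_of_mem_levelDisc {W : Opens D₂.Point} {f : analytic W} (hf : derivation W f = 0)
    {Q : k[X]} {l s : ℝ} (hl : 0 < l) {y : k} (hy : ‖y - D₂.center‖ < D₂.radius)
    (hW : levelDisc D₂ Q l s y ≤ W) {a : RatIn W} (ha : D₂.ratPt a.1 ∈ levelDisc D₂ Q l s y) :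
    f.1 a = zeroExt f.1 y := by
  have hsub : ∀ v : BerkovichLine k, v.seminorm (X - C y) ≤ ‖a.1.1 - y‖ →
      ∃ h : v.seminorm (X - C D₂.center) < D₂.radius, (⟨v, h⟩ : D₂.Point) ∈ W := by
    intro v hv
    have h1 : ‖a.1.1 - y‖ < D₂.radius := by
      rw [← BerkovichLine.rational_X_sub_C, BerkovichLine.X_sub_C_lt_iff _ hy]
      exact (D₂.ratPt a.1).2
    refine ⟨(v.X_sub_C_lt_iff hy).1 (hv.trans_lt h1), hW (mem_levelDisc.2 (lt_of_le_of_lt ?_ (mem_levelDisc.1 ha)))⟩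
    refine mul_le_mul_of_nonneg_left (gaussPoint_mono y (v.nonneg _) ?_ Q) hl.le
    rw [StrictOpenDisc.ratPt, BerkovichLine.rational_X_sub_C]
    exact hv
  have hder : ∀ b, ‖b - y‖ ≤ ‖a.1.1 - y‖ → deriv (zeroExt f.1) b = 0 := by
    intro b hb
    obtain ⟨h1, h2⟩ := hsub (BerkovichLine.rational b) (by rwa [BerkovichLine.rational_X_sub_C])
    rw [BerkovichLine.rational_X_sub_C] at h1
    exact congrFun (congrArg Subtype.val hf) ⟨⟨b, h1⟩, h2⟩
  rw [← zeroExt_apply f.1]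
  rcases (norm_nonneg (a.1.1 - y)).eq_or_lt with h | h
  · rw [sub_eq_zero.1 (norm_eq_zero.1 h.symm)]
  · exact (f.2.polyApprox h.le hsub).eq_of_deriv_eq_zero h hder le_rfl

/-- The combinatorial description of `N_x` and of the dimension of the spaces of horizontal
sections, in terms of an ultrametric on the fibre of `φ` at `x`. -/
theorem exists_ultrametric (hfin : φ.IsFinite) (het : φ.IsEtale) {d : ℕ} (hd : φ.HasDegree d)
    (x : D₁.RatPoint) :
    ∃ (T : Type u) (_ : Finite T) (σ : T → T → ℝ), Nat.card T = d ∧ (∀ y, σ y y = 0) ∧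
      (∀ y z, σ y z = σ z y) ∧ (∀ y z w, σ y w ≤ max (σ y z) (σ z w)) ∧
      (∀ y z, y ≠ z → 0 < σ y z) ∧ (∀ y z, σ y z < 1) ∧
      ∀ s, 0 < s → φ.numComponents x s = ballCount σ s ∧
        Module.rank k ((pushforwardConstant φ het d hd).horizontal (D₁.subdisc x s)) =
          ballCount σ s := by
  obtain ⟨S, hS, hSD, κ, hκ, hSκ⟩ := hfin.exists_fibre het x
  have hcard := hd.card_eq het hS hSD hκ hSκ
  have hne : S.Nonempty := Finset.card_pos.1 (hcard ▸ hd.pos)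
  set Q : k[X] := ∏ y ∈ S, (X - C y) with hQ
  have hQ0 : Q ≠ 0 := Finset.prod_ne_zero_iff.2 fun y _ => X_sub_C_ne_zero y
  have hQS : ∀ y ∈ S, Q.eval y = 0 := fun y hy => by
    rw [hQ, eval_prod]
    exact Finset.prod_eq_zero hy (by simp)
  have hR := D₁.radius_pos
  set l := κ / D₁.radius with hl
  have hl0 : 0 < l := div_pos hκ hR
  -- Scaled by κ divided by the radius of `D₁`, so that σ is comparable with the normalized radius
  -- s.
  let σ : S → S → ℝ := fun y z => l * joinValue Q y.1 z.1
  have hσ0 : ∀ y, σ y y = 0 := fun y => by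
    simp only [σ, joinValue_self (hQS _ y.2), mul_zero]
  have hσs : ∀ y z, σ y z = σ z y := fun y z => by simp only [σ, joinValue_comm Q y.1]
  have hσu : ∀ y z w, σ y w ≤ max (σ y z) (σ z w) := fun y z w => by
    rw [← mul_max_of_nonneg _ _ hl0.le]
    exact mul_le_mul_of_nonneg_left (joinValue_le_max Q _ _ _) hl0.le
  -- The join of two points of the fibre is a point of `D₂`. Its image lies in `D₁`, so it is at
  -- normalized distance less than 1 from x.
  have hσ1 : ∀ y z, σ y z < 1 := fun y z => by
    have hv : (gaussPoint y.1 ‖y.1 - z.1‖).seminorm (X - C D₂.center) < D₂.radius := by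
      rw [← BerkovichLine.X_sub_C_lt_iff _ (hSD _ y.2), gaussPoint_X_sub_C _ _ (norm_nonneg _),
        sub_self, norm_zero, max_eq_left (norm_nonneg _), ← sub_sub_sub_cancel_right _ _ D₂.center]
      rw [sub_eq_add_neg]
      refine (IsUltrametricDist.norm_add_le_max _ _).trans_lt (max_lt (hSD _ y.2) ?_)
      rw [norm_neg]
      exact hSD _ z.2
    have h1 := hSκ ⟨_, hv⟩
    have h2 := (BerkovichLine.X_sub_C_lt_iff _ x.2).2 (φ.toMap ⟨_, hv⟩).2
    rw [h1] at h2
    change κ / D₁.radius * _ < 1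
    rwa [div_mul_eq_mul_div, div_lt_one hR]
  refine ⟨S, inferInstance, σ, by simpa using hcard, hσ0, hσs, hσu,
    fun y z h => mul_pos hl0 (joinValue_pos hQ0 fun h' => h (Subtype.ext h')), hσ1, fun s hs => ?_⟩
  set W := φ.preimage (D₁.subdisc x s) with hW
  let B : S → Opens D₂.Point := fun y => levelDisc D₂ Q l s y.1
  have hmemW : ∀ v : D₂.Point, v ∈ W ↔ l * v.1.seminorm Q < s := fun v => by
    change (φ.toMap v).1.seminorm (X - C x.1) < s * D₁.radius ↔ _
    rw [hSκ, hl, div_mul_eq_mul_div, div_lt_iff₀ hR]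
  have hBW : ∀ y, B y ≤ W := fun y v hv => (hmemW v).2
    ((mul_le_mul_of_nonneg_left (seminorm_le_gaussPoint Q v.1 y.1) hl0.le).trans_lt hv)
  have hWB : ∀ v ∈ W, ∃ y, v ∈ B y := fun v hv => by
    obtain ⟨y, hy, hyv⟩ := exists_seminorm_prod_eq hne v.1
    refine ⟨⟨y, hy⟩, ?_⟩
    change l * _ < s
    rw [← hyv]
    exact (hmemW v).1 hv
  have hBB : ∀ v y z, v ∈ B y → v ∈ B z → σ y z < s := fun v y z hy hz => by
    refine (mul_le_mul_of_nonneg_left (joinValue_le_max_gaussPoint Q v.1 y.1 z.1) hl0.le).trans_lt ?_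
    rw [mul_max_of_nonneg _ _ hl0.le]
    exact max_lt hy hz
  have hBσ : ∀ v y z, v ∈ B z → σ y z < s → v ∈ B y := fun v y z hz h => by
    refine (mul_le_mul_of_nonneg_left (gaussPoint_le_max_joinValue Q v.1 y.1 z.1) hl0.le).trans_lt ?_
    rw [mul_max_of_nonneg _ _ hl0.le]
    exact max_lt h hz
  have hyB : ∀ y, D₂.ratPt ⟨y.1, hSD _ y.2⟩ ∈ B y := fun y => by
    change l * _ < s
    rw [StrictOpenDisc.ratPt, BerkovichLine.rational_X_sub_C, sub_self, norm_zero, gaussPoint_zero,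
      BerkovichLine.rational_apply, hQS _ y.2, norm_zero, mul_zero]
    exact hs
  -- The zeros whose level discs contain v form a σ-ball of radius s. Hence q is locally constant,
  -- its fibres are the connected level discs, and its values are exactly the balls.
  let q : W → Set S := fun v => {z | v.1 ∈ B z}
  have hq : ∀ (v : W) y, v.1 ∈ B y → q v = {z | σ y z < s} := fun v y hy => by
    ext z
    exact ⟨fun hz => hBB v.1 y z hy hz, fun hz => hBσ v.1 z y hy ((hσs z y).trans_lt hz)⟩
  have hqq : ∀ (v w : W) y, v.1 ∈ B y → (q w = q v ↔ w.1 ∈ B y) := fun v w y hy =>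
    ⟨fun h => (show y ∈ q w from h ▸ hy), fun h => by rw [hq v y hy, hq w y h]⟩
  have hloc : IsLocallyConstant q := by
    refine (IsLocallyConstant.iff_exists_open q).2 fun v => ?_
    obtain ⟨y, hy⟩ := hWB v.1 v.2
    exact ⟨_, (B y).isOpen.preimage continuous_subtype_val, hy, fun w hw => (hqq v w y hy).2 hw⟩
  have hrange : Set.range q = Set.range fun y => {z | σ y z < s} := by
    ext t
    constructor
    · rintro ⟨v, rfl⟩
      obtain ⟨y, hy⟩ := hWB v.1 v.2
      exact ⟨y, (hq v y hy).symm⟩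
    · rintro ⟨y, rfl⟩
      exact ⟨⟨_, hBW y (hyB y)⟩, hq _ y (hyB y)⟩
  rw [ballCount, ← hrange]
  refine ⟨card_connectedComponents_eq hloc fun v => ?_, rank_horizontal_eq het hd hloc ?_⟩
  · obtain ⟨y, hy⟩ := hWB v.1 v.2
    have h1 : Subtype.val '' {w : W | q w = q v} = (B y : Set D₂.Point) := by
      ext w
      constructor
      · rintro ⟨w, hw, rfl⟩
        exact (hqq v w y hy).1 hw
      · exact fun hw => ⟨⟨w, hBW y hw⟩, (hqq v ⟨w, hBW y hw⟩ y hy).2 hw, rfl⟩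
    exact isPreconnected_of_image_eq Topology.IsInducing.subtypeVal h1
      (isPreconnected_levelDisc hl0 (hSD _ y.2))
  · intro f hf a b hab
    obtain ⟨y, hy⟩ := hWB _ a.2
    have hb : D₂.ratPt b.1 ∈ B y := (hqq ⟨_, a.2⟩ ⟨_, b.2⟩ y hy).1 hab.symm
    rw [eq_of_mem_levelDisc hf hl0 (hSD _ y.2) (hBW y) hy,
      eq_of_mem_levelDisc hf hl0 (hSD _ y.2) (hBW y) hb]

end Count

/-! ### Counting balls of a finite ultrametric space -/

section Balls

variable {T : Type*} [Finite T] {σ : T → T → ℝ}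

theorem ballCount_congr {s t : ℝ} (h : ∀ y z, σ y z < s ↔ σ y z < t) :
    ballCount σ s = ballCount σ t := by
  simp only [ballCount, h]

/-- Balls of radius s with equal underlying sets have equal enlargements of radius t, so enlarging
maps the s-balls onto the t-balls. -/
theorem ballCount_anti (h0 : ∀ y, σ y y = 0) (hs : ∀ y z, σ y z = σ z y)
    (hu : ∀ y z w, σ y w ≤ max (σ y z) (σ z w)) {s t : ℝ} (hpos : 0 < s) (hst : s ≤ t) :
    ballCount σ t ≤ ballCount σ s := by
  have hball : ∀ y z, {w | σ y w < s} = {w | σ z w < s} → {w | σ y w < t} = {w | σ z w < t} := by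
    intro y z h
    have h1 : σ y z < s := by
      change z ∈ {w | σ y w < s}
      rw [h]
      exact (h0 z).trans_lt hpos
    ext w
    exact ⟨fun hw => (hu z y w).trans_lt (max_lt ((hs z y).trans_lt (h1.trans_le hst)) hw),
      fun hw => (hu y z w).trans_lt (max_lt (h1.trans_le hst) hw)⟩
  refine Nat.card_le_card_of_surjective
    (fun b : Set.range fun y => {w | σ y w < s} => ⟨{w | σ b.2.choose w < t}, _, rfl⟩) ?_
  rintro ⟨_, y, rfl⟩
  refine ⟨⟨_, y, rfl⟩, Subtype.ext (hball _ _ ?_)⟩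
  exact (⟨_, y, rfl⟩ : Set.range fun y => {w | σ y w < s}).2.choose_spec

theorem eventually_ballCount_eq {s : ℝ} {l : Filter ℝ}
    (h : ∀ y z, ∀ᶠ t in l, σ y z < t ↔ σ y z < s) : ∀ᶠ t in l, ballCount σ t = ballCount σ s := by
  have h1 : ∀ᶠ t in l, ∀ y z, σ y z < t ↔ σ y z < s :=
    Filter.eventually_all.2 fun y => Filter.eventually_all.2 fun z => h y z
  exact h1.mono fun t ht => ballCount_congr ht

/-- Balls are defined by a strict inequality, and for t slightly below s the conditions σ < t and σ
< s agree on the finitely many values of σ. -/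
theorem eventually_ballCount_left (s : ℝ) : ∀ᶠ t in 𝓝[≤] s, ballCount σ t = ballCount σ s := by
  refine eventually_ballCount_eq fun y z => ?_
  rcases lt_or_ge (σ y z) s with h | h
  · filter_upwards [nhdsWithin_le_nhds (lt_mem_nhds h)] with t ht
    exact iff_of_true ht h
  · filter_upwards [self_mem_nhdsWithin] with t ht
    exact iff_of_false (not_lt.2 (ht.trans h)) (not_lt.2 h)

theorem eventually_ballCount_eq_of_ne {s : ℝ} (h : ∀ y z, σ y z ≠ s) :
    ∀ᶠ t in 𝓝 s, ballCount σ t = ballCount σ s := by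
  refine eventually_ballCount_eq fun y z => ?_
  rcases (h y z).lt_or_gt with h | h
  · filter_upwards [lt_mem_nhds h] with t ht
    exact iff_of_true ht h
  · filter_upwards [gt_mem_nhds h] with t ht
    exact iff_of_false (not_lt.2 ht.le) (not_lt.2 h.le)

theorem eventually_ballCount_eq_card (h0 : ∀ y, σ y y = 0) (hpos : ∀ y z, y ≠ z → 0 < σ y z) :
    ∀ᶠ t in 𝓝[>] 0, ballCount σ t = Nat.card T := by
  have h1 : ∀ᶠ t in 𝓝[>] (0 : ℝ), ∀ y z, y ≠ z → t < σ y z :=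
    Filter.eventually_all.2 fun y => Filter.eventually_all.2 fun z =>
      Filter.eventually_imp_distrib_left.2 fun h =>
        nhdsWithin_le_nhds (gt_mem_nhds (hpos y z h))
  filter_upwards [h1, self_mem_nhdsWithin] with t ht ht0
  refine (Nat.card_congr (Equiv.ofInjective _ fun y z hyz => ?_)).symm
  by_contra hne
  have h2 : y ∈ {w | σ z w < t} := by
    rw [← show {w | σ y w < t} = {w | σ z w < t} from hyz]
    exact (h0 y).trans_lt ht0
  exact lt_asymm (ht z y (Ne.symm hne)) h2

theorem ballCount_eq_one [Nonempty T] {s : ℝ} (h : ∀ y z, σ y z < s) : ballCount σ s = 1 := by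
  simp [ballCount, h]

end Balls

/-! ### Break-points and radii -/

section Radii

variable {N : ℝ → ℕ} {d : ℕ}

theorem sequence_eq_zero_and_one {n : ℕ} {s : ℕ → ℝ} (hs : StrictMonoOn s (Set.Iic n))
    (himg : s '' Set.Iic n = breakPoints N) : s 0 = 0 ∧ s n = 1 ∧ 0 < n := by
  have hmem : ∀ i ≤ n, 0 ≤ s i ∧ s i ≤ 1 := fun i hi => by
    have h1 : s i ∈ breakPoints N := himg ▸ ⟨i, hi, rfl⟩
    rcases h1 with (h | h) | h
    · simp [h]
    · simp [show s i = 1 from h]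
    · exact ⟨h.1.1.le, h.1.2.le⟩
  have h0 : (0 : ℝ) ∈ s '' Set.Iic n := himg ▸ Or.inl (Or.inl rfl)
  have h1 : (1 : ℝ) ∈ s '' Set.Iic n := himg ▸ Or.inl (Or.inr rfl)
  obtain ⟨i, hi, hi0⟩ := h0
  obtain ⟨j, hj, hj1⟩ := h1
  have e0 : s 0 = 0 := le_antisymm
    (hi0 ▸ hs.monotoneOn (Nat.zero_le n) hi (Nat.zero_le i)) (hmem 0 (Nat.zero_le n)).1
  have e1 : s n = 1 := le_antisymm (hmem n le_rfl).2
    (hj1 ▸ hs.monotoneOn hj (Set.mem_Iic.2 le_rfl) hj)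
  refine ⟨e0, e1, Nat.pos_of_ne_zero ?_⟩
  rintro rfl
  exact zero_ne_one (e0.symm.trans e1)

/-- A left continuous function is constant between two consecutive break-points. -/
theorem eq_of_mem_Ioc_breakPoints (hleft : ∀ t, 0 < t → ∀ᶠ t' in 𝓝[≤] t, N t' = N t)
    {n : ℕ} {s : ℕ → ℝ} (hs : StrictMonoOn s (Set.Iic n))
    (himg : s '' Set.Iic n = breakPoints N) {i : ℕ} (hi : i < n) {t : ℝ}
    (ht : t ∈ Set.Ioc (s i) (s (i + 1))) : N t = N (s (i + 1)) := by
  obtain ⟨e0, e1, -⟩ := sequence_eq_zero_and_one hs himg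
  have hi' : i + 1 ≤ n := hi
  have h0 : 0 ≤ s i := e0 ▸ hs.monotoneOn (Nat.zero_le n) hi.le (Nat.zero_le i)
  have h1 : s (i + 1) ≤ 1 := e1 ▸ hs.monotoneOn hi' (Set.mem_Iic.2 le_rfl) hi'
  have hlt : s i < s (i + 1) := hs hi.le hi' i.lt_succ_self
  have hcont : ∀ t ∈ Set.Ioo (s i) (s (i + 1)), ContinuousAt N t := by
    intro t ht
    by_contra hc
    have h2 : t ∈ s '' Set.Iic n := himg ▸ Or.inr ⟨⟨h0.trans_lt ht.1, ht.2.trans_le h1⟩, hc⟩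
    obtain ⟨m, hm, rfl⟩ := h2
    have h3 := (hs.lt_iff_lt hi.le hm).1 ht.1
    have h4 := (hs.lt_iff_lt hm hi').1 ht.2
    omega
  have hconst : ∀ t ∈ Set.Ioo (s i) (s (i + 1)), ∀ t' ∈ Set.Ioo (s i) (s (i + 1)), N t = N t' :=
    fun t ht t' ht' => isPreconnected_Ioo.constant
      (fun t ht => (hcont t ht).continuousWithinAt) ht ht'
  rcases ht.2.eq_or_lt with h | h
  · rw [h]
  · have h2 : ∀ᶠ t' in 𝓝[<] s (i + 1), N t' = N (s (i + 1)) ∧ t' ∈ Set.Ioo (s i) (s (i + 1)) :=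
      ((hleft _ (h0.trans_lt hlt)).filter_mono (nhdsWithin_mono _ Set.Iio_subset_Iic_self)).and
        (Ioo_mem_nhdsLT hlt)
    obtain ⟨t', ht', ht''⟩ := h2.exists
    rw [← ht', hconst t ⟨ht.1, h⟩ t' ht'']

/-- The relation between the break-points of a function `N` and the suprema of the sets
`{N ≥ m}`. -/
theorem radii_of_breakPoints (hd : 0 < d) (hanti : ∀ t t', 0 < t → t ≤ t' → N t' ≤ N t)
    (hleft : ∀ t, 0 < t → ∀ᶠ t' in 𝓝[≤] t, N t' = N t) (hzero : ∀ᶠ t in 𝓝[>] 0, N t = d)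
    (hone : N 1 = 1) {R : ℕ → ℝ}
    (hR : ∀ j, R j = sSup {t : ℝ | t ∈ Set.Ioo 0 1 ∧ d - j + 1 ≤ N t})
    (n : ℕ) (s : ℕ → ℝ) (hs : StrictMonoOn s (Set.Iic n))
    (himg : s '' Set.Iic n = breakPoints N) :
    N (s 1) = d ∧ N (s n) = 1 ∧
      (∀ i j : ℕ, 1 ≤ i → i < n → d < j + N (s i) → j + N (s (i + 1)) ≤ d → R j = s i) ∧
      R d = 1 ∧
      (∀ i : ℕ, 1 ≤ i → i < n →
        {j : ℕ | j ∈ Set.Icc 1 d ∧ R j = s i}.ncard + N (s (i + 1)) = N (s i)) ∧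
      {j : ℕ | j ∈ Set.Icc 1 d ∧ R j = 1}.ncard = 1 := by
  obtain ⟨e0, e1, hn⟩ := sequence_eq_zero_and_one hs himg
  have hlt : ∀ i j, i < j → j ≤ n → s i < s j := fun i j hij hj => hs (hij.le.trans hj) hj hij
  have hpos : ∀ i, 1 ≤ i → i ≤ n → 0 < s i := fun i hi hin => e0 ▸ hlt 0 i hi hin
  have hnonneg : ∀ i, i ≤ n → 0 ≤ s i := fun i hin =>
    e0 ▸ hs.monotoneOn (Nat.zero_le n) hin (Nat.zero_le i)
  have hIoc : ∀ i, i < n → ∀ t ∈ Set.Ioc (s i) (s (i + 1)), N t = N (s (i + 1)) :=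
    fun i hi t ht => eq_of_mem_Ioc_breakPoints hleft hs himg hi ht
  have hle : ∀ t, 0 < t → N t ≤ d := fun t ht => by
    obtain ⟨t', ht', ht''⟩ := (hzero.and (Ioo_mem_nhdsGT ht)).exists
    exact ht' ▸ hanti t' t ht''.1 ht''.2.le
  have hupper : ∀ i < n, ∀ m, N (s (i + 1)) < m →
      sSup {t : ℝ | t ∈ Set.Ioo 0 1 ∧ m ≤ N t} ≤ s i := by
    intro i hi m hm
    -- The set may be empty, in which case the supremum is 0; this is why s_i ≥ 0 enters.
    refine Real.sSup_le (fun t ht => ?_) (hnonneg i hi.le)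
    by_contra! hcon
    have h1 := hIoc i hi (min t (s (i + 1)))
      ⟨lt_min hcon (hlt i (i + 1) i.lt_succ_self hi), min_le_right _ _⟩
    have h2 := hanti (min t (s (i + 1))) t (lt_min ht.1.1 (hpos _ (by omega) hi)) (min_le_left _ _)
    have h3 := ht.2
    omega
  have hlower : ∀ (t : ℝ) m, t ∈ Set.Ioo (0 : ℝ) 1 → m ≤ N t →
      t ≤ sSup {t : ℝ | t ∈ Set.Ioo 0 1 ∧ m ≤ N t} :=
    fun t m ht hm => le_csSup ⟨1, fun _ h => h.1.2.le⟩ ⟨ht, hm⟩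
  have hIoo : ∀ i, 1 ≤ i → i < n → s i ∈ Set.Ioo (0 : ℝ) 1 := fun i hi hin =>
    ⟨hpos i hi hin.le, e1 ▸ hlt i n hin le_rfl⟩
  have heq : ∀ i j, 1 ≤ i → i < n → d < j + N (s i) → j + N (s (i + 1)) ≤ d → R j = s i := by
    intro i j hi hin h1 h2
    rw [hR]
    exact le_antisymm (hupper i hin _ (by omega)) (hlower _ _ (hIoo i hi hin) (by omega))
  have hiff : ∀ i j, 1 ≤ i → i < n → 1 ≤ j → j ≤ d →
      (R j = s i ↔ d < j + N (s i) ∧ j + N (s (i + 1)) ≤ d) := by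
    intro i j hi hin hj hjd
    refine ⟨fun h => ?_, fun h => heq i j hi hin h.1 h.2⟩
    rw [hR] at h
    constructor
    · by_contra! hcon
      -- If N is already too small at s_i, it is too small on all of (s_{i−1}, s_i], and the
      -- supremum is at most s_{i−1}. For i = 1 this bound is s_0 = 0.
      have h1 : N (s (i - 1 + 1)) < d - j + 1 := by
        rw [Nat.sub_add_cancel hi]
        omega
      exact (hupper (i - 1) (by omega) _ h1).not_gt (h ▸ hlt (i - 1) i (by omega) hin.le)
    · by_contra! hcon
      have h1 := hlt i (i + 1) i.lt_succ_self hin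
      have h2 : s (i + 1) ≤ 1 := e1 ▸ hs.monotoneOn hin (Set.mem_Iic.2 le_rfl) hin
      have h3 := hpos i hi hin.le
      -- If N is still large enough at s_{i+1}, it is so at the midpoint of the interval, which
      -- exceeds s_i. The endpoint s_{i+1} may be 1, which is not an admissible radius.
      have h4 := hIoc i hin ((s i + s (i + 1)) / 2) ⟨by linarith, by linarith⟩
      have h5 := hlower ((s i + s (i + 1)) / 2) (d - j + 1) ⟨by linarith, by linarith⟩ (by omega)
      linarith
  have hone' : ∀ j, 1 ≤ j → j ≤ d → (R j = 1 ↔ j = d) := by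
    intro j hj hjd
    constructor
    · intro h
      by_contra hne
      have h1 := hupper (n - 1) (by omega) (d - j + 1) (by
        rw [Nat.sub_add_cancel hn, e1, hone]
        omega)
      rw [← hR, h, ← e1] at h1
      exact h1.not_gt (hlt (n - 1) n (by omega) le_rfl)
    · rintro rfl
      have h1 : {t : ℝ | t ∈ Set.Ioo 0 1 ∧ j - j + 1 ≤ N t} = Set.Ioo 0 1 := by
        ext t
        refine ⟨fun h => h.1, fun h => ⟨h, ?_⟩⟩
        have := hanti t 1 h.1 h.2.le
        omega
      rw [hR, h1, csSup_Ioo zero_lt_one]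
  refine ⟨?_, by rw [e1, hone], heq, (hone' d hd le_rfl).2 rfl, fun i hi hin => ?_, ?_⟩
  · obtain ⟨t, ht, ht'⟩ := (hzero.and (Ioo_mem_nhdsGT (hpos 1 le_rfl hn))).exists
    rw [← hIoc 0 hn t ⟨e0 ▸ ht'.1, ht'.2.le⟩, ht]
  · have h1 : {j : ℕ | j ∈ Set.Icc 1 d ∧ R j = s i} =
        (Finset.Ioc (d - N (s i)) (d - N (s (i + 1))) : Finset ℕ) := by
      ext j
      rw [Finset.mem_coe, Finset.mem_Ioc]
      have h2 := hle _ (hpos i hi hin.le)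
      have h3 := hle _ (hpos (i + 1) (by omega) hin)
      constructor
      · rintro ⟨⟨hj, hjd⟩, h⟩
        have := (hiff i j hi hin hj hjd).1 h
        omega
      · intro h
        have hj : 1 ≤ j := by omega
        have hjd : j ≤ d := by omega
        exact ⟨⟨hj, hjd⟩, (hiff i j hi hin hj hjd).2 (by omega)⟩
    rw [h1, Set.ncard_coe_finset, Nat.card_Ioc]
    have h2 := hle _ (hpos i hi hin.le)
    have h3 := hanti (s i) (s (i + 1)) (hpos i hi hin.le) (hlt i (i + 1) i.lt_succ_self hin).le
    omega
  · have h1 : {j : ℕ | j ∈ Set.Icc 1 d ∧ R j = 1} = {d} := by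
      ext j
      constructor
      · rintro ⟨⟨hj, hjd⟩, h⟩
        exact (hone' j hj hjd).1 h
      · rintro rfl
        exact ⟨⟨hd, le_rfl⟩, (hone' j hd le_rfl).2 rfl⟩
    rw [h1, Set.ncard_singleton]

end Radii

end PushConst

/-- The radii of convergence of `φ_* (𝒪, d)` at the rational point `x`. -/
theorem mainTheorem5 {k : Type u} [NontriviallyNormedField k] [IsUltrametricDist k]
    [CompleteSpace k] [IsAlgClosed k] [CharZero k]
    (D₂ D₁ : PushConst.StrictOpenDisc k) (φ : PushConst.DiscMorphism D₂ D₁)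
    (hfin : φ.IsFinite) (het : φ.IsEtale) (d : ℕ) (hd : φ.HasDegree d) (x : D₁.RatPoint) :
    (PushConst.breakPoints (φ.numComponents x)).Finite ∧
    ∀ (n : ℕ) (s : ℕ → ℝ), StrictMonoOn s (Set.Iic n) →
      s '' Set.Iic n = PushConst.breakPoints (φ.numComponents x) →
      φ.numComponents x (s 1) = d ∧
      φ.numComponents x (s n) = 1 ∧
      (∀ i j : ℕ, 1 ≤ i → i < n → d < j + φ.numComponents x (s i) →
        j + φ.numComponents x (s (i + 1)) ≤ d →
        (PushConst.pushforwardConstant φ het d hd).radius x j = s i) ∧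
      (PushConst.pushforwardConstant φ het d hd).radius x d = 1 ∧
      (∀ i : ℕ, 1 ≤ i → i < n →
        {j : ℕ | j ∈ Set.Icc 1 d ∧
          (PushConst.pushforwardConstant φ het d hd).radius x j = s i}.ncard +
            φ.numComponents x (s (i + 1)) = φ.numComponents x (s i)) ∧
      {j : ℕ | j ∈ Set.Icc 1 d ∧
        (PushConst.pushforwardConstant φ het d hd).radius x j = 1}.ncard = 1 := by
  obtain ⟨T, hT, σ, hcard, h0, hsymm, hu, hpos, h1, hσ⟩ :=
    PushConst.exists_ultrametric hfin het hd x
  have hN : ∀ s, 0 < s → φ.numComponents x s = PushConst.ballCount σ s := fun s hs => (hσ s hs).1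
  have hT' : Nonempty T := (Nat.card_pos_iff.1 (hcard ▸ hd.pos)).1
  -- The interior discontinuities are among the finitely many values of σ.
  refine ⟨((Set.toFinite {0, 1}).union (Set.finite_range fun p : T × T => σ p.1 p.2)).subset
    (Set.union_subset_union_right _ ?_), ?_⟩
  · rintro s ⟨hs, hc⟩
    by_contra hne
    refine hc ?_
    have h2 : ∀ᶠ t in 𝓝 s, φ.numComponents x t = φ.numComponents x s := by
      filter_upwards [PushConst.eventually_ballCount_eq_of_ne (σ := σ) fun y z h => hne ⟨(y, z), h⟩,
        lt_mem_nhds hs.1] with t ht ht0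
      rw [hN t ht0, hN s hs.1, ht]
    exact continuousAt_const.congr (h2.mono fun t ht => ht.symm)
  · refine PushConst.radii_of_breakPoints hd.pos (fun t t' ht htt => ?_) (fun t ht => ?_) ?_ ?_
      (fun j => ?_)
    · rw [hN t ht, hN t' (ht.trans_le htt)]
      exact PushConst.ballCount_anti (σ := σ) h0 hsymm hu ht htt
    · filter_upwards [PushConst.eventually_ballCount_left (σ := σ) t,
        nhdsWithin_le_nhds (lt_mem_nhds ht)] with t' ht' h0'
      rw [hN t' h0', hN t ht, ht']
    · filter_upwards [PushConst.eventually_ballCount_eq_card h0 hpos,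
        self_mem_nhdsWithin] with t ht ht0
      rw [hN t ht0, ht, hcard]
    · rw [hN 1 one_pos, PushConst.ballCount_eq_one h1]
    · rw [PushConst.DifferentialEquation.radius]
      congr 1
      -- The dimension of the space of horizontal sections and the number of components are the same
      -- ball count, so the radii are the suprema of the sets {N ≥ d − j + 1}.
      ext t
      refine and_congr_right fun ht => ?_
      rw [(hσ t ht.1).2, hN t ht.1, Nat.cast_le]
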